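/- Let $\alpha\in(0,1/2)$ and consider on $\mathbb R^2$ the supercritical surface quasi-geostrophic equation $$\partial_t\theta+u\cdot\nabla\theta+(-\Delta)^{\alpha}\theta=0,\qquad u=R^\perp\theta=(-\mathcal R_{2}\theta,\mathcal R_{1}\theta),$$ where $\mathcal R_j$ is the Riesz transform with symbol $-i\xi_j/|\xi|$. For $q\in(1,\infty)$, $T>0$ and real-valued $\theta_0\in L^q\cap L^2$, a real-valued $\theta\in L^\infty(0,T;L^2\cap L^q)$ is called a (Marchand) weak solution on $\mathbb R^2\times(0,T)$ with initial data $\theta_0$ if for every $\varphi\in C_c^\infty((-\infty,T)\times\mathbb R^2)$ $$\int_0^T\!\!\int \theta\,\partial_t\varphi+\theta\,R^\perp\theta\cdot\nabla\varphi-\theta\,(-\Delta)^\alpha\varphi\;dx\,dt+\int\theta_0\,\varphi(0,\cdot)\,dx=0.$$ Fix a non-negative radial $\chi\in C_c^\infty(B_1)$ with $\chi=1$ on $B_{1/2}$, let $f_{<J}=\Delta_{<J}f$ be the Fourier multiplier with symbol $\chi(2^{-J}\xi)$ (equivalently, $\sum_{j<J}\dot\Delta_jf$ with $\dot\Delta_j$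 of symbol $\chi(2^{-j-1}\xi)-\chi(2^{-j}\xi)$), and let $f_{\ge J}=f-f_{<J}$. **Theorem 1.4.** Let $q\in(1,\infty)$, $p=\frac{2q}{q-1}\in(2,\infty)$, $T>0$, $J\in\mathbb Z$, and let $\theta_1,\theta_2$ be weak solutions on $\mathbb R^2\times(0,T)$ with the same initial data $\theta_0\in L^q\cap L^2$. Put $w=\theta_1-\theta_2$ and suppose that, in the sense of distributions on $(0,T)$, $$\partial_t\|w_{<J}\|_{L^2}^2\le-2\int\big(R^\perp w\cdot\nabla\theta_1+R^\perp\theta_2\cdot\nabla w\big)_{<J}\,w_{<J}\,dx,$$ where $R^\perp w\cdot\nabla\theta_1+R^\perp\theta_2\cdot\nabla w$ denotes the distribution $\nabla\cdot(\theta_1R^\perp w+w\,R^\perp\theta_2)$. If there is $C<\infty$ such that $$\frac{\|w_{\ge J}(t)\|_{L^p}}{\|w_{<J}(t)\|_{L^p}}\le C\qquad\text{for a.e. }t\in(0,T)$$ (with the conventions $0/0=0$ and $a/0=\infty$ for $0<a\le\infty$), then $w=0$, i.e. $\theta_1(t)=\theta_2(t)$ for a.e. $t\in(0,T)$. -/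

import Mathlib

open MeasureTheory FourierTransform
open scoped ENNReal ContDiff

noncomputable section

namespace SQG

/-- The plane `ℝ²` with its Euclidean norm. -/
abbrev Plane : Type := EuclideanSpace ℝ (Fin 2)

/-- Real-valued `L²(ℝ²)`. -/
abbrev L2 : Type := Lp ℝ 2 (volume : Measure Plane)

/-! ### Riesz transforms and the fractional Laplacian

Mathlib's Fourier transform has the kernel `exp (-2πi x·ξ)`, so the frequency variable of the
kernel `exp (-i x·ξ)` is `2π ξ`. -/

/-- The symbol `-i ξⱼ / |ξ|` of the `j`-th Riesz transform (homogeneous of degree zero). -/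
def rieszSymbol (j : Fin 2) (ξ : Plane) : ℂ :=
  -Complex.I * ((ξ j / ‖ξ‖ : ℝ) : ℂ)

lemma measurable_rieszSymbol (j : Fin 2) : Measurable (rieszSymbol j) := by
  unfold rieszSymbol
  fun_prop

lemma norm_rieszSymbol_le (j : Fin 2) (ξ : Plane) : ‖rieszSymbol j ξ‖ ≤ 1 := by
  have h : ‖ξ j‖ ≤ ‖ξ‖ := PiLp.norm_apply_le ξ j
  simp only [rieszSymbol, norm_mul, norm_neg, Complex.norm_I, one_mul, Complex.norm_real,
    norm_div, norm_norm]
  exact div_le_one_of_le₀ h (norm_nonneg _)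

lemma memLp_rieszSymbol_mul (j : Fin 2) (g : Lp ℂ 2 (volume : Measure Plane)) :
    MemLp (fun ξ => rieszSymbol j ξ * g ξ) 2 (volume : Measure Plane) := by
  refine (Lp.memLp g).of_le
    ((measurable_rieszSymbol j).aestronglyMeasurable.mul (Lp.aestronglyMeasurable g)) ?_
  filter_upwards with ξ
  rw [norm_mul]
  exact mul_le_of_le_one_left (norm_nonneg _) (norm_rieszSymbol_le j ξ)

/-- The `j`-th Riesz transform on real `L²(ℝ²)`, as the Fourier multiplier with symbol
`-i ξⱼ / |ξ|`. (It maps real functions to real functions, so the final real part only changes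
the codomain.) -/
def riesz (j : Fin 2) (f : L2) : L2 :=
  Complex.reCLM.compLp
    (𝓕⁻ ((memLp_rieszSymbol_mul j (𝓕 (Complex.ofRealCLM.compLp f))).toLp
      (fun ξ => rieszSymbol j ξ * (𝓕 (Complex.ofRealCLM.compLp f)) ξ)) :
      Lp ℂ 2 (volume : Measure Plane))

/-- The velocity `R^⊥ f = (-R₂ f, R₁ f)`. -/
def rieszPerp (f : L2) : Fin 2 → L2 :=
  ![-riesz 1 f, riesz 0 f]

/-- `(-Δ)^α g` for a smooth compactly supported `g`: the Fourier multiplier with symbol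
`|ξ|^{2α}`. -/
def fracLaplacian (α : ℝ) (g : Plane → ℝ) (x : Plane) : ℝ :=
  (𝓕⁻ (fun ξ : Plane => (((2 * Real.pi * ‖ξ‖) ^ (2 * α) : ℝ) : ℂ) *
    𝓕 (fun y : Plane => ((g y : ℝ) : ℂ)) ξ) x).re

/-! ### Weak solutions -/

/-- `θ` is a weak solution, in the sense of Marchand, of
`∂ₜθ + u·∇θ + (-Δ)^α θ = 0`, `u = R^⊥ θ`, on `ℝ² × (0,T)` with initial datum `θ₀ ∈ L² ∩ L^q`:
it belongs to `L^∞(0,T; L² ∩ L^q)` and satisfies the equation, in the divergence form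
`∂ₜθ + ∇·(θ u) + (-Δ)^α θ = 0`, and the initial condition in the sense of distributions.
As usual, `θ` is a class of functions of time modulo null sets. -/
structure IsMarchandSolution (α q T : ℝ) (θ₀ : L2) (θ : ℝ → L2) : Prop where
  aestronglyMeasurable : AEStronglyMeasurable θ (volume.restrict (Set.Ioo 0 T))
  bounded : ∃ M : ℝ, ∀ᵐ t ∂(volume.restrict (Set.Ioo 0 T)),
    eLpNorm (θ t) 2 volume ≤ ENNReal.ofReal M ∧
      eLpNorm (θ t) (ENNReal.ofReal q) volume ≤ ENNReal.ofReal M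
  weak : ∀ φ : ℝ × Plane → ℝ, ContDiff ℝ ∞ φ → HasCompactSupport φ →
    tsupport φ ⊆ Set.Iio T ×ˢ Set.univ →
    (∫ t in Set.Ioo 0 T,
        ((∫ x, θ t x * deriv (fun s => φ (s, x)) t)
          + (∫ x, ∑ i : Fin 2, θ t x * rieszPerp (θ t) i x *
              fderiv ℝ (fun y => φ (t, y)) x (EuclideanSpace.single i 1))
          - ∫ x, θ t x * fracLaplacian α (fun y => φ (t, y)) x))
      + ∫ x, θ₀ x * φ (0, x) = 0

/-! ### Littlewood-Paley truncations -/

/-- The cut-off functions generating the Littlewood-Paley decomposition: non-negative, radial,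
smooth, compactly supported in the open unit ball, equal to `1` on the ball of radius `1/2`. -/
structure IsCutoff (χ : Plane → ℝ) : Prop where
  smooth : ContDiff ℝ ∞ χ
  compactSupport : HasCompactSupport χ
  support_subset : tsupport χ ⊆ Metric.ball 0 1
  nonneg : ∀ ξ, 0 ≤ χ ξ
  radial : ∀ ξ η, ‖ξ‖ = ‖η‖ → χ ξ = χ η
  eq_one : ∀ ξ ∈ Metric.ball (0 : Plane) (1 / 2), χ ξ = 1

/-- The symbol `φⱼ(ξ) = φ(2^{-j} ξ)`, `φ(ξ) = χ(ξ/2) - χ(ξ)`, of the homogeneous dyadic block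
`Δ̇ⱼ`. -/
def blockSymbol (χ : Plane → ℝ) (j : ℤ) (ξ : Plane) : ℝ :=
  χ ((2 : ℝ)⁻¹ • (((2 : ℝ) ^ (-j)) • ξ)) - χ (((2 : ℝ) ^ (-j)) • ξ)

/-- The symbol of `Δ_{<J}`. -/
def lowSymbol (χ : Plane → ℝ) (J : ℤ) (ξ : Plane) : ℝ :=
  χ (((2 : ℝ) ^ (-J)) • ξ)

/-- `Δ_{<J} = ∑_{j<J} Δ̇ⱼ` on the level of symbols. -/
lemma hasSum_blockSymbol {χ : Plane → ℝ} (hχ : IsCutoff χ) (J : ℤ) {ξ : Plane} (hξ : ξ ≠ 0) :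
    HasSum (fun n : ℕ => blockSymbol χ (J - 1 - n) ξ) (lowSymbol χ J ξ) := by
  have step : ∀ n : ℕ, blockSymbol χ (J - 1 - n) ξ =
      lowSymbol χ (J - n) ξ - lowSymbol χ (J - (n + 1 : ℕ)) ξ := by
    intro n
    unfold blockSymbol lowSymbol
    rw [smul_smul]
    have h1 : (2 : ℝ)⁻¹ * 2 ^ (-(J - 1 - (n : ℤ))) = 2 ^ (-(J - (n : ℤ))) := by
      rw [← zpow_neg_one, ← zpow_add₀ (by norm_num)]
      congr 1
      ring
    have h2 : (-(J - 1 - (n : ℤ))) = -(J - ((n + 1 : ℕ) : ℤ)) := by push_cast; ring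
    rw [h1, h2]
  obtain ⟨N, hN⟩ : ∃ N : ℕ, (2 : ℝ) ^ J / ‖ξ‖ < 2 ^ N := pow_unbounded_of_one_lt _ (by norm_num)
  have zero : ∀ n : ℕ, N ≤ n → lowSymbol χ (J - n) ξ = 0 := by
    intro n hn
    unfold lowSymbol
    refine image_eq_zero_of_notMem_tsupport (fun h => ?_)
    have h' := hχ.support_subset h
    have hpos : 0 < ‖ξ‖ := norm_pos_iff.mpr hξ
    rw [mem_ball_zero_iff, norm_smul, Real.norm_of_nonneg (by positivity)] at h'
    have h3 : (2 : ℝ) ^ J < 2 ^ n * ‖ξ‖ := by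
      have : (2 : ℝ) ^ N ≤ 2 ^ n := pow_le_pow_right₀ (by norm_num) hn
      rw [div_lt_iff₀ hpos] at hN
      nlinarith
    have h4 : (2 : ℝ) ^ (-(J - (n : ℤ))) = 2 ^ n / 2 ^ J := by
      rw [neg_sub, zpow_sub₀ (by norm_num), zpow_natCast]
    rw [h4, div_mul_eq_mul_div, div_lt_one (by positivity)] at h'
    linarith
  have hs : HasSum (fun n : ℕ => blockSymbol χ (J - 1 - n) ξ)
      (∑ n ∈ Finset.range N, blockSymbol χ (J - 1 - n) ξ) := by
    refine hasSum_sum_of_ne_finset_zero (fun n hn => ?_)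
    rw [Finset.mem_range, not_lt] at hn
    rw [step, zero n hn, zero (n + 1) (by omega), sub_zero]
  convert hs using 1
  rw [Finset.sum_congr rfl (fun n _ => step n),
    Finset.sum_range_sub' (fun n : ℕ => lowSymbol χ (J - n) ξ), zero N le_rfl]
  simp

/-- The convolution kernel of `Δ_{<J}`, the inverse Fourier transform of its symbol. It is real
because the symbol is radial. -/
def lowKernel (χ : Plane → ℝ) (J : ℤ) (x : Plane) : ℝ :=
  (𝓕⁻ (fun ξ : Plane => ((lowSymbol χ J ((2 * Real.pi) • ξ) : ℝ) : ℂ)) x).re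

/-- `f_{<J} = Δ_{<J} f`. -/
def low (χ : Plane → ℝ) (J : ℤ) (f : Plane → ℝ) (x : Plane) : ℝ :=
  ∫ y, lowKernel χ J (x - y) * f y

/-- `f_{≥J} = f - Δ_{<J} f`. -/
def high (χ : Plane → ℝ) (J : ℤ) (f : Plane → ℝ) (x : Plane) : ℝ :=
  f x - low χ J f x

/-- `(∇·F)_{<J}` for an integrable vector field `F`, whose divergence is a distribution: the
convolution of `∇·F` with the smooth kernel of `Δ_{<J}`, i.e. `∑ᵢ (∂ᵢK) * Fᵢ`. -/
def lowDiv (χ : Plane → ℝ) (J : ℤ) (F : Fin 2 → Plane → ℝ) (x : Plane) : ℝ :=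
  ∑ i : Fin 2, ∫ y, fderiv ℝ (lowKernel χ J) (x - y) (EuclideanSpace.single i 1) * F i y

/-- The flux of the nonlinear terms in the equation of `w = θ₁ - θ₂` : since `R^⊥ w` and
`R^⊥ θ₂` are divergence free,
`R^⊥ w · ∇θ₁ + R^⊥ θ₂ · ∇w = ∇·(θ₁ R^⊥ w + w R^⊥ θ₂)`. -/
def flux (θ₁ θ₂ : L2) (i : Fin 2) (x : Plane) : ℝ :=
  θ₁ x * rieszPerp (θ₁ - θ₂) i x + (θ₁ - θ₂ : L2) x * rieszPerp θ₂ i x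

/-- `∫ (R^⊥ w · ∇θ₁ + R^⊥ θ₂ · ∇w)_{<J} w_{<J} dx` with `w = θ₁ - θ₂`. -/
def transfer (χ : Plane → ℝ) (J : ℤ) (θ₁ θ₂ : L2) : ℝ :=
  ∫ x, lowDiv χ J (flux θ₁ θ₂) x * low χ J ((θ₁ - θ₂ : L2) : Plane → ℝ) x

/-- The energy inequality
`∂ₜ ‖w_{<J}‖²_{L²} ≤ -2 ∫ (R^⊥ w · ∇θ₁ + R^⊥ θ₂ · ∇w)_{<J} w_{<J} dx`, `w = θ₁ - θ₂`,
in the sense of distributions on `(0,T)`. -/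
def LowEnergyInequality (χ : Plane → ℝ) (J : ℤ) (T : ℝ) (θ₁ θ₂ : ℝ → L2) : Prop :=
  ∀ ψ : ℝ → ℝ, ContDiff ℝ ∞ ψ → HasCompactSupport ψ → tsupport ψ ⊆ Set.Ioo 0 T →
    (∀ t, 0 ≤ ψ t) →
    -(∫ t in Set.Ioo 0 T,
        deriv ψ t * ∫ x, (low χ J ((θ₁ t - θ₂ t : L2) : Plane → ℝ) x) ^ 2)
      ≤ ∫ t in Set.Ioo 0 T, ψ t * (-2 * transfer χ J (θ₁ t) (θ₂ t))

end SQG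

end

noncomputable section

namespace SQG

open scoped SchwartzMap ComplexConjugate LineDeriv
open Filter Topology

variable {χ : Plane → ℝ}

/-! Put `w = θ₁ - θ₂` and `m = θ₁ + θ₂`. Symmetrised, the flux is `(m R^⊥ w + w R^⊥ m) / 2`: the
terms quadratic in `w` cancel (`flux_ae_eq`). Moving the truncation and the divergence onto
`w_{<J}`, the transfer term becomes a sum of integrals `∫ (m Rⱼ w + w Rⱼ m) V`, where `V` is a very
smooth function built linearly from `w_{<J}` (`transfer_eq`).

The kernel `k` of `Rⱼ` is odd, so this integral is formally the commutator form `∬ m(x) k(x - y)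
w(y) (V(x) - V(y))`. Decompose `k` into dyadic blocks. At high frequencies the Lipschitz bounds on
`V`, in `L^∞` and in `L²`, leave the first moment of the block, of size `2^{-n}`. At low frequencies
no cancellation is needed: Young's inequality leaves the `L^{p'}` norm of the block, of size
`2^{2n/p}`. Both series converge, so the form is bounded by `‖m‖_{L²} ‖w‖_{L^p}` times the bound on
`V`, for every `p > 2` (`enorm_integral_symm_riesz_le`). Hence the transfer is at most a constant
times `‖m‖_{L²} ‖w‖_{L^p} ‖w_{<J}‖_{L²}` (`enorm_transfer_le`).

The assumption on the ratio and Bernstein's inequality give `‖w‖_{L^p} ≲ ‖w_{<J}‖_{L²}`, so the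
energy `E = ‖w_{<J}‖²` satisfies `E' ≤ cE` on the open interval. That inequality does not see time
zero. The missing initial condition comes from the weak formulations: their common datum cancels,
and `‖w_{<J}(t)‖ ≤ K t` follows by duality (`exists_ae_norm_lowL2_sub_le`). Gronwall's inequality
(`ae_eq_zero_of_gronwall`) gives `w_{<J} = 0`, and the ratio bound then forces `w = 0`. -/

/-- Complex-valued `L²(ℝ²)`. -/
abbrev L2C : Type := Lp ℂ 2 (volume : Measure Plane)

/-! ### Fourier inversion on `L¹` and `L²`, and convolution with Schwartz functions -/

lemma integral_schwartz_mul_fourierInv (g : 𝓢(Plane, ℂ)) {h : Plane → ℂ} (h1 : Integrable h) :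
    ∫ x, g x * 𝓕⁻ h x = ∫ ξ, 𝓕⁻ g ξ * h ξ := by
  have := VectorFourier.integral_bilin_fourierIntegral_eq_flip (μ := (volume : Measure Plane))
    (ν := (volume : Measure Plane)) (f := g) (g := h) (.mul ℂ ℂ : ℂ →L[ℂ] ℂ →L[ℂ] ℂ)
    (L := -innerₗ Plane) Real.continuous_fourierChar
    (continuous_inner (𝕜 := ℝ) (E := Plane)).neg g.integrable h1
  have hflip : (-innerₗ Plane).flip = -innerₗ Plane := by
    ext x y; simp [real_inner_comm]
  rw [hflip] at this
  rw [SchwartzMap.fourierInv_coe]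
  exact this.symm

lemma integral_schwartz_mul_fourierInv_lp (g : 𝓢(Plane, ℂ)) (F : L2C) :
    ∫ x, g x * (𝓕⁻ F : L2C) x = ∫ ξ, 𝓕⁻ g ξ * F ξ := by
  have h := congrArg (fun T => T g) (Lp.fourierInv_toTemperedDistribution_eq F)
  simp only [TemperedDistribution.fourierInv_apply, Lp.toTemperedDistribution_apply,
    smul_eq_mul] at h
  exact h.symm

lemma continuous_fourierInv {h : Plane → ℂ} (h1 : Integrable h) : Continuous (𝓕⁻ h) := by
  have : 𝓕⁻ h = fun x => 𝓕 h (-x) := funext fun x => Real.fourierInv_eq_fourier_neg h x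
  rw [this]
  exact (VectorFourier.fourierIntegral_continuous (L := innerₗ Plane) Real.continuous_fourierChar
    (continuous_inner (𝕜 := ℝ) (E := Plane)) h1).comp continuous_neg

/-- On `L¹ ∩ L²` the pointwise inverse Fourier transform is the one of `L²`. -/
lemma fourierInv_ae_eq {h : Plane → ℂ} (h1 : Integrable h) (h2 : MemLp h 2) :
    𝓕⁻ h =ᵐ[volume] (𝓕⁻ (h2.toLp h) : L2C) := by
  -- Both sides are tested against smooth compactly supported functions; there the transform can be
  -- moved onto the test function, for `L¹` and for `L²` alike.
  refine ae_eq_of_integral_contDiff_smul_eq (continuous_fourierInv h1).locallyIntegrable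
    ((Lp.memLp _).locallyIntegrable (by norm_num)) (fun g hg hgc => ?_)
  have hgc' : HasCompactSupport (fun x => (g x : ℂ)) := hgc.comp_left (g := Complex.ofReal) Complex.ofReal_zero
  have hg' : ContDiff ℝ ∞ (fun x => (g x : ℂ)) := Complex.ofRealCLM.contDiff.comp hg
  set G := hgc'.toSchwartzMap hg' with hG
  have hGx : ∀ x, G x = (g x : ℂ) := fun x => rfl
  clear_value G
  have e1 := integral_schwartz_mul_fourierInv G h1
  have e2 := integral_schwartz_mul_fourierInv_lp G (h2.toLp h)
  have e3 : ∫ ξ, 𝓕⁻ G ξ * h ξ = ∫ ξ, 𝓕⁻ G ξ * h2.toLp h ξ :=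
    integral_congr_ae (by filter_upwards [h2.coeFn_toLp] with x hx; rw [hx])
  simp only [Complex.real_smul, ← hGx]
  exact e1.trans (e3.trans e2.symm)

lemma norm_fourierInv_le (h : Plane → ℂ) (x : Plane) : ‖𝓕⁻ h x‖ ≤ ∫ ξ, ‖h ξ‖ :=
  VectorFourier.norm_fourierIntegral_le_integral_norm _ _ _ _ _

/-- The function `y ↦ Ψ (x - y)`. -/
def reflect (Ψ : 𝓢(Plane, ℂ)) (x : Plane) : 𝓢(Plane, ℂ) :=
  SchwartzMap.compSubConstCLM ℂ x
    (SchwartzMap.compCLMOfContinuousLinearEquiv ℂ (ContinuousLinearEquiv.neg ℝ) Ψ)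

@[simp] lemma reflect_apply (Ψ : 𝓢(Plane, ℂ)) (x y : Plane) : reflect Ψ x y = Ψ (x - y) := by
  simp [reflect]

lemma fourierInv_reflect (Ψ : 𝓢(Plane, ℂ)) (x ξ : Plane) :
    𝓕⁻ (reflect Ψ x) ξ = Real.fourierChar (inner ℝ ξ x) • 𝓕 Ψ ξ := by
  rw [SchwartzMap.fourierInv_coe, SchwartzMap.fourier_coe, Real.fourierInv_eq, Real.fourier_eq,
    ← integral_sub_left_eq_self _ _ x, Circle.smul_def, ← integral_smul]
  congr 1 with y
  simp only [reflect_apply, sub_sub_cancel, Circle.smul_def, smul_smul, inner_sub_left,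
    ← Circle.coe_mul, ← AddChar.map_add_eq_mul]
  rw [real_inner_comm, sub_eq_add_neg]

/-- Convolution with a Schwartz function on `L²` is a Fourier multiplier. -/
lemma convolution_eq_fourierInv (Ψ : 𝓢(Plane, ℂ)) (F : L2C) (x : Plane) :
    ∫ y, Ψ (x - y) * F y = 𝓕⁻ (fun ξ => 𝓕 Ψ ξ * (𝓕 F : L2C) ξ) x := by
  have h := integral_schwartz_mul_fourierInv_lp (reflect Ψ x) (𝓕 F)
  rw [FourierTransform.fourierInv_fourier_eq] at h
  simp only [reflect_apply] at h
  rw [h, Real.fourierInv_eq]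
  congr 1 with ξ
  rw [fourierInv_reflect, smul_mul_assoc]

lemma integrable_schwartz_mul (Φ : 𝓢(Plane, ℂ)) (F : L2C) : Integrable (fun ξ => Φ ξ * F ξ) :=
  MemLp.integrable_mul (Φ.memLp 2) (Lp.memLp F)

lemma exists_schwartz_bound (Φ : 𝓢(Plane, ℂ)) : ∃ C, 0 < C ∧ ∀ ξ, ‖Φ ξ‖ ≤ C := by
  obtain ⟨C, h0, hC⟩ := Φ.decay 0 0
  exact ⟨C, h0, fun ξ => by simpa using hC ξ⟩

lemma memLp_bounded_mul {σ : Plane → ℂ} (hσ : Measurable σ) {C : ℝ} (hC : ∀ ξ, ‖σ ξ‖ ≤ C)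
    (F : L2C) : MemLp (fun ξ => σ ξ * F ξ) 2 := by
  refine (Lp.memLp F).of_le_mul (c := C) (hσ.aestronglyMeasurable.mul (Lp.aestronglyMeasurable F))
    (.of_forall fun ξ => ?_)
  rw [norm_mul]
  exact mul_le_mul_of_nonneg_right (hC ξ) (norm_nonneg _)

lemma memLp_schwartz_mul (Φ : 𝓢(Plane, ℂ)) (F : L2C) : MemLp (fun ξ => Φ ξ * F ξ) 2 := by
  obtain ⟨C, -, hC⟩ := exists_schwartz_bound Φ
  exact memLp_bounded_mul Φ.continuous.measurable hC F

lemma norm_toLp_bounded_mul_le {σ : Plane → ℂ} {C : ℝ} (hC : ∀ ξ, ‖σ ξ‖ ≤ C)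
    (F : L2C) (h : MemLp (fun ξ => σ ξ * F ξ) 2) : ‖h.toLp _‖ ≤ C * ‖F‖ := by
  refine Lp.norm_le_mul_norm_of_ae_le_mul ?_
  filter_upwards [h.coeFn_toLp] with ξ hξ
  rw [hξ, norm_mul]
  exact mul_le_mul_of_nonneg_right (hC ξ) (norm_nonneg _)

/-! ### Real `L²` functions, Riesz transforms and Plancherel pairings -/

/-- A real `L²` function as a complex one. -/
def toC (f : L2) : L2C := Complex.ofRealCLM.compLp f

lemma coeFn_toC (f : L2) : (toC f : Plane → ℂ) =ᵐ[volume] fun x => (f x : ℂ) :=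
  Complex.ofRealCLM.coeFn_compLp f

lemma norm_toC (f : L2) : ‖toC f‖ = ‖f‖ := by
  apply le_antisymm
  · refine Lp.norm_le_norm_of_ae_le ?_
    filter_upwards [coeFn_toC f] with x hx
    simp [hx]
  · refine Lp.norm_le_norm_of_ae_le ?_
    filter_upwards [coeFn_toC f] with x hx
    simp [hx]

lemma toC_add (f g : L2) : toC (f + g) = toC f + toC g := (Complex.ofRealCLM.compLpₗ 2 (volume : Measure Plane)).map_add f g

/-- Real part of the convolution of a real function with a Schwartz function, through the Fourier
transform. -/
lemma integral_re_schwartz_mul (Ψ : 𝓢(Plane, ℂ)) (f : L2) (x : Plane) :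
    ∫ y, (Ψ (x - y)).re * f y = (𝓕⁻ (fun ξ => 𝓕 Ψ ξ * (𝓕 (toC f) : L2C) ξ) x).re := by
  rw [← convolution_eq_fourierInv]
  have hi : Integrable (fun y => Ψ (x - y) * toC f y) := by
    simpa using integrable_schwartz_mul (reflect Ψ x) (toC f)
  have := integral_re hi
  simp only [RCLike.re_eq_complex_re] at this
  rw [← this]
  refine integral_congr_ae ?_
  filter_upwards [coeFn_toC f] with y hy
  simp [hy]

lemma norm_rieszSymbol_mul_le (j : Fin 2) (F : L2C) :
    ‖(memLp_rieszSymbol_mul j F).toLp _‖ ≤ ‖F‖ := by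
  simpa using norm_toLp_bounded_mul_le (norm_rieszSymbol_le j) F (memLp_rieszSymbol_mul j F)

lemma riesz_eq (j : Fin 2) (f : L2) : riesz j f =
    Complex.reCLM.compLp (𝓕⁻ ((memLp_rieszSymbol_mul j (𝓕 (toC f))).toLp _) : L2C) := rfl

lemma norm_re_compLp_le (F : L2C) : ‖(Complex.reCLM.compLp F : L2)‖ ≤ ‖F‖ := by
  refine Lp.norm_le_norm_of_ae_le ?_
  filter_upwards [Complex.reCLM.coeFn_compLp F] with x hx
  rw [hx]
  exact Complex.abs_re_le_norm _

lemma norm_fourierInv_lp (F : L2C) : ‖(𝓕⁻ F : L2C)‖ = ‖F‖ :=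
  (Lp.fourierTransformₗᵢ Plane ℂ).symm.norm_map F

lemma norm_riesz_le (j : Fin 2) (f : L2) : ‖riesz j f‖ ≤ ‖f‖ := by
  rw [riesz_eq]
  refine (norm_re_compLp_le _).trans ?_
  rw [norm_fourierInv_lp]
  refine (norm_rieszSymbol_mul_le j _).trans ?_
  rw [Lp.norm_fourier_eq, norm_toC]

lemma riesz_add (j : Fin 2) (f g : L2) : riesz j (f + g) = riesz j f + riesz j g := by
  have h : (memLp_rieszSymbol_mul j (𝓕 (toC (f + g)))).toLp _ =
      (memLp_rieszSymbol_mul j (𝓕 (toC f))).toLp _ +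
        (memLp_rieszSymbol_mul j (𝓕 (toC g))).toLp _ := by
    rw [← MemLp.toLp_add, MemLp.toLp_eq_toLp_iff, toC_add, FourierTransform.fourier_add]
    filter_upwards [Lp.coeFn_add (𝓕 (toC f) : L2C) (𝓕 (toC g))] with x hx
    simp only [hx, Pi.add_apply, mul_add]
  rw [riesz_eq, h, FourierTransform.fourierInv_add]
  exact (Complex.reCLM.compLpₗ 2 (volume : Measure Plane)).map_add _ _

/-- The Riesz transforms as additive maps. -/
def rieszHom (j : Fin 2) : L2 →+ L2 := AddMonoidHom.mk' (riesz j) (riesz_add j)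

lemma riesz_sub (j : Fin 2) (f g : L2) : riesz j (f - g) = riesz j f - riesz j g :=
  (rieszHom j).map_sub f g

lemma continuous_riesz (j : Fin 2) : Continuous (riesz j) := by
  have : LipschitzWith 1 (riesz j) := LipschitzWith.of_dist_le_mul fun f g => by
    rw [dist_eq_norm, dist_eq_norm, ← riesz_sub]
    simpa using norm_riesz_le j (f - g)
  exact this.continuous

lemma rieszPerp_zero (f : L2) : rieszPerp f 0 = -riesz 1 f := rfl
lemma rieszPerp_one (f : L2) : rieszPerp f 1 = riesz 0 f := rfl

lemma rieszPerp_sub (f g : L2) (i : Fin 2) :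
    rieszPerp (f - g) i = rieszPerp f i - rieszPerp g i := by
  fin_cases i
  · simp only [Fin.zero_eta, rieszPerp_zero, riesz_sub]; abel
  · simp only [Fin.mk_one, rieszPerp_one, riesz_sub]

lemma norm_rieszPerp_le (f : L2) (i : Fin 2) : ‖rieszPerp f i‖ ≤ ‖f‖ := by
  fin_cases i
  · simpa [rieszPerp_zero] using norm_riesz_le 1 f
  · simpa [rieszPerp_one] using norm_riesz_le 0 f

lemma continuous_rieszPerp (i : Fin 2) : Continuous fun f => rieszPerp f i := by
  fin_cases i
  · exact (continuous_riesz 1).neg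
  · simpa [rieszPerp_one] using continuous_riesz 0

lemma integrable_conj_mul (F H : L2C) : Integrable (fun ξ => conj (F ξ) * H ξ) := by
  have : MemLp (fun ξ => conj (F ξ)) 2 (volume : Measure Plane) :=
    (Lp.memLp F).of_le (Complex.continuous_conj.comp_aestronglyMeasurable
      (Lp.aestronglyMeasurable F)) (.of_forall fun ξ => by simp)
  exact this.integrable_mul (Lp.memLp H)

/-- Plancherel's identity for the pairing of a real function with the real part of a complex one. -/
lemma integral_mul_re (G : L2) (H : L2C) :
    ∫ x, G x * (H x).re = (∫ ξ, conj ((𝓕 (toC G) : L2C) ξ) * (𝓕 H : L2C) ξ).re := by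
  have h := Lp.inner_fourier_eq (toC G) H
  rw [L2.inner_def, L2.inner_def] at h
  simp only [RCLike.inner_apply'] at h
  erw [h]
  have := integral_re (integrable_conj_mul (toC G) H)
  simp only [RCLike.re_eq_complex_re] at this
  refine Eq.trans ?_ this
  refine integral_congr_ae ?_
  filter_upwards [coeFn_toC G] with x hx
  simp [hx]

lemma integral_mul_re_fourierInv (G : L2) {h : Plane → ℂ} (h2 : MemLp h 2) :
    ∫ x, G x * ((𝓕⁻ (h2.toLp h) : L2C) x).re =
      (∫ ξ, conj ((𝓕 (toC G) : L2C) ξ) * h ξ).re := by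
  rw [integral_mul_re, FourierTransform.fourier_fourierInv_eq]
  congr 1
  refine integral_congr_ae ?_
  filter_upwards [h2.coeFn_toLp] with ξ hξ
  rw [hξ]

lemma integral_mul_riesz (j : Fin 2) (G f : L2) :
    ∫ x, G x * riesz j f x = (∫ ξ, conj ((𝓕 (toC G) : L2C) ξ) *
      (rieszSymbol j ξ * (𝓕 (toC f) : L2C) ξ)).re := by
  rw [← integral_mul_re_fourierInv G (memLp_rieszSymbol_mul j (𝓕 (toC f))), riesz_eq]
  refine integral_congr_ae ?_
  filter_upwards [Complex.reCLM.coeFn_compLp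
    (𝓕⁻ ((memLp_rieszSymbol_mul j (𝓕 (toC f))).toLp _) : L2C)] with x hx
  rw [hx]; rfl

lemma integral_mul_convolution (Ψ : 𝓢(Plane, ℂ)) (G f : L2) :
    ∫ x, G x * ∫ y, (Ψ (x - y)).re * f y = (∫ ξ, conj ((𝓕 (toC G) : L2C) ξ) *
      (𝓕 Ψ ξ * (𝓕 (toC f) : L2C) ξ)).re := by
  rw [← integral_mul_re_fourierInv G (memLp_schwartz_mul (𝓕 Ψ) (𝓕 (toC f)))]
  refine integral_congr_ae ?_
  filter_upwards [fourierInv_ae_eq (integrable_schwartz_mul (𝓕 Ψ) (𝓕 (toC f)))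
    (memLp_schwartz_mul (𝓕 Ψ) (𝓕 (toC f)))] with x hx
  rw [integral_re_schwartz_mul, hx]

lemma eLpNorm_re_fourierInv_le {h : Plane → ℂ} (h1 : Integrable h) (h2 : MemLp h 2) :
    MemLp (fun x => (𝓕⁻ h x).re) 2 ∧
      eLpNorm (fun x => (𝓕⁻ h x).re) 2 volume ≤ ENNReal.ofReal ‖h2.toLp h‖ := by
  have hle : eLpNorm (fun x => (𝓕⁻ h x).re) 2 volume ≤ ENNReal.ofReal ‖h2.toLp h‖ := by
    rw [← norm_fourierInv_lp, Lp.norm_def, ENNReal.ofReal_toReal (Lp.eLpNorm_ne_top _),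
      ← eLpNorm_congr_ae (fourierInv_ae_eq h1 h2)]
    exact eLpNorm_mono fun x => Complex.abs_re_le_norm _
  exact ⟨⟨(Complex.continuous_re.comp (continuous_fourierInv h1)).aestronglyMeasurable,
    hle.trans_lt ENNReal.ofReal_lt_top⟩, hle⟩

/-! ### Dyadic blocks of the Riesz transforms and their kernels -/

/-- The part of the symbol of a Riesz transform at frequencies of size `2 ^ n`. -/
def blockRiesz (χ : Plane → ℝ) (j : Fin 2) (n : ℤ) (ξ : Plane) : ℂ :=
  rieszSymbol j ξ * ((lowSymbol χ (n + 1) ξ - lowSymbol χ n ξ : ℝ) : ℂ)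

lemma rieszSymbol_smul (j : Fin 2) {c : ℝ} (hc : 0 < c) (ξ : Plane) :
    rieszSymbol j (c • ξ) = rieszSymbol j ξ := by
  unfold rieszSymbol
  rw [norm_smul, Real.norm_of_nonneg hc.le, PiLp.smul_apply, smul_eq_mul,
    mul_div_mul_left _ _ hc.ne']

lemma rieszSymbol_neg (j : Fin 2) (ξ : Plane) : rieszSymbol j (-ξ) = -rieszSymbol j ξ := by
  simp [rieszSymbol, neg_div]

lemma IsCutoff.map_neg (hχ : IsCutoff χ) (ξ : Plane) : χ (-ξ) = χ ξ := hχ.radial _ _ (norm_neg ξ)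

lemma IsCutoff.exists_bound (hχ : IsCutoff χ) : ∃ C, 0 < C ∧ ∀ ξ, χ ξ ≤ C := by
  obtain ⟨C, hC⟩ := hχ.compactSupport.exists_bound_of_continuous hχ.smooth.continuous
  exact ⟨max C 1, by positivity, fun ξ => (le_abs_self _).trans ((hC ξ).trans (le_max_left _ _))⟩

lemma IsCutoff.eq_zero (hχ : IsCutoff χ) {ξ : Plane} (h : 1 ≤ ‖ξ‖) : χ ξ = 0 :=
  image_eq_zero_of_notMem_tsupport fun h' => by
    have := hχ.support_subset h'
    rw [mem_ball_zero_iff] at this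
    linarith

lemma lowSymbol_add (χ : Plane → ℝ) (n m : ℤ) (ξ : Plane) :
    lowSymbol χ (n + m) ξ = lowSymbol χ m ((2 : ℝ) ^ (-n) • ξ) := by
  unfold lowSymbol
  rw [smul_smul, ← zpow_add₀ (by norm_num)]
  congr 3
  ring

/-- The Riesz symbol is homogeneous of degree zero, so every block is a dilate of the block zero.
All kernel estimates reduce to `n = 0` in this way. -/
lemma blockRiesz_eq_smul (χ : Plane → ℝ) (j : Fin 2) (n : ℤ) (ξ : Plane) :
    blockRiesz χ j n ξ = blockRiesz χ j 0 ((2 : ℝ) ^ (-n) • ξ) := by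
  unfold blockRiesz
  rw [rieszSymbol_smul j (by positivity), ← lowSymbol_add, ← lowSymbol_add, add_zero, zero_add]

lemma blockRiesz_neg (hχ : IsCutoff χ) (j : Fin 2) (n : ℤ) (ξ : Plane) :
    blockRiesz χ j n (-ξ) = -blockRiesz χ j n ξ := by
  unfold blockRiesz lowSymbol
  rw [rieszSymbol_neg, smul_neg, smul_neg, hχ.map_neg, hχ.map_neg, neg_mul]

lemma contDiff_lowSymbol (hχ : IsCutoff χ) (n : ℤ) : ContDiff ℝ ∞ (lowSymbol χ n) :=
  hχ.smooth.comp (contDiff_const_smul _)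

/-- The only singularity of `ξⱼ / |ξ|` is the origin, near which both cut-offs equal one and their
difference vanishes. -/
lemma contDiff_blockRiesz (hχ : IsCutoff χ) (j : Fin 2) (n : ℤ) :
    ContDiff ℝ ∞ (blockRiesz χ j n) := by
  have h0 : ContDiff ℝ ∞ (blockRiesz χ j 0) := by
    rw [contDiff_iff_contDiffAt]
    intro ξ
    by_cases hξ : ξ = 0
    · have : blockRiesz χ j 0 =ᶠ[𝓝 ξ] fun _ => 0 := by
        filter_upwards [Metric.ball_mem_nhds ξ (show (0 : ℝ) < 1 / 2 by norm_num)] with η hη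
        rw [hξ] at hη
        have h1 : lowSymbol χ 0 η = 1 := by
          simpa [lowSymbol] using hχ.eq_one η hη
        have h2 : lowSymbol χ (0 + 1) η = 1 := by
          refine hχ.eq_one _ ?_
          rw [mem_ball_zero_iff] at hη ⊢
          rw [norm_smul]
          norm_num
          linarith [norm_nonneg η]
        rw [blockRiesz, h1, h2]
        simp
      exact contDiffAt_const.congr_of_eventuallyEq this
    · have hcoord : ContDiffAt ℝ ∞ (fun η : Plane => η j / ‖η‖) ξ := by
        refine ContDiffAt.div ?_ (contDiffAt_norm ℝ hξ) (norm_ne_zero_iff.mpr hξ)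
        exact (EuclideanSpace.proj (𝕜 := ℝ) j).contDiff.contDiffAt
      refine ContDiffAt.mul (contDiffAt_const.mul ?_) ?_
      · exact Complex.ofRealCLM.contDiff.contDiffAt.comp ξ hcoord
      · exact (Complex.ofRealCLM.contDiff.comp
          ((contDiff_lowSymbol hχ _).sub (contDiff_lowSymbol hχ _))).contDiffAt
  have : blockRiesz χ j n = fun ξ => blockRiesz χ j 0 ((2 : ℝ) ^ (-n) • ξ) :=
    funext (blockRiesz_eq_smul χ j n)
  rw [this]
  exact h0.comp (contDiff_const_smul _)

lemma lowSymbol_eq_zero (hχ : IsCutoff χ) {n : ℤ} {ξ : Plane} (h : (2 : ℝ) ^ n ≤ ‖ξ‖) :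
    lowSymbol χ n ξ = 0 := by
  refine hχ.eq_zero ?_
  rw [norm_smul, Real.norm_of_nonneg (by positivity), zpow_neg, ← div_eq_inv_mul]
  exact (one_le_div (by positivity)).mpr h

lemma hasCompactSupport_blockRiesz (hχ : IsCutoff χ) (j : Fin 2) (n : ℤ) :
    HasCompactSupport (blockRiesz χ j n) := by
  refine HasCompactSupport.of_support_subset_isCompact
    (isCompact_closedBall (0 : Plane) ((2 : ℝ) ^ (n + 1))) (fun ξ hξ => ?_)
  by_contra h
  rw [mem_closedBall_zero_iff, not_le] at h
  have h2 : (2 : ℝ) ^ n ≤ 2 ^ (n + 1) := zpow_le_zpow_right₀ (by norm_num) (by omega)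
  refine hξ ?_
  rw [blockRiesz, lowSymbol_eq_zero hχ h.le, lowSymbol_eq_zero hχ (h2.trans h.le)]
  simp

/-- The convolution kernel with symbol `blockRiesz`. -/
def blockKernel (hχ : IsCutoff χ) (j : Fin 2) (n : ℤ) : 𝓢(Plane, ℂ) :=
  𝓕⁻ ((hasCompactSupport_blockRiesz hχ j n).toSchwartzMap (contDiff_blockRiesz hχ j n))

lemma fourier_blockKernel (hχ : IsCutoff χ) (j : Fin 2) (n : ℤ) (ξ : Plane) :
    𝓕 (blockKernel hχ j n) ξ = blockRiesz χ j n ξ := by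
  rw [blockKernel, FourierTransform.fourier_fourierInv_eq]; rfl

lemma blockKernel_apply (hχ : IsCutoff χ) (j : Fin 2) (n : ℤ) (x : Plane) :
    blockKernel hχ j n x = 𝓕⁻ (blockRiesz χ j n) x := by
  rw [blockKernel, SchwartzMap.fourierInv_coe]; rfl

/-- The Riesz symbol is odd and `χ` is even. Oddness of the kernel is what later produces the
difference `V(x) - V(y)`. -/
lemma blockKernel_neg (hχ : IsCutoff χ) (j : Fin 2) (n : ℤ) (x : Plane) :
    blockKernel hχ j n (-x) = -blockKernel hχ j n x := by
  rw [blockKernel_apply, blockKernel_apply, Real.fourierInv_eq_fourier_neg, neg_neg,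
    Real.fourierInv_eq_fourier_comp_neg]
  simp only [blockRiesz_neg hχ, Real.fourier_eq, smul_neg, integral_neg, neg_neg]

lemma blockKernel_eq_smul (hχ : IsCutoff χ) (j : Fin 2) (n : ℤ) (x : Plane) :
    blockKernel hχ j n x = (((2 : ℝ) ^ n) ^ 2 : ℝ) • blockKernel hχ j 0 ((2 : ℝ) ^ n • x) := by
  have hc : (0 : ℝ) < 2 ^ n := by positivity
  rw [blockKernel_apply, blockKernel_apply, Real.fourierInv_eq, Real.fourierInv_eq]
  have := Measure.integral_comp_smul (volume : Measure Plane)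
    (fun v => Real.fourierChar (inner ℝ v ((2 : ℝ) ^ n • x)) • blockRiesz χ j 0 v) ((2 : ℝ) ^ (-n))
  simp only [← blockRiesz_eq_smul] at this
  rw [finrank_euclideanSpace_fin, zpow_neg, inv_pow, inv_inv, abs_of_pos (by positivity)] at this
  rw [← this]
  congr 1 with v
  rw [real_inner_smul_left, real_inner_smul_right, inv_mul_cancel_left₀ hc.ne']

/-- The real convolution kernel of a dyadic block of a Riesz transform. -/
def rieszKernel (hχ : IsCutoff χ) (j : Fin 2) (n : ℤ) (x : Plane) : ℝ := (blockKernel hχ j n x).re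

lemma rieszKernel_neg (hχ : IsCutoff χ) (j : Fin 2) (n : ℤ) (x : Plane) :
    rieszKernel hχ j n (-x) = -rieszKernel hχ j n x := by
  simp [rieszKernel, blockKernel_neg]

lemma rieszKernel_eq_smul (hχ : IsCutoff χ) (j : Fin 2) (n : ℤ) (x : Plane) :
    rieszKernel hχ j n x = ((2 : ℝ) ^ n) ^ 2 * rieszKernel hχ j 0 ((2 : ℝ) ^ n • x) := by
  rw [rieszKernel, blockKernel_eq_smul, Complex.smul_re, smul_eq_mul]; rfl

lemma continuous_rieszKernel (hχ : IsCutoff χ) (j : Fin 2) (n : ℤ) :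
    Continuous (rieszKernel hχ j n) :=
  Complex.continuous_re.comp (blockKernel hχ j n).continuous

lemma lintegral_comp_smul_plane {f : Plane → ℝ≥0∞} (hf : Measurable f) {c : ℝ} (hc : 0 < c) :
    ∫⁻ x, f (c • x) = ENNReal.ofReal ((c ^ 2)⁻¹) * ∫⁻ x, f x := by
  have h := lintegral_map (μ := (volume : Measure Plane)) hf (measurable_const_smul c)
  rw [← h, Measure.map_addHaar_smul _ hc.ne', lintegral_smul_measure,
    finrank_euclideanSpace_fin, abs_of_pos (by positivity), smul_eq_mul]

/-- The amplitude `2^{2n}` cancels the Jacobian in the plane, and the weight `‖z‖` contributes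
`2^{-n}`, summable as `n → +∞`. -/
lemma lintegral_norm_mul_rieszKernel (hχ : IsCutoff χ) (j : Fin 2) (n : ℤ) :
    ∫⁻ z, ENNReal.ofReal ‖z‖ * ‖rieszKernel hχ j n z‖ₑ =
      ENNReal.ofReal (2 ^ (-n)) * ∫⁻ z, ENNReal.ofReal ‖z‖ * ‖rieszKernel hχ j 0 z‖ₑ := by
  have hc : (0 : ℝ) < 2 ^ n := by positivity
  have hm : Measurable fun z : Plane => ENNReal.ofReal ‖z‖ * ‖rieszKernel hχ j 0 z‖ₑ :=
    (by fun_prop : Measurable fun z : Plane => ENNReal.ofReal ‖z‖).mul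
      (continuous_rieszKernel hχ j 0).measurable.enorm
  have h := lintegral_comp_smul_plane hm hc
  have e : ∀ z : Plane, ENNReal.ofReal ‖z‖ * ‖rieszKernel hχ j n z‖ₑ =
      ENNReal.ofReal (2 ^ n) * (ENNReal.ofReal ‖(2 : ℝ) ^ n • z‖ *
        ‖rieszKernel hχ j 0 ((2 : ℝ) ^ n • z)‖ₑ) := by
    intro z
    rw [rieszKernel_eq_smul, enorm_mul, norm_smul, ENNReal.ofReal_mul (norm_nonneg _),
      Real.norm_of_nonneg hc.le, Real.enorm_of_nonneg (by positivity), pow_two,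
      ENNReal.ofReal_mul hc.le]
    ring
  simp_rw [e]
  rw [lintegral_const_mul' _ _ ENNReal.ofReal_ne_top, h, ← mul_assoc, ← ENNReal.ofReal_mul hc.le]
  congr 2
  rw [zpow_neg]
  field_simp

/-- The amplitude gives `2^{2n}` and the Jacobian `2^{-2n/b}`. For `b > 1` the exponent is positive,
hence summable as `n → -∞`. -/
lemma lintegral_rieszKernel_rpow (hχ : IsCutoff χ) (j : Fin 2) (n : ℤ) {b : ℝ} (hb : 0 < b) :
    (∫⁻ z, ‖rieszKernel hχ j n z‖ₑ ^ b) ^ (1 / b) =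
      ENNReal.ofReal (((2 : ℝ) ^ n) ^ (2 - 2 / b)) *
        (∫⁻ z, ‖rieszKernel hχ j 0 z‖ₑ ^ b) ^ (1 / b) := by
  have hc : (0 : ℝ) < 2 ^ n := by positivity
  have hm : Measurable fun z : Plane => ‖rieszKernel hχ j 0 z‖ₑ ^ b :=
    (continuous_rieszKernel hχ j 0).measurable.enorm.pow_const b
  have h := lintegral_comp_smul_plane hm hc
  have e : ∀ z : Plane, ‖rieszKernel hχ j n z‖ₑ ^ b = ENNReal.ofReal (((2 : ℝ) ^ n) ^ (2 * b)) *
      ‖rieszKernel hχ j 0 ((2 : ℝ) ^ n • z)‖ₑ ^ b := by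
    intro z
    rw [rieszKernel_eq_smul, enorm_mul, ENNReal.mul_rpow_of_nonneg _ _ hb.le,
      Real.enorm_of_nonneg (by positivity), ENNReal.ofReal_rpow_of_nonneg (by positivity) hb.le,
      Real.rpow_mul hc.le, Real.rpow_two]
  simp_rw [e]
  rw [lintegral_const_mul' _ _ ENNReal.ofReal_ne_top, h, ← mul_assoc,
    ← ENNReal.ofReal_mul (by positivity), ENNReal.mul_rpow_of_nonneg _ _ (by positivity),
    ENNReal.ofReal_rpow_of_nonneg (by positivity) (by positivity)]
  congr 2
  rw [← Real.rpow_two, ← Real.rpow_neg hc.le, ← Real.rpow_add hc, ← Real.rpow_mul hc.le]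
  congr 1
  field_simp
  ring

lemma lintegral_norm_mul_rieszKernel_lt_top (hχ : IsCutoff χ) (j : Fin 2) (n : ℤ) :
    ∫⁻ z, ENNReal.ofReal ‖z‖ * ‖rieszKernel hχ j n z‖ₑ < ⊤ := by
  have h := ((blockKernel hχ j n).integrable_pow_mul (volume : Measure Plane) 1).lintegral_lt_top
  refine lt_of_le_of_lt (lintegral_mono fun z => ?_) h
  rw [pow_one, ENNReal.ofReal_mul (norm_nonneg _), ofReal_norm (blockKernel hχ j n z)]
  gcongr
  exact enorm_le_iff_norm_le.mpr (Complex.abs_re_le_norm _)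

lemma memLp_rieszKernel (hχ : IsCutoff χ) (j : Fin 2) (n : ℤ) (p : ℝ≥0∞) :
    MemLp (rieszKernel hχ j n) p :=
  ((blockKernel hχ j n).memLp p).of_le (continuous_rieszKernel hχ j n).aestronglyMeasurable
    (.of_forall fun _ => Complex.abs_re_le_norm _)

lemma lintegral_rieszKernel_rpow_lt_top (hχ : IsCutoff χ) (j : Fin 2) (n : ℤ) {b : ℝ}
    (hb : 0 < b) : (∫⁻ z, ‖rieszKernel hχ j n z‖ₑ ^ b) ^ (1 / b) < ⊤ := by
  have h := (memLp_rieszKernel hχ j n (ENNReal.ofReal b)).eLpNorm_lt_top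
  rwa [eLpNorm_eq_lintegral_rpow_enorm_toReal (by simpa using hb) ENNReal.ofReal_ne_top,
    ENNReal.toReal_ofReal hb.le] at h

/-- The pairing of `G` with the `n`-th dyadic block of the `j`-th Riesz transform of `f`. -/
def blockPairing (hχ : IsCutoff χ) (j : Fin 2) (n : ℤ) (G f : L2) : ℝ :=
  ∫ x, G x * ∫ y, rieszKernel hχ j n (x - y) * f y

lemma tendsto_lowSymbol_atTop (hχ : IsCutoff χ) (ξ : Plane) :
    ∀ᶠ N : ℕ in atTop, lowSymbol χ (N : ℤ) ξ = 1 := by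
  obtain ⟨N, hN⟩ : ∃ N : ℕ, 2 * ‖ξ‖ < 2 ^ N := pow_unbounded_of_one_lt _ (by norm_num)
  filter_upwards [eventually_ge_atTop N] with n hn
  refine hχ.eq_one _ ?_
  have : (2 : ℝ) ^ N ≤ 2 ^ n := pow_le_pow_right₀ (by norm_num) hn
  rw [mem_ball_zero_iff, norm_smul, Real.norm_of_nonneg (by positivity), zpow_neg, zpow_natCast,
    ← div_eq_inv_mul, div_lt_iff₀ (by positivity)]
  linarith

lemma tendsto_lowSymbol_atBot (hχ : IsCutoff χ) {ξ : Plane} (hξ : ξ ≠ 0) :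
    ∀ᶠ N : ℕ in atTop, lowSymbol χ (-(N : ℤ)) ξ = 0 := by
  have hpos : 0 < ‖ξ‖ := norm_pos_iff.mpr hξ
  obtain ⟨N, hN⟩ : ∃ N : ℕ, 1 / ‖ξ‖ < 2 ^ N := pow_unbounded_of_one_lt _ (by norm_num)
  filter_upwards [eventually_ge_atTop N] with n hn
  refine lowSymbol_eq_zero hχ ?_
  have : (2 : ℝ) ^ N ≤ 2 ^ n := pow_le_pow_right₀ (by norm_num) hn
  rw [zpow_neg, zpow_natCast]
  rw [div_lt_iff₀ hpos] at hN
  rw [inv_le_iff_one_le_mul₀ (by positivity)]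
  nlinarith

/-- The blocks telescope. Pairing the index `n` with `-n - 1` exhausts the integers by a sequence
over the naturals. -/
lemma sum_blockRiesz (χ : Plane → ℝ) (j : Fin 2) (N : ℕ) (ξ : Plane) :
    ∑ n ∈ Finset.range N, (blockRiesz χ j n ξ + blockRiesz χ j (-(n : ℤ) - 1) ξ) =
      rieszSymbol j ξ * ((lowSymbol χ N ξ - lowSymbol χ (-(N : ℤ)) ξ : ℝ) : ℂ) := by
  induction N with
  | zero => simp
  | succ N ih =>
    rw [Finset.sum_range_succ, ih]
    unfold blockRiesz
    rw [sub_add_cancel]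
    push_cast
    rw [neg_add, sub_eq_add_neg (-(N : ℤ)) 1]
    ring

/-- By Plancherel the partial sums carry the Riesz symbol times a cut-off that is bounded uniformly
in `N` and eventually equal to one at each nonzero frequency; dominated convergence applies. -/
lemma tendsto_sum_blockPairing (hχ : IsCutoff χ) (j : Fin 2) (G f : L2) :
    Tendsto (fun N : ℕ => ∑ n ∈ Finset.range N,
      (blockPairing hχ j n G f + blockPairing hχ j (-(n : ℤ) - 1) G f)) atTop
      (𝓝 (∫ x, G x * riesz j f x)) := by
  set A : L2C := 𝓕 (toC G)
  set B : L2C := 𝓕 (toC f)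
  have hp : ∀ n : ℤ, blockPairing hχ j n G f =
      (∫ ξ, conj (A ξ) * (blockRiesz χ j n ξ * B ξ)).re := by
    intro n
    simp only [blockPairing, rieszKernel, integral_mul_convolution, fourier_blockKernel]
    rfl
  have hint : ∀ n : ℤ, Integrable fun ξ => conj (A ξ) * (blockRiesz χ j n ξ * B ξ) := by
    intro n
    have h2 := memLp_schwartz_mul (𝓕 (blockKernel hχ j n)) B
    simp only [fourier_blockKernel] at h2
    refine (integrable_conj_mul A (h2.toLp _)).congr ?_
    filter_upwards [h2.coeFn_toLp] with ξ hξ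
    rw [hξ]
  have hsum : ∀ N : ℕ, ∑ n ∈ Finset.range N,
      (blockPairing hχ j n G f + blockPairing hχ j (-(n : ℤ) - 1) G f) =
      (∫ ξ, conj (A ξ) * ((rieszSymbol j ξ *
        ((lowSymbol χ N ξ - lowSymbol χ (-(N : ℤ)) ξ : ℝ) : ℂ)) * B ξ)).re := by
    intro N
    simp_rw [hp, ← sum_blockRiesz, Finset.sum_mul, Finset.mul_sum, add_mul, mul_add]
    have hI : ∀ n ∈ Finset.range N, Integrable fun ξ =>
        conj (A ξ) * (blockRiesz χ j n ξ * B ξ) +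
          conj (A ξ) * (blockRiesz χ j (-(n : ℤ) - 1) ξ * B ξ) := fun n _ => (hint _).add (hint _)
    rw [integral_finsetSum _ hI, Complex.re_sum]
    refine Finset.sum_congr rfl fun n _ => ?_
    rw [integral_add (hint _) (hint _), Complex.add_re]
  simp_rw [hsum]
  rw [integral_mul_riesz]
  refine (Complex.continuous_re.tendsto _).comp ?_
  obtain ⟨C, hC0, hC⟩ := hχ.exists_bound
  refine tendsto_integral_of_dominated_convergence (fun ξ => 2 * C * ‖conj (A ξ) * B ξ‖)
    (fun N => ?_) ((integrable_conj_mul A B).norm.const_mul _) (fun N => .of_forall fun ξ => ?_) ?_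
  · simp_rw [← sum_blockRiesz, Finset.sum_mul, Finset.mul_sum, add_mul, mul_add]
    exact (integrable_finsetSum _ fun n _ => (hint _).add (hint _)).aestronglyMeasurable
  · have h1 := norm_rieszSymbol_le j ξ
    have h2 : |lowSymbol χ N ξ - lowSymbol χ (-(N : ℤ)) ξ| ≤ 2 * C := by
      rw [abs_le]
      constructor <;> linarith [hC ((2 : ℝ) ^ (-(N : ℤ)) • ξ), hχ.nonneg ((2 : ℝ) ^ (-(N : ℤ)) • ξ),
        hC ((2 : ℝ) ^ (- -(N : ℤ)) • ξ), hχ.nonneg ((2 : ℝ) ^ (- -(N : ℤ)) • ξ),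
        show lowSymbol χ N ξ = χ ((2 : ℝ) ^ (-(N : ℤ)) • ξ) from rfl,
        show lowSymbol χ (-(N : ℤ)) ξ = χ ((2 : ℝ) ^ (- -(N : ℤ)) • ξ) from rfl]
    simp only [norm_mul, Complex.norm_real, Real.norm_eq_abs]
    calc _ ≤ ‖conj (A ξ)‖ * (1 * (2 * C) * ‖B ξ‖) := by gcongr
      _ = _ := by ring
  · have h0 : ∀ᵐ ξ : Plane, ξ ≠ 0 := by
      simp [ae_iff, measure_singleton]
    filter_upwards [h0] with ξ hξ
    refine tendsto_const_nhds.congr' ?_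
    filter_upwards [tendsto_lowSymbol_atTop hχ ξ, tendsto_lowSymbol_atBot hχ hξ] with N h1 h2
    rw [h1, h2]
    simp [A, B]

/-! ### Hölder, interpolation and Young inequalities -/

/-- The `L^p` norm of a function with values in `[0, ∞]`. -/
def lpNorm (p : ℝ) (f : Plane → ℝ≥0∞) : ℝ≥0∞ := (∫⁻ x, f x ^ p) ^ (1 / p)

lemma eLpNorm_eq_lpNorm {p : ℝ} (hp : 0 < p) (f : Plane → ℝ) :
    eLpNorm f (ENNReal.ofReal p) volume = lpNorm p fun x => ‖f x‖ₑ := by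
  rw [eLpNorm_eq_lintegral_rpow_enorm_toReal (by simpa using hp) ENNReal.ofReal_ne_top,
    ENNReal.toReal_ofReal hp.le, lpNorm]

lemma eLpNorm_two_eq_lpNorm (f : Plane → ℝ) :
    eLpNorm f 2 volume = lpNorm 2 fun x => ‖f x‖ₑ := by
  rw [← eLpNorm_eq_lpNorm (by norm_num)]
  norm_num

lemma lpNorm_rpow {p : ℝ} (hp : p ≠ 0) (f : Plane → ℝ≥0∞) : lpNorm p f ^ p = ∫⁻ x, f x ^ p := by
  rw [lpNorm, ← ENNReal.rpow_mul, one_div_mul_cancel hp, ENNReal.rpow_one]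

lemma lintegral_mul_mul_le {f g h : Plane → ℝ≥0∞} (hf : Measurable f) (hg : Measurable g)
    (hh : Measurable h) {a b c : ℝ} (ha : 0 < a) (hb : 0 < b) (hc : 0 < c)
    (habc : 1 / a + 1 / b + 1 / c = 1) :
    ∫⁻ x, f x * g x * h x ≤ lpNorm a f * lpNorm b g * lpNorm c h := by
  have H := ENNReal.lintegral_prod_norm_pow_le (μ := (volume : Measure Plane)) Finset.univ
    (f := ![fun x => f x ^ a, fun x => g x ^ b, fun x => h x ^ c]) (p := ![1 / a, 1 / b, 1 / c])
    (fun i _ => by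
      fin_cases i
      · exact (hf.pow_const a).aemeasurable
      · exact (hg.pow_const b).aemeasurable
      · exact (hh.pow_const c).aemeasurable)
    (by simpa [Fin.sum_univ_three] using habc)
    (fun i _ => by fin_cases i <;> simp <;> positivity)
  simp only [Fin.prod_univ_three, Matrix.cons_val_zero, Matrix.cons_val_one,
    Matrix.cons_val] at H
  refine le_trans (le_of_eq ?_) H
  refine lintegral_congr fun x => ?_
  rw [← ENNReal.rpow_mul, ← ENNReal.rpow_mul, ← ENNReal.rpow_mul, mul_one_div_cancel ha.ne',
    mul_one_div_cancel hb.ne', mul_one_div_cancel hc.ne']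
  simp

/-- Interpolation between `L²` and `L^∞`: `h^r ≤ B^{r-2} h²`. -/
lemma lpNorm_le_of_le {h : Plane → ℝ≥0∞} {B : ℝ≥0∞} (hB : ∀ x, h x ≤ B)
    (h2 : lpNorm 2 h ≤ B) {r : ℝ} (hr : 2 ≤ r) : lpNorm r h ≤ B := by
  have hr0 : 0 < r := by linarith
  by_cases htop : B = ⊤
  · simp [htop]
  have h3 : ∫⁻ x, h x ^ r ≤ B ^ r := by
    calc ∫⁻ x, h x ^ r ≤ ∫⁻ x, B ^ (r - 2) * h x ^ (2 : ℝ) := by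
          refine lintegral_mono fun x => ?_
          have : h x ^ r = h x ^ (r - 2) * h x ^ (2 : ℝ) := by
            rw [← ENNReal.rpow_add_of_nonneg _ _ (by linarith) (by norm_num)]
            congr 1; ring
          rw [this]
          gcongr
          exact hB x
      _ = B ^ (r - 2) * lpNorm 2 h ^ (2 : ℝ) := by
          rw [lintegral_const_mul' _ _ (ENNReal.rpow_ne_top_of_nonneg (by linarith) htop),
            lpNorm_rpow (by norm_num)]
      _ ≤ B ^ (r - 2) * B ^ (2 : ℝ) := by gcongr
      _ = B ^ r := by
          rw [← ENNReal.rpow_add_of_nonneg _ _ (by linarith) (by norm_num)]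
          congr 1; ring
  calc lpNorm r h ≤ (B ^ r) ^ (1 / r) := ENNReal.rpow_le_rpow h3 (by positivity)
    _ = B := by rw [← ENNReal.rpow_mul, mul_one_div_cancel hr0.ne', ENNReal.rpow_one]

/-- Young's convolution inequality in trilinear form. -/
lemma lintegral_convolution_le {f k g : Plane → ℝ≥0∞} (hf : Measurable f) (hk : Measurable k)
    (hg : Measurable g) {a b c : ℝ} (ha : 1 ≤ a) (hb : 1 ≤ b) (hc : 1 ≤ c)
    (habc : 1 / a + 1 / b + 1 / c = 2) :
    ∫⁻ x, ∫⁻ y, f x * k (x - y) * g y ≤ lpNorm a f * lpNorm b k * lpNorm c g := by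
  have ha0 : 0 < a := by linarith
  have hb0 : 0 < b := by linarith
  have hc0 : 0 < c := by linarith
  have ha1 : 0 ≤ 1 - 1 / a := sub_nonneg.mpr ((div_le_one ha0).mpr ha)
  have hb1 : 0 ≤ 1 - 1 / b := sub_nonneg.mpr ((div_le_one hb0).mpr hb)
  have hc1 : 0 ≤ 1 - 1 / c := sub_nonneg.mpr ((div_le_one hc0).mpr hc)
  have mf : Measurable fun z : Plane × Plane => f z.1 ^ a :=
    (hf.comp measurable_fst).pow_const a
  have mk : Measurable fun z : Plane × Plane => k (z.1 - z.2) ^ b :=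
    (hk.comp (measurable_fst.sub measurable_snd)).pow_const b
  have mg : Measurable fun z : Plane × Plane => g z.2 ^ c :=
    (hg.comp measurable_snd).pow_const c
  -- Hölder on the product space for the factorisation `f k g = (k^b g^c)^{1-1/a} (f^a g^c)^{1-1/b}
  -- (f^a k^b)^{1-1/c}`. The three weights add up to one, and each factor is recovered since, for
  -- example, `(1 - 1/b) + (1 - 1/c) = 1/a`.
  have H := ENNReal.lintegral_prod_norm_pow_le (μ := (volume : Measure Plane).prod volume)
    Finset.univ
    (f := ![fun z => k (z.1 - z.2) ^ b * g z.2 ^ c, fun z => f z.1 ^ a * g z.2 ^ c,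
      fun z => f z.1 ^ a * k (z.1 - z.2) ^ b]) (p := ![1 - 1 / a, 1 - 1 / b, 1 - 1 / c])
    (fun i _ => by
      fin_cases i
      · exact (mk.mul mg).aemeasurable
      · exact (mf.mul mg).aemeasurable
      · exact (mf.mul mk).aemeasurable)
    (by simp only [Fin.sum_univ_three, Matrix.cons_val_zero, Matrix.cons_val_one,
          Matrix.cons_val]; linarith)
    (fun i _ => by
      fin_cases i
      exacts [ha1, hb1, hc1])
  simp only [Fin.prod_univ_three, Matrix.cons_val_zero, Matrix.cons_val_one,
    Matrix.cons_val] at H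
  have mkg : Measurable fun z : Plane × Plane => k (z.1 - z.2) ^ b * g z.2 ^ c := mk.mul mg
  have mfk : Measurable fun z : Plane × Plane => f z.1 ^ a * k (z.1 - z.2) ^ b := mf.mul mk
  have e0 : ∫⁻ z, k (z.1 - z.2) ^ b * g z.2 ^ c ∂((volume : Measure Plane).prod volume) =
      lpNorm b k ^ b * lpNorm c g ^ c := by
    rw [lintegral_prod_symm _ mkg.aemeasurable]
    simp only
    have : ∀ y : Plane, ∫⁻ x, k (x - y) ^ b * g y ^ c = (∫⁻ x, k x ^ b) * g y ^ c := fun y => by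
      rw [lintegral_mul_const _ (by fun_prop), lintegral_sub_right_eq_self (fun x => k x ^ b) y]
    simp_rw [this]
    rw [lintegral_const_mul _ (by fun_prop), lpNorm_rpow hb0.ne', lpNorm_rpow hc0.ne']
  have e1 : ∫⁻ z, f z.1 ^ a * g z.2 ^ c ∂((volume : Measure Plane).prod volume) =
      lpNorm a f ^ a * lpNorm c g ^ c := by
    rw [lintegral_prod_mul (f := fun x => f x ^ a) (g := fun y => g y ^ c) (by fun_prop)
      (by fun_prop), lpNorm_rpow ha0.ne', lpNorm_rpow hc0.ne']
  have e2 : ∫⁻ z, f z.1 ^ a * k (z.1 - z.2) ^ b ∂((volume : Measure Plane).prod volume) =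
      lpNorm a f ^ a * lpNorm b k ^ b := by
    rw [lintegral_prod _ mfk.aemeasurable]
    simp only
    have : ∀ x : Plane, ∫⁻ y, f x ^ a * k (x - y) ^ b = f x ^ a * ∫⁻ y, k y ^ b := fun x => by
      rw [lintegral_const_mul _ (by fun_prop), lintegral_sub_left_eq_self (fun y => k y ^ b) x]
    simp_rw [this]
    rw [lintegral_mul_const _ (by fun_prop), lpNorm_rpow ha0.ne', lpNorm_rpow hb0.ne']
  have key : ∀ X Y Z : ℝ≥0∞, (Y ^ b * Z ^ c) ^ (1 - 1 / a) * (X ^ a * Z ^ c) ^ (1 - 1 / b) *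
      (X ^ a * Y ^ b) ^ (1 - 1 / c) = X * Y * Z := by
    intro X Y Z
    rw [ENNReal.mul_rpow_of_nonneg _ _ ha1, ENNReal.mul_rpow_of_nonneg _ _ hb1,
      ENNReal.mul_rpow_of_nonneg _ _ hc1]
    simp only [← ENNReal.rpow_mul]
    have hX : X ^ (a * (1 - 1 / b)) * X ^ (a * (1 - 1 / c)) = X := by
      rw [← ENNReal.rpow_add_of_nonneg _ _ (by positivity) (by positivity), ← mul_add]
      have : a * (1 - 1 / b + (1 - 1 / c)) = 1 := by
        rw [show 1 - 1 / b + (1 - 1 / c) = 1 / a by linarith, mul_one_div_cancel ha0.ne']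
      rw [this, ENNReal.rpow_one]
    have hY : Y ^ (b * (1 - 1 / a)) * Y ^ (b * (1 - 1 / c)) = Y := by
      rw [← ENNReal.rpow_add_of_nonneg _ _ (by positivity) (by positivity), ← mul_add]
      have : b * (1 - 1 / a + (1 - 1 / c)) = 1 := by
        rw [show 1 - 1 / a + (1 - 1 / c) = 1 / b by linarith, mul_one_div_cancel hb0.ne']
      rw [this, ENNReal.rpow_one]
    have hZ : Z ^ (c * (1 - 1 / a)) * Z ^ (c * (1 - 1 / b)) = Z := by
      rw [← ENNReal.rpow_add_of_nonneg _ _ (by positivity) (by positivity), ← mul_add]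
      have : c * (1 - 1 / a + (1 - 1 / b)) = 1 := by
        rw [show 1 - 1 / a + (1 - 1 / b) = 1 / c by linarith, mul_one_div_cancel hc0.ne']
      rw [this, ENNReal.rpow_one]
    calc _ = (X ^ (a * (1 - 1 / b)) * X ^ (a * (1 - 1 / c))) *
          (Y ^ (b * (1 - 1 / a)) * Y ^ (b * (1 - 1 / c))) *
          (Z ^ (c * (1 - 1 / a)) * Z ^ (c * (1 - 1 / b))) := by ring
      _ = _ := by rw [hX, hY, hZ]
  rw [e0, e1, e2, key] at H
  simp_rw [key] at H
  rwa [lintegral_prod _ (by fun_prop)] at H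

/-! ### The commutator estimate -/

/-- The absolute value of the commutator form of a kernel `k`. -/
def absForm (k m w V : Plane → ℝ) : ℝ≥0∞ :=
  ∫⁻ x, ∫⁻ y, ‖m x‖ₑ * ‖k (x - y)‖ₑ * ‖w y‖ₑ * ‖V x - V y‖ₑ

/-- Bound for kernels with a first moment, through the differences of `V`. -/
lemma absForm_le_of_moment {k m w V : Plane → ℝ} (hk : Measurable k) (hm : Measurable m)
    (hw : Measurable w) (hV : Measurable V) {p : ℝ} (hp : 2 < p) {B : ℝ} (hB : 0 ≤ B)
    (hV1 : ∀ x z, |V x - V (x - z)| ≤ B * ‖z‖)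
    (hV2 : ∀ z, eLpNorm (fun x => V x - V (x - z)) 2 volume ≤ ENNReal.ofReal (B * ‖z‖)) :
    absForm k m w V ≤ (∫⁻ z, ENNReal.ofReal ‖z‖ * ‖k z‖ₑ) *
      (ENNReal.ofReal B * eLpNorm m 2 volume * eLpNorm w (ENNReal.ofReal p) volume) := by
  have hp0 : 0 < p := by linarith
  -- The third Hölder exponent beside `2` and `p`. It is at least `2`, so the differences of `V` can
  -- be interpolated between `L²` and `L^∞`.
  set r : ℝ := (1 / 2 - 1 / p)⁻¹ with hr
  have h1p : 0 < 1 / 2 - 1 / p := by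
    rw [sub_pos]; exact one_div_lt_one_div_of_lt (by norm_num) hp
  have hr0 : 0 < r := inv_pos.mpr h1p
  have hr2 : 2 ≤ r := by
    rw [hr, le_inv_comm₀ (by norm_num) h1p]
    have : 0 < 1 / p := by positivity
    norm_num at this ⊢
    exact hp0.le
  have hsum : 1 / 2 + 1 / p + 1 / r = 1 := by rw [hr, one_div, one_div, one_div, inv_inv]; ring
  -- With `z = x - y` as a variable, Hölder can be used in `x` for fixed `z`, leaving only `‖z‖
  -- |k(z)|` to integrate.
  have step : absForm k m w V = ∫⁻ z, ‖k z‖ₑ *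
      ∫⁻ x, ‖m x‖ₑ * ‖w (x - z)‖ₑ * ‖V x - V (x - z)‖ₑ := by
    calc absForm k m w V
        = ∫⁻ x, ∫⁻ z, ‖m x‖ₑ * ‖k z‖ₑ * ‖w (x - z)‖ₑ * ‖V x - V (x - z)‖ₑ := by
          refine lintegral_congr fun x => ?_
          rw [← lintegral_sub_left_eq_self _ x]
          simp only [sub_sub_cancel]
      _ = ∫⁻ z, ∫⁻ x, ‖m x‖ₑ * ‖k z‖ₑ * ‖w (x - z)‖ₑ * ‖V x - V (x - z)‖ₑ :=
          lintegral_lintegral_swap (by fun_prop)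
      _ = _ := by
          refine lintegral_congr fun z => ?_
          rw [← lintegral_const_mul _ (by fun_prop)]
          refine lintegral_congr fun x => ?_
          ring
  rw [step, ← lintegral_mul_const _ (by fun_prop)]
  refine lintegral_mono fun z => ?_
  have hD : lpNorm r (fun x => ‖V x - V (x - z)‖ₑ) ≤ ENNReal.ofReal (B * ‖z‖) := by
    refine lpNorm_le_of_le (fun x => ?_) ?_ hr2
    · rw [Real.enorm_eq_ofReal_abs]
      exact ENNReal.ofReal_le_ofReal (hV1 x z)
    · rw [← eLpNorm_two_eq_lpNorm fun x => V x - V (x - z)]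
      exact hV2 z
  have hwz : lpNorm p (fun x => ‖w (x - z)‖ₑ) = lpNorm p fun x => ‖w x‖ₑ := by
    unfold lpNorm
    rw [lintegral_sub_right_eq_self (fun x => ‖w x‖ₑ ^ p) z]
  have h := lintegral_mul_mul_le (f := fun x => ‖m x‖ₑ) (g := fun x => ‖w (x - z)‖ₑ)
    (h := fun x => ‖V x - V (x - z)‖ₑ) (by fun_prop) (by fun_prop) (by fun_prop)
    (by norm_num : (0 : ℝ) < 2) hp0 hr0 hsum
  rw [hwz] at h
  rw [eLpNorm_two_eq_lpNorm, eLpNorm_eq_lpNorm hp0]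
  calc _ ≤ ‖k z‖ₑ * (lpNorm 2 (fun x => ‖m x‖ₑ) * lpNorm p (fun x => ‖w x‖ₑ) *
        ENNReal.ofReal (B * ‖z‖)) := by
          gcongr
          exact h.trans (by gcongr)
    _ = _ := by rw [ENNReal.ofReal_mul hB]; ring

/-- Bound for integrable kernels, without using cancellation. -/
lemma absForm_le_of_rpow {k m w V : Plane → ℝ} (hk : Measurable k) (hm : Measurable m)
    (hw : Measurable w) (hV : Measurable V) {p : ℝ} (hp : 2 < p) {B : ℝ}
    (hV2 : eLpNorm V 2 volume ≤ ENNReal.ofReal B) :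
    absForm k m w V ≤ 2 * lpNorm (p / (p - 1)) (fun z => ‖k z‖ₑ) *
      (ENNReal.ofReal B * eLpNorm m 2 volume * eLpNorm w (ENNReal.ofReal p) volume) := by
  have hp0 : 0 < p := by linarith
  have hp1 : 0 < p - 1 := by linarith
  set b := p / (p - 1) with hb
  have hb1 : 1 ≤ b := (one_le_div hp1).mpr (by linarith)
  have hbinv : 1 / b = 1 - 1 / p := by rw [hb]; field_simp
  -- The exponent of the product `w V` with `w ∈ L^p` and `V ∈ L²`.
  set u : ℝ := (1 / 2 + 1 / p)⁻¹ with hu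
  have hu0 : 0 < u := by positivity
  have hp2 : 1 / p < 1 / 2 := one_div_lt_one_div_of_lt (by norm_num) hp
  have hu1 : 1 ≤ u := by
    rw [hu, one_le_inv₀ (by positivity)]
    linarith
  have huinv : 1 / u = 1 / p + 1 / 2 := by rw [hu, one_div, inv_inv]; ring
  have hup : u < p := by
    rw [← one_div_lt_one_div hp0 hu0, huinv]
    linarith
  rw [eLpNorm_two_eq_lpNorm] at hV2
  rw [eLpNorm_two_eq_lpNorm, eLpNorm_eq_lpNorm hp0]
  set M := lpNorm 2 fun x => ‖m x‖ₑ
  set W := lpNorm p fun x => ‖w x‖ₑ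
  set K := lpNorm b fun x => ‖k x‖ₑ
  -- The term with `V(x)`: Young with `m V ∈ L¹`, `k ∈ L^b`, `w ∈ L^p`.
  have t1 : ∫⁻ x, ∫⁻ y, (‖m x‖ₑ * ‖V x‖ₑ) * ‖k (x - y)‖ₑ * ‖w y‖ₑ ≤
      (M * ENNReal.ofReal B) * K * W := by
    refine (lintegral_convolution_le (f := fun x => ‖m x‖ₑ * ‖V x‖ₑ) (k := fun z => ‖k z‖ₑ)
      (g := fun y => ‖w y‖ₑ) (by fun_prop) (by fun_prop) (by fun_prop) le_rfl hb1
      (by linarith : (1 : ℝ) ≤ p) (by rw [hbinv]; ring)).trans ?_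
    gcongr
    have h := ENNReal.lintegral_mul_le_Lp_mul_Lq (volume : Measure Plane)
      Real.HolderConjugate.two_two (f := fun x => ‖m x‖ₑ) (g := fun x => ‖V x‖ₑ)
      (by fun_prop) (by fun_prop)
    calc lpNorm 1 (fun x => ‖m x‖ₑ * ‖V x‖ₑ) = ∫⁻ x, ‖m x‖ₑ * ‖V x‖ₑ := by simp [lpNorm]
      _ ≤ M * lpNorm 2 fun x => ‖V x‖ₑ := h
      _ ≤ _ := by gcongr
  -- The term with `V(y)`: Young with `m ∈ L²`, `k ∈ L^b`, `w V ∈ L^u`.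
  have t2 : ∫⁻ x, ∫⁻ y, ‖m x‖ₑ * ‖k (x - y)‖ₑ * (‖w y‖ₑ * ‖V y‖ₑ) ≤
      M * K * (W * ENNReal.ofReal B) := by
    refine (lintegral_convolution_le (f := fun x => ‖m x‖ₑ) (k := fun z => ‖k z‖ₑ)
      (g := fun y => ‖w y‖ₑ * ‖V y‖ₑ) (by fun_prop) (by fun_prop) (by fun_prop)
      (by norm_num : (1 : ℝ) ≤ 2) hb1 hu1 (by rw [hbinv, huinv]; ring)).trans ?_
    gcongr
    have h := ENNReal.lintegral_Lp_mul_le_Lq_mul_Lr hu0 hup huinv (volume : Measure Plane)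
      (f := fun x => ‖w x‖ₑ) (g := fun x => ‖V x‖ₑ) (by fun_prop) (by fun_prop)
    exact h.trans (mul_le_mul' le_rfl hV2)
  have hadd : absForm k m w V ≤ (∫⁻ x, ∫⁻ y, (‖m x‖ₑ * ‖V x‖ₑ) * ‖k (x - y)‖ₑ * ‖w y‖ₑ) +
      ∫⁻ x, ∫⁻ y, ‖m x‖ₑ * ‖k (x - y)‖ₑ * (‖w y‖ₑ * ‖V y‖ₑ) := by
    rw [← lintegral_add_left
      (Measurable.lintegral_prod_right' (f := fun z : Plane × Plane =>
        (‖m z.1‖ₑ * ‖V z.1‖ₑ) * ‖k (z.1 - z.2)‖ₑ * ‖w z.2‖ₑ) (by fun_prop))]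
    refine lintegral_mono fun x => ?_
    simp only
    rw [← lintegral_add_left (by fun_prop)]
    refine lintegral_mono fun y => ?_
    calc _ ≤ ‖m x‖ₑ * ‖k (x - y)‖ₑ * ‖w y‖ₑ * (‖V x‖ₑ + ‖V y‖ₑ) := by
          gcongr
          exact enorm_sub_le
      _ = _ := by ring
  refine hadd.trans ((add_le_add t1 t2).trans (le_of_eq ?_))
  ring

lemma integrable_convolution_form {k F g : Plane → ℝ} (hk : Measurable k) (hF : Measurable F)
    (hg : Measurable g) (hk1 : MemLp k 1) (hF2 : MemLp F 2) (hg2 : MemLp g 2) :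
    Integrable (fun z : Plane × Plane => F z.1 * (k (z.1 - z.2) * g z.2))
      ((volume : Measure Plane).prod volume) := by
  refine ⟨Measurable.aestronglyMeasurable (by fun_prop), ?_⟩
  rw [hasFiniteIntegral_iff_enorm, lintegral_prod _ (by fun_prop)]
  have h := lintegral_convolution_le (f := fun x => ‖F x‖ₑ) (k := fun z => ‖k z‖ₑ)
    (g := fun y => ‖g y‖ₑ) (by fun_prop) (by fun_prop) (by fun_prop)
    (by norm_num : (1 : ℝ) ≤ 2) le_rfl (by norm_num : (1 : ℝ) ≤ 2) (by norm_num)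
  rw [← eLpNorm_two_eq_lpNorm, ← eLpNorm_two_eq_lpNorm, ← eLpNorm_eq_lpNorm one_pos] at h
  refine lt_of_le_of_lt ?_ (h.trans_lt ?_)
  · refine lintegral_mono fun x => lintegral_mono fun y => ?_
    rw [enorm_mul, enorm_mul, mul_assoc]
  · rw [ENNReal.ofReal_one]
    exact ENNReal.mul_lt_top (ENNReal.mul_lt_top hF2.eLpNorm_lt_top hk1.eLpNorm_lt_top)
      hg2.eLpNorm_lt_top

lemma memLp_mul_bounded {m : L2} {V : Plane → ℝ} (hV : Measurable V) {B : ℝ}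
    (hB : ∀ x, |V x| ≤ B) : MemLp (fun x => m x * V x) 2 := by
  refine (Lp.memLp m).of_le_mul (c := B)
    ((Lp.aestronglyMeasurable m).mul hV.aestronglyMeasurable) (.of_forall fun x => ?_)
  rw [norm_mul, mul_comm]
  exact mul_le_mul_of_nonneg_right (hB x) (norm_nonneg _)

/-- Exchanging `x` and `y` in the second pairing changes the sign of the odd kernel, so the two
pairings combine into `∬ m(x) k(x - y) w(y) (V(x) - V(y))`. -/
lemma enorm_blockPairing_add_le (hχ : IsCutoff χ) (j : Fin 2) (n : ℤ) (m w : L2) {V : Plane → ℝ}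
    (hV : Measurable V) (hm : MemLp (fun x => m x * V x) 2) (hw : MemLp (fun x => w x * V x) 2) :
    ‖blockPairing hχ j n (hm.toLp _) w + blockPairing hχ j n (hw.toLp _) m‖ₑ ≤
      absForm (rieszKernel hχ j n) m w V := by
  set k := rieszKernel hχ j n with hk
  have mk : Measurable k := (continuous_rieszKernel hχ j n).measurable
  have mm : Measurable m := (Lp.stronglyMeasurable m).measurable
  have mw : Measurable w := (Lp.stronglyMeasurable w).measurable
  have I1 := integrable_convolution_form (F := fun x => m x * V x) mk (mm.mul hV) mw (memLp_rieszKernel hχ j n 1) hm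
    (Lp.memLp w)
  have I2 := integrable_convolution_form (F := fun x => w x * V x) mk (mw.mul hV) mm (memLp_rieszKernel hχ j n 1) hw
    (Lp.memLp m)
  have e1 : blockPairing hχ j n (hm.toLp _) w = ∫ z : Plane × Plane,
      (m z.1 * V z.1) * (k (z.1 - z.2) * w z.2) ∂((volume : Measure Plane).prod volume) := by
    rw [integral_prod _ I1]
    refine integral_congr_ae ?_
    filter_upwards [hm.coeFn_toLp] with x hx
    rw [hx, ← integral_const_mul]
  have e2 : blockPairing hχ j n (hw.toLp _) m = ∫ z : Plane × Plane,
      (w z.2 * V z.2) * (k (z.2 - z.1) * m z.1) ∂((volume : Measure Plane).prod volume) := by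
    rw [← integral_prod_swap]
    simp only [Prod.fst_swap, Prod.snd_swap]
    rw [integral_prod _ I2]
    refine integral_congr_ae ?_
    filter_upwards [hw.coeFn_toLp] with x hx
    rw [hx, ← integral_const_mul]
  have I3 : Integrable (fun z : Plane × Plane => (w z.2 * V z.2) * (k (z.2 - z.1) * m z.1))
    ((volume : Measure Plane).prod volume) := I2.swap
  rw [e1, e2, ← integral_add I1 I3]
  refine (enorm_integral_le_lintegral_enorm _).trans (le_of_eq ?_)
  rw [absForm, lintegral_prod]
  · refine lintegral_congr fun x => lintegral_congr fun y => ?_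
    rw [← enorm_mul, ← enorm_mul, ← enorm_mul]
    congr 1
    have hneg : k (y - x) = -k (x - y) := by
      rw [← neg_sub x y]
      exact rieszKernel_neg hχ j n _
    rw [hneg]
    ring
  · exact Measurable.aemeasurable (by fun_prop)

/-- The commutator structure of the quadratic term: the symmetrised form
`(m, w) ↦ ∫ (m Rⱼ w + w Rⱼ m) V` is bounded for `m ∈ L²` and `w ∈ L^p`, `p > 2`. -/
theorem enorm_integral_symm_riesz_le (hχ : IsCutoff χ) (j : Fin 2) {p : ℝ} (hp : 2 < p) :
    ∃ A : ℝ≥0∞, A ≠ ⊤ ∧ ∀ (B : ℝ) (V : Plane → ℝ), 0 ≤ B → Measurable V → (∀ x, |V x| ≤ B) →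
      eLpNorm V 2 volume ≤ ENNReal.ofReal B → (∀ x z, |V x - V (x - z)| ≤ B * ‖z‖) →
      (∀ z, eLpNorm (fun x => V x - V (x - z)) 2 volume ≤ ENNReal.ofReal (B * ‖z‖)) →
      ∀ m w : L2, ‖∫ x, (m x * riesz j w x + w x * riesz j m x) * V x‖ₑ ≤
        A * (ENNReal.ofReal B * eLpNorm m 2 volume * eLpNorm w (ENNReal.ofReal p) volume) := by
  have hp0 : 0 < p := by linarith
  have hp1 : 0 < p - 1 := by linarith
  set b := p / (p - 1) with hb
  have hb0 : 0 < b := by positivity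
  set I : ℝ≥0∞ := ∫⁻ z, ENNReal.ofReal ‖z‖ * ‖rieszKernel hχ j 0 z‖ₑ
  set K : ℝ≥0∞ := (∫⁻ z, ‖rieszKernel hχ j 0 z‖ₑ ^ b) ^ (1 / b)
  have hI : I ≠ ⊤ := (lintegral_norm_mul_rieszKernel_lt_top hχ j 0).ne
  have hK : K ≠ ⊤ := (lintegral_rieszKernel_rpow_lt_top hχ j 0 hb0).ne
  -- The ratio of the low-frequency series: with `b` conjugate to `p`, the exponent `2 - 2/b` equals
  -- `2/p`.
  set ρ : ℝ := (1 / 2) ^ (2 / p) with hρ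
  have hρ0 : 0 < ρ := by positivity
  have hρ1 : ρ < 1 := Real.rpow_lt_one (by norm_num) (by norm_num) (by positivity)
  set S : ℝ≥0∞ := ∑' n : ℕ, ENNReal.ofReal ((1 / 2) ^ n)
  set S' : ℝ≥0∞ := ∑' n : ℕ, ENNReal.ofReal (ρ ^ (n + 1))
  have hS : S ≠ ⊤ := (summable_geometric_of_lt_one (by norm_num) (by norm_num)).tsum_ofReal_ne_top
  have hS' : S' ≠ ⊤ := by
    refine Summable.tsum_ofReal_ne_top ?_
    exact (summable_nat_add_iff 1).mpr (summable_geometric_of_lt_one hρ0.le hρ1)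
  refine ⟨I * S + 2 * K * S', by finiteness, ?_⟩
  intro B V hB hV hVB hV2 hD1 hD2 m w
  have mm : Measurable m := (Lp.stronglyMeasurable m).measurable
  have mw : Measurable w := (Lp.stronglyMeasurable w).measurable
  have hmV := memLp_mul_bounded (m := m) hV hVB
  have hwV := memLp_mul_bounded (m := w) hV hVB
  set X := ENNReal.ofReal B * eLpNorm m 2 volume * eLpNorm w (ENNReal.ofReal p) volume
  have hlim := (tendsto_sum_blockPairing hχ j (hmV.toLp _) w).add
    (tendsto_sum_blockPairing hχ j (hwV.toLp _) m)
  have hval : (∫ x, hmV.toLp _ x * riesz j w x) + ∫ x, hwV.toLp _ x * riesz j m x =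
      ∫ x, (m x * riesz j w x + w x * riesz j m x) * V x := by
    rw [← integral_add ((Lp.memLp _).integrable_mul (Lp.memLp _))
      ((Lp.memLp _).integrable_mul (Lp.memLp _))]
    refine integral_congr_ae ?_
    filter_upwards [hmV.coeFn_toLp, hwV.coeFn_toLp] with x h1 h2
    rw [h1, h2]
    ring
  rw [hval] at hlim
  -- It suffices to bound the dyadic partial sums uniformly in `N`.
  refine le_of_tendsto ((continuous_enorm.tendsto _).comp hlim) (.of_forall fun N => ?_)
  -- High frequencies use the regularity of `V`.
  have hpos : ∀ n : ℕ, absForm (rieszKernel hχ j n) m w V ≤ ENNReal.ofReal ((1 / 2) ^ n) * I * X := by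
    intro n
    refine (absForm_le_of_moment (continuous_rieszKernel hχ j n).measurable mm mw hV hp hB hD1
      hD2).trans ?_
    rw [lintegral_norm_mul_rieszKernel, zpow_neg, zpow_natCast, one_div, inv_pow]
  -- Low frequencies use only the size of `V` in `L²`.
  have hneg : ∀ n : ℕ, absForm (rieszKernel hχ j (-(n : ℤ) - 1)) m w V ≤
      2 * (ENNReal.ofReal (ρ ^ (n + 1)) * K) * X := by
    intro n
    refine (absForm_le_of_rpow (continuous_rieszKernel hχ j _).measurable mm mw hV hp hV2).trans ?_
    rw [lpNorm, lintegral_rieszKernel_rpow hχ j _ hb0]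
    have : ((2 : ℝ) ^ (-(n : ℤ) - 1)) ^ (2 - 2 / b) = ρ ^ (n + 1) := by
      have h1 : 2 - 2 / b = 2 / p := by rw [hb]; field_simp; ring
      have h2 : (2 : ℝ) ^ (-(n : ℤ) - 1) = (1 / 2 : ℝ) ^ (n + 1) := by
        rw [show -(n : ℤ) - 1 = -((n + 1 : ℕ) : ℤ) by push_cast; ring, zpow_neg, zpow_natCast,
          one_div, inv_pow]
      rw [h1, h2, hρ, ← Real.rpow_natCast, ← Real.rpow_natCast, ← Real.rpow_mul (by norm_num),
        ← Real.rpow_mul (by norm_num), mul_comm]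
    rw [this]
  simp only [Function.comp_apply]
  rw [← Finset.sum_add_distrib]
  calc _ ≤ ∑ n ∈ Finset.range N, ‖(blockPairing hχ j n (hmV.toLp _) w +
          blockPairing hχ j (-(n : ℤ) - 1) (hmV.toLp _) w) +
          (blockPairing hχ j n (hwV.toLp _) m +
          blockPairing hχ j (-(n : ℤ) - 1) (hwV.toLp _) m)‖ₑ := enorm_sum_le _ _
    _ ≤ ∑ n ∈ Finset.range N, (ENNReal.ofReal ((1 / 2) ^ n) * (I * X) +
          ENNReal.ofReal (ρ ^ (n + 1)) * (2 * K * X)) := by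
        refine Finset.sum_le_sum fun n _ => ?_
        rw [add_add_add_comm]
        refine (enorm_add_le _ _).trans (add_le_add ?_ ?_)
        · refine (enorm_blockPairing_add_le hχ j n m w hV hmV hwV).trans ((hpos n).trans ?_)
          rw [mul_assoc]
        · refine (enorm_blockPairing_add_le hχ j _ m w hV hmV hwV).trans ((hneg n).trans ?_)
          exact le_of_eq (by ring)
    _ ≤ S * (I * X) + S' * (2 * K * X) := by
        rw [Finset.sum_add_distrib, ← Finset.sum_mul, ← Finset.sum_mul]
        gcongr <;> exact ENNReal.sum_le_tsum _
    _ = _ := by ring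

/-! ### Size and Lipschitz bounds for Schwartz multipliers on `L²` -/

lemma integral_norm_mul_le {σ : Plane → ℂ} {C : ℝ} (hC : 0 ≤ C) (h2 : MemLp σ 2)
    (h2C : eLpNorm σ 2 volume ≤ ENNReal.ofReal C) (F : L2C) :
    Integrable (fun ξ => σ ξ * F ξ) ∧ ∫ ξ, ‖σ ξ * F ξ‖ ≤ C * ‖F‖ := by
  have hint : Integrable (fun ξ => σ ξ * F ξ) := h2.integrable_mul (Lp.memLp F)
  refine ⟨hint, ?_⟩
  have h := ENNReal.lintegral_mul_le_Lp_mul_Lq (volume : Measure Plane)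
    Real.HolderConjugate.two_two (f := fun ξ => ‖σ ξ‖ₑ) (g := fun ξ => ‖F ξ‖ₑ)
    h2.1.enorm (Lp.aestronglyMeasurable F).enorm
  have e : ∀ f : Plane → ℂ, (∫⁻ ξ, ‖f ξ‖ₑ ^ (2 : ℝ)) ^ (1 / (2 : ℝ)) = eLpNorm f 2 volume := by
    intro f
    rw [eLpNorm_eq_lintegral_rpow_enorm_toReal (by norm_num) (by norm_num)]
    simp
  rw [e, e] at h
  rw [← ENNReal.ofReal_le_ofReal_iff (by positivity), ofReal_integral_norm_eq_lintegral_enorm hint,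
    ENNReal.ofReal_mul hC, Lp.norm_def, ENNReal.ofReal_toReal (Lp.eLpNorm_ne_top _)]
  calc ∫⁻ ξ, ‖σ ξ * F ξ‖ₑ = ∫⁻ ξ, ‖σ ξ‖ₑ * ‖F ξ‖ₑ := by simp_rw [enorm_mul]
    _ ≤ _ := h
    _ ≤ _ := by gcongr

/-- Fourier multipliers with a symbol in `L² ∩ L^∞` map `L²` to `L² ∩ L^∞`. -/
lemma multiplier_bounds {σ : Plane → ℂ} (hσ : Measurable σ) {C : ℝ} (hC0 : 0 ≤ C)
    (hC : ∀ ξ, ‖σ ξ‖ ≤ C) (h2 : MemLp σ 2) (h2C : eLpNorm σ 2 volume ≤ ENNReal.ofReal C)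
    (F : L2C) :
    (∀ x, |(𝓕⁻ (fun ξ => σ ξ * F ξ) x).re| ≤ C * ‖F‖) ∧
      eLpNorm (fun x => (𝓕⁻ (fun ξ => σ ξ * F ξ) x).re) 2 volume ≤ ENNReal.ofReal (C * ‖F‖) := by
  obtain ⟨h1, h1C⟩ := integral_norm_mul_le hC0 h2 h2C F
  have hm := memLp_bounded_mul hσ hC F
  refine ⟨fun x => (Complex.abs_re_le_norm _).trans ((norm_fourierInv_le _ _).trans h1C), ?_⟩
  exact (eLpNorm_re_fourierInv_le h1 hm).2.trans
    (ENNReal.ofReal_le_ofReal (norm_toLp_bounded_mul_le hC F hm))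

/-- The bounds weighted by `‖ξ‖` serve for translation differences, whose symbol carries an
additional factor of size at most `2π ‖ξ‖ ‖z‖`. -/
lemma exists_schwartz_bounds (Φ : 𝓢(Plane, ℂ)) : ∃ C, 0 < C ∧ (∀ ξ, ‖Φ ξ‖ ≤ C) ∧
    eLpNorm Φ 2 volume ≤ ENNReal.ofReal C ∧ (∀ ξ, ‖ξ‖ * ‖Φ ξ‖ ≤ C) ∧
    MemLp (fun ξ => ‖ξ‖ * ‖Φ ξ‖) 2 ∧
    eLpNorm (fun ξ => ‖ξ‖ * ‖Φ ξ‖) 2 volume ≤ ENNReal.ofReal C := by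
  obtain ⟨C0, h0, hC0⟩ := Φ.decay 0 0
  obtain ⟨C1, h1, hC1⟩ := Φ.decay 1 0
  simp only [pow_zero, one_mul, pow_one, norm_iteratedFDeriv_zero] at hC0 hC1
  have hm : MemLp (fun ξ => ‖ξ‖ * ‖Φ ξ‖) 2 := by
    have hc : Continuous fun ξ : Plane => ‖ξ‖ * ‖Φ ξ‖ := continuous_norm.mul Φ.continuous.norm
    rw [memLp_two_iff_integrable_sq hc.aestronglyMeasurable]
    refine ((Φ.integrable_pow_mul (volume : Measure Plane) 2).const_mul C0).mono'
      (hc.pow 2).aestronglyMeasurable (.of_forall fun ξ => ?_)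
    rw [Real.norm_of_nonneg (by positivity)]
    calc (‖ξ‖ * ‖Φ ξ‖) ^ 2 = ‖Φ ξ‖ * (‖ξ‖ ^ 2 * ‖Φ ξ‖) := by ring
      _ ≤ _ := by gcongr; exact hC0 ξ
  have hΦ := Φ.memLp 2 (volume : Measure Plane)
  have p1 := ENNReal.toReal_nonneg (a := eLpNorm Φ 2 volume)
  have p2 := ENNReal.toReal_nonneg (a := eLpNorm (fun ξ => ‖ξ‖ * ‖Φ ξ‖) 2 volume)
  refine ⟨C0 + C1 + (eLpNorm Φ 2 volume).toReal +
    (eLpNorm (fun ξ => ‖ξ‖ * ‖Φ ξ‖) 2 volume).toReal, by positivity, fun ξ => ?_, ?_, fun ξ => ?_,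
    hm, ?_⟩
  · linarith [hC0 ξ]
  · rw [ENNReal.le_ofReal_iff_toReal_le hΦ.eLpNorm_ne_top (by positivity)]
    linarith
  · linarith [hC1 ξ]
  · rw [ENNReal.le_ofReal_iff_toReal_le hm.eLpNorm_ne_top (by positivity)]
    linarith

/-- Convolution of a real `L²` function with the real part of a Schwartz function. -/
def convRe (Ψ : 𝓢(Plane, ℂ)) (f : L2) (x : Plane) : ℝ := ∫ y, (Ψ (x - y)).re * f y

lemma convRe_eq (Ψ : 𝓢(Plane, ℂ)) (f : L2) (x : Plane) :
    convRe Ψ f x = (𝓕⁻ (fun ξ => 𝓕 Ψ ξ * (𝓕 (toC f) : L2C) ξ) x).re :=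
  integral_re_schwartz_mul Ψ f x

lemma continuous_convRe (Ψ : 𝓢(Plane, ℂ)) (f : L2) : Continuous (convRe Ψ f) := by
  have : convRe Ψ f = fun x => (𝓕⁻ (fun ξ => 𝓕 Ψ ξ * (𝓕 (toC f) : L2C) ξ) x).re :=
    funext (convRe_eq Ψ f)
  rw [this]
  exact Complex.continuous_re.comp (continuous_fourierInv (integrable_schwartz_mul _ _))

lemma memLp_convRe (Ψ : 𝓢(Plane, ℂ)) (f : L2) : MemLp (convRe Ψ f) 2 := by
  have : convRe Ψ f = fun x => (𝓕⁻ (fun ξ => 𝓕 Ψ ξ * (𝓕 (toC f) : L2C) ξ) x).re :=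
    funext (convRe_eq Ψ f)
  rw [this]
  exact (eLpNorm_re_fourierInv_le (integrable_schwartz_mul _ _) (memLp_schwartz_mul _ _)).1

lemma fourierInv_sub_translate {h : Plane → ℂ} (h1 : Integrable h) (x z : Plane) :
    𝓕⁻ h x - 𝓕⁻ h (x - z) =
      𝓕⁻ (fun ξ => (1 - (Real.fourierChar (-inner ℝ ξ z) : ℂ)) * h ξ) x := by
  rw [Real.fourierInv_eq, Real.fourierInv_eq, Real.fourierInv_eq, ← integral_sub]
  · congr 1 with ξ
    simp only [Circle.smul_def, smul_eq_mul]
    have : (Real.fourierChar (inner ℝ ξ (x - z)) : ℂ) =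
        Real.fourierChar (inner ℝ ξ x) * Real.fourierChar (-inner ℝ ξ z) := by
      rw [← Circle.coe_mul, ← AddChar.map_add_eq_mul, inner_sub_right, sub_eq_add_neg]
    rw [this]
    ring
  · simpa using (Real.fourierIntegral_convergent_iff (μ := (volume : Measure Plane)) (-x)).mpr h1
  · simpa [inner_sub_right] using
      (Real.fourierIntegral_convergent_iff (μ := (volume : Measure Plane)) (-(x - z))).mpr h1

lemma norm_one_sub_fourierChar_le (t : ℝ) : ‖1 - (Real.fourierChar t : ℂ)‖ ≤ 2 * Real.pi * |t| := by
  rw [norm_sub_rev, Real.fourierChar_apply, mul_comm]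
  refine (Real.norm_exp_I_mul_ofReal_sub_one_le).trans (le_of_eq ?_)
  rw [Real.norm_eq_abs, abs_mul, abs_of_pos (by positivity)]

/-- These are exactly the four conditions imposed on `V` in the commutator estimate. A symbol in `L²
∩ L^∞` maps `L²` to `L² ∩ L^∞`, and translation differences multiply the symbol by `1 - e^{-2πi
ξ·z}`. -/
lemma convRe_bounds (Ψ : 𝓢(Plane, ℂ)) : ∃ B, 0 < B ∧ ∀ f : L2,
    (∀ x, |convRe Ψ f x| ≤ B * ‖f‖) ∧
    eLpNorm (convRe Ψ f) 2 volume ≤ ENNReal.ofReal (B * ‖f‖) ∧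
    (∀ x z, |convRe Ψ f x - convRe Ψ f (x - z)| ≤ B * ‖f‖ * ‖z‖) ∧
    (∀ z, eLpNorm (fun x => convRe Ψ f x - convRe Ψ f (x - z)) 2 volume ≤
      ENNReal.ofReal (B * ‖f‖ * ‖z‖)) := by
  obtain ⟨C, hC0, hC1, hC2, hC3, hC4, hC5⟩ := exists_schwartz_bounds (𝓕 Ψ)
  have hpi : 1 ≤ 2 * Real.pi := by linarith [Real.pi_gt_three]
  refine ⟨2 * Real.pi * C, by positivity, fun f => ?_⟩
  have hN : ‖(𝓕 (toC f) : L2C)‖ = ‖f‖ := by rw [Lp.norm_fourier_eq, norm_toC]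
  have hCf : C * ‖f‖ ≤ 2 * Real.pi * C * ‖f‖ := by
    rw [mul_assoc]
    exact le_mul_of_one_le_left (by positivity) hpi
  have e : convRe Ψ f = fun x => (𝓕⁻ (fun ξ => 𝓕 Ψ ξ * (𝓕 (toC f) : L2C) ξ) x).re :=
    funext (convRe_eq Ψ f)
  have H1 := multiplier_bounds (𝓕 Ψ).continuous.measurable hC0.le hC1
    ((𝓕 Ψ).memLp 2) hC2 (𝓕 (toC f))
  rw [hN] at H1
  have hd : ∀ x z, convRe Ψ f x - convRe Ψ f (x - z) = (𝓕⁻ (fun ξ =>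
      ((1 - (Real.fourierChar (-inner ℝ ξ z) : ℂ)) * 𝓕 Ψ ξ) * (𝓕 (toC f) : L2C) ξ) x).re := by
    intro x z
    simp only [e]
    rw [← Complex.sub_re, fourierInv_sub_translate (integrable_schwartz_mul _ _)]
    simp only [mul_assoc]
  have H2 : ∀ z : Plane, _ := fun z => by
    have hpt : ∀ ξ, ‖(1 - (Real.fourierChar (-inner ℝ ξ z) : ℂ)) * 𝓕 Ψ ξ‖ ≤
        2 * Real.pi * ‖z‖ * (‖ξ‖ * ‖𝓕 Ψ ξ‖) := by
      intro ξ
      rw [norm_mul]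
      have h1 := norm_one_sub_fourierChar_le (-inner ℝ ξ z)
      have h2 : |-inner ℝ ξ z| ≤ ‖ξ‖ * ‖z‖ := by
        rw [abs_neg]; exact abs_real_inner_le_norm ξ z
      calc _ ≤ 2 * Real.pi * (‖ξ‖ * ‖z‖) * ‖𝓕 Ψ ξ‖ := by
            gcongr
            exact h1.trans (by gcongr)
        _ = _ := by ring
    have hmeas : Measurable fun ξ : Plane =>
        (1 - (Real.fourierChar (-inner ℝ ξ z) : ℂ)) * 𝓕 Ψ ξ := by
      refine Continuous.measurable ?_
      have : Continuous fun ξ : Plane => (Real.fourierChar (-inner ℝ ξ z) : ℂ) :=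
        continuous_subtype_val.comp
          (Real.continuous_fourierChar.comp (continuous_id.inner continuous_const).neg)
      exact (continuous_const.sub this).mul (𝓕 Ψ).continuous
    have hmem : MemLp (fun ξ : Plane =>
        (1 - (Real.fourierChar (-inner ℝ ξ z) : ℂ)) * 𝓕 Ψ ξ) 2 := by
      refine hC4.of_le_mul (c := 2 * Real.pi * ‖z‖) hmeas.aestronglyMeasurable
        (.of_forall fun ξ => ?_)
      rw [Real.norm_of_nonneg (by positivity)]
      exact hpt ξ
    exact multiplier_bounds (C := 2 * Real.pi * ‖z‖ * C) hmeas (by positivity)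
      (fun ξ => (hpt ξ).trans (by gcongr; exact hC3 ξ)) hmem (by
        refine (eLpNorm_le_mul_eLpNorm_of_ae_le_mul (g := fun ξ => ‖ξ‖ * ‖𝓕 Ψ ξ‖)
          (c := 2 * Real.pi * ‖z‖) (.of_forall fun ξ => ?_) 2).trans ?_
        · rw [Real.norm_of_nonneg (by positivity : 0 ≤ ‖ξ‖ * ‖𝓕 Ψ ξ‖)]
          exact hpt ξ
        · rw [ENNReal.ofReal_mul (p := 2 * Real.pi * ‖z‖) (by positivity)]
          exact mul_le_mul' le_rfl hC5) (𝓕 (toC f))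
  refine ⟨fun x => ?_, ?_, fun x z => ?_, fun z => ?_⟩
  · rw [convRe_eq]
    exact (H1.1 x).trans hCf
  · rw [e]
    exact H1.2.trans (ENNReal.ofReal_le_ofReal hCf)
  · rw [hd]
    refine ((H2 z).1 x).trans (le_of_eq ?_)
    rw [hN]; ring
  · simp_rw [hd]
    refine (H2 z).2.trans (le_of_eq ?_)
    rw [hN]; ring_nf

/-! ### The truncation `Δ_{<J}` -/

/-- The symbol of `Δ_{<J}` in the frequency variable of Mathlib's Fourier transform. -/
def lowSchwartz (hχ : IsCutoff χ) (J : ℤ) : 𝓢(Plane, ℂ) :=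
  HasCompactSupport.toSchwartzMap (f := fun ξ : Plane => (lowSymbol χ J ((2 * Real.pi) • ξ) : ℂ))
    (by
      refine HasCompactSupport.comp_left (g := Complex.ofReal)
        (f := fun ξ : Plane => lowSymbol χ J ((2 * Real.pi) • ξ)) ?_ Complex.ofReal_zero
      have h1 : HasCompactSupport (lowSymbol χ J) :=
        hχ.compactSupport.comp_smul (by positivity)
      exact h1.comp_smul (by positivity))
    (Complex.ofRealCLM.contDiff.comp ((contDiff_lowSymbol hχ J).comp (contDiff_const_smul _)))

lemma lowSchwartz_apply (hχ : IsCutoff χ) (J : ℤ) (ξ : Plane) :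
    lowSchwartz hχ J ξ = (lowSymbol χ J ((2 * Real.pi) • ξ) : ℂ) := rfl

/-- The kernel of `Δ_{<J}` as a complex Schwartz function. -/
def lowKernelC (hχ : IsCutoff χ) (J : ℤ) : 𝓢(Plane, ℂ) := 𝓕⁻ (lowSchwartz hχ J)

lemma fourier_lowKernelC (hχ : IsCutoff χ) (J : ℤ) : 𝓕 (lowKernelC hχ J) = lowSchwartz hχ J :=
  FourierTransform.fourier_fourierInv_eq _

lemma lowKernelC_apply (hχ : IsCutoff χ) (J : ℤ) (x : Plane) :
    lowKernelC hχ J x = 𝓕⁻ (fun ξ : Plane => (lowSymbol χ J ((2 * Real.pi) • ξ) : ℂ)) x := by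
  rw [lowKernelC, SchwartzMap.fourierInv_coe]; rfl

lemma lowKernel_eq (hχ : IsCutoff χ) (J : ℤ) (x : Plane) :
    lowKernel χ J x = (lowKernelC hχ J x).re := by
  rw [lowKernelC_apply]; rfl

/-- The symbol is real and even, so conjugating the inverse transform leaves it unchanged. -/
lemma lowKernelC_im (hχ : IsCutoff χ) (J : ℤ) (x : Plane) : (lowKernelC hχ J x).im = 0 := by
  rw [← Complex.conj_eq_iff_im, lowKernelC_apply]
  conv_rhs => rw [Real.fourierInv_eq_fourier_comp_neg]
  rw [Real.fourierInv_eq, Real.fourier_eq, ← integral_conj]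
  congr 1 with ξ
  have : lowSymbol χ J ((2 * Real.pi) • -ξ) = lowSymbol χ J ((2 * Real.pi) • ξ) := by
    unfold lowSymbol
    rw [smul_neg, smul_neg, hχ.map_neg]
  rw [this, Circle.smul_def, Circle.smul_def, smul_eq_mul, smul_eq_mul, map_mul,
    Complex.conj_ofReal, AddChar.map_neg_eq_inv, Circle.coe_inv_eq_conj]

lemma low_eq_convRe (hχ : IsCutoff χ) (J : ℤ) (f : L2) :
    low χ J f = convRe (lowKernelC hχ J) f := by
  funext x
  simp only [low, convRe, lowKernel_eq hχ]

lemma ofReal_low (hχ : IsCutoff χ) (J : ℤ) (f : L2) (x : Plane) :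
    (low χ J f x : ℂ) = 𝓕⁻ (fun ξ => lowSchwartz hχ J ξ * (𝓕 (toC f) : L2C) ξ) x := by
  rw [← fourier_lowKernelC, ← convolution_eq_fourierInv, low, ← integral_complex_ofReal]
  refine integral_congr_ae ?_
  filter_upwards [coeFn_toC f] with y hy
  rw [hy, lowKernel_eq hχ, Complex.ofReal_mul]
  congr 1
  apply Complex.ext <;> simp [lowKernelC_im]

lemma memLp_low (hχ : IsCutoff χ) (J : ℤ) (f : L2) : MemLp (low χ J f) 2 := by
  rw [low_eq_convRe hχ]
  exact memLp_convRe _ _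

lemma continuous_low (hχ : IsCutoff χ) (J : ℤ) (f : L2) : Continuous (low χ J f) := by
  rw [low_eq_convRe hχ]
  exact continuous_convRe _ _

/-- `Δ_{<J} f` as an element of `L²`. -/
def lowL2 (hχ : IsCutoff χ) (J : ℤ) (f : L2) : L2 := (memLp_low hχ J f).toLp _

lemma coeFn_lowL2 (hχ : IsCutoff χ) (J : ℤ) (f : L2) :
    (lowL2 hχ J f : Plane → ℝ) =ᵐ[volume] low χ J f := (memLp_low hχ J f).coeFn_toLp

lemma fourier_lowL2 (hχ : IsCutoff χ) (J : ℤ) (f : L2) :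
    𝓕 (toC (lowL2 hχ J f)) = (memLp_schwartz_mul (lowSchwartz hχ J) (𝓕 (toC f))).toLp _ := by
  have h : toC (lowL2 hχ J f) =
      𝓕⁻ ((memLp_schwartz_mul (lowSchwartz hχ J) (𝓕 (toC f))).toLp _) := by
    refine Lp.ext ?_
    filter_upwards [coeFn_toC (lowL2 hχ J f), coeFn_lowL2 hχ J f,
      fourierInv_ae_eq (integrable_schwartz_mul (lowSchwartz hχ J) (𝓕 (toC f)))
        (memLp_schwartz_mul (lowSchwartz hχ J) (𝓕 (toC f)))] with x h1 h2 h3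
    rw [h1, h2, ofReal_low hχ, h3]
  rw [h, FourierTransform.fourier_fourierInv_eq]

/-- The symbol at level `J + 1` equals one wherever the symbol at level `J` is nonzero. This
reproducing formula lets Bernstein's inequality have `‖f_{<J}‖_{L²}` on the right rather than
`‖f‖_{L²}`. -/
lemma low_eq_low_succ (hχ : IsCutoff χ) (J : ℤ) (f : L2) :
    low χ J f = convRe (lowKernelC hχ (J + 1)) (lowL2 hχ J f) := by
  funext x
  rw [convRe_eq, fourier_lowL2, fourier_lowKernelC, ← Complex.ofReal_re (low χ J f x),
    ofReal_low hχ]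
  congr 1
  refine Real.fourierInv_congr_ae ?_ x
  filter_upwards [(memLp_schwartz_mul (lowSchwartz hχ J) (𝓕 (toC f))).coeFn_toLp] with ξ hξ
  rw [hξ, ← mul_assoc]
  congr 1
  rw [lowSchwartz_apply, lowSchwartz_apply, ← Complex.ofReal_mul]
  congr 1
  by_cases h : (2 : ℝ) ^ J ≤ ‖(2 * Real.pi) • ξ‖
  · rw [lowSymbol_eq_zero hχ h, mul_zero]
  · have : lowSymbol χ (J + 1) ((2 * Real.pi) • ξ) = 1 := by
      refine hχ.eq_one _ ?_
      rw [mem_ball_zero_iff, norm_smul _ ((2 * Real.pi) • ξ), Real.norm_of_nonneg (by positivity),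
        neg_add, zpow_add₀ (by norm_num), zpow_neg]
      rw [not_le] at h
      have hc : (0 : ℝ) < 2 ^ J := by positivity
      calc _ = (‖(2 * Real.pi) • ξ‖ / 2 ^ J) * (1 / 2) := by norm_num; ring
        _ < 1 * (1 / 2) := by gcongr; exact (div_lt_one hc).mpr h
        _ = 1 / 2 := by norm_num
    rw [this, one_mul]

/-- Bernstein's inequality. -/
lemma eLpNorm_low_le (hχ : IsCutoff χ) (J : ℤ) {p : ℝ} (hp : 2 ≤ p) : ∃ C, 0 < C ∧ ∀ f : L2,
    eLpNorm (low χ J f) (ENNReal.ofReal p) volume ≤ ENNReal.ofReal (C * ‖lowL2 hχ J f‖) := by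
  obtain ⟨B, hB, h⟩ := convRe_bounds (lowKernelC hχ (J + 1))
  refine ⟨B, hB, fun f => ?_⟩
  obtain ⟨h1, h2, -, -⟩ := h (lowL2 hχ J f)
  rw [← low_eq_low_succ] at h1 h2
  rw [eLpNorm_eq_lpNorm (by linarith)]
  refine lpNorm_le_of_le (fun x => ?_) ?_ hp
  · rw [Real.enorm_eq_ofReal_abs]
    exact ENNReal.ofReal_le_ofReal (h1 x)
  · rwa [← eLpNorm_two_eq_lpNorm]

lemma norm_lowL2_sq (hχ : IsCutoff χ) (J : ℤ) (f : L2) :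
    ‖lowL2 hχ J f‖ ^ 2 = ∫ x, low χ J f x ^ 2 := by
  rw [← real_inner_self_eq_norm_sq, L2.inner_def]
  refine integral_congr_ae ?_
  filter_upwards [coeFn_lowL2 hχ J f] with x hx
  simp only [hx]
  simp [pow_two]

/-! ### The transfer term as a commutator form -/

/-- The flux is a product of two `L²` functions, hence only integrable; Young's inequality is
therefore used with the kernel in `L²`. This justifies Fubini in `transfer_eq`. -/
lemma integrable_convolution_form_one {k F g : Plane → ℝ} (hk : Measurable k) (hF : Measurable F)
    (hg : Measurable g) (hk2 : MemLp k 2) (hF2 : MemLp F 2) (hg1 : Integrable g) :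
    Integrable (fun z : Plane × Plane => F z.1 * (k (z.1 - z.2) * g z.2))
      ((volume : Measure Plane).prod volume) := by
  refine ⟨Measurable.aestronglyMeasurable (by fun_prop), ?_⟩
  rw [hasFiniteIntegral_iff_enorm, lintegral_prod _ (by fun_prop)]
  have h := lintegral_convolution_le (f := fun x => ‖F x‖ₑ) (k := fun z => ‖k z‖ₑ)
    (g := fun y => ‖g y‖ₑ) (by fun_prop) (by fun_prop) (by fun_prop)
    (by norm_num : (1 : ℝ) ≤ 2) (by norm_num : (1 : ℝ) ≤ 2) le_rfl (by norm_num)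
  rw [← eLpNorm_two_eq_lpNorm, ← eLpNorm_two_eq_lpNorm, ← eLpNorm_eq_lpNorm one_pos,
    ENNReal.ofReal_one] at h
  refine lt_of_le_of_lt ?_ (h.trans_lt ?_)
  · refine lintegral_mono fun x => lintegral_mono fun y => ?_
    rw [enorm_mul, enorm_mul, mul_assoc]
  · exact ENNReal.mul_lt_top (ENNReal.mul_lt_top hF2.eLpNorm_lt_top hk2.eLpNorm_lt_top)
      (memLp_one_iff_integrable.mpr hg1).eLpNorm_lt_top

/-- The `i`-th derivative of the kernel of `Δ_{<J}`. -/
def gradKernel (hχ : IsCutoff χ) (J : ℤ) (i : Fin 2) : 𝓢(Plane, ℂ) :=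
  ∂_{(EuclideanSpace.single i 1 : Plane)} (lowKernelC hχ J)

lemma fderiv_lowKernel (hχ : IsCutoff χ) (J : ℤ) (i : Fin 2) (x : Plane) :
    fderiv ℝ (lowKernel χ J) x (EuclideanSpace.single i 1) = (gradKernel hχ J i x).re := by
  have h : lowKernel χ J = fun x => Complex.reCLM (lowKernelC hχ J x) :=
    funext (lowKernel_eq hχ J)
  have hd := Complex.reCLM.hasFDerivAt.comp x (lowKernelC hχ J).differentiableAt.hasFDerivAt
  rw [h]
  erw [hd.fderiv]
  rfl

lemma measurable_flux (θ₁ θ₂ : L2) (i : Fin 2) : Measurable (flux θ₁ θ₂ i) :=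
  ((Lp.stronglyMeasurable _).measurable.mul (Lp.stronglyMeasurable _).measurable).add
    ((Lp.stronglyMeasurable _).measurable.mul (Lp.stronglyMeasurable _).measurable)

lemma integrable_flux (θ₁ θ₂ : L2) (i : Fin 2) : Integrable (flux θ₁ θ₂ i) :=
  ((Lp.memLp _).integrable_mul (Lp.memLp _)).add ((Lp.memLp _).integrable_mul (Lp.memLp _))

/-- By Fubini the differentiated kernel passes from the flux to `w_{<J}`. The transpose of
convolution with `∂ᵢK` is convolution with `y ↦ ∂ᵢK(-y)`, which is the reflection at `0`. -/
lemma transfer_eq (hχ : IsCutoff χ) (J : ℤ) (θ₁ θ₂ : L2) : transfer χ J θ₁ θ₂ =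
    ∑ i, ∫ y, flux θ₁ θ₂ i y *
      convRe (reflect (gradKernel hχ J i) 0) (lowL2 hχ J (θ₁ - θ₂)) y := by
  set v : Plane → ℝ := low χ J ((θ₁ - θ₂ : L2) : Plane → ℝ) with hv
  have hI : ∀ i, Integrable (fun z : Plane × Plane =>
      v z.1 * ((gradKernel hχ J i (z.1 - z.2)).re * flux θ₁ θ₂ i z.2))
      ((volume : Measure Plane).prod volume) := fun i =>
    have hc : Continuous fun x => (gradKernel hχ J i x).re :=
      Complex.continuous_re.comp (gradKernel hχ J i).continuous
    integrable_convolution_form_one (k := fun x => (gradKernel hχ J i x).re) hc.measurable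
      (continuous_low hχ J _).measurable (measurable_flux θ₁ θ₂ i)
      (((gradKernel hχ J i).memLp 2).of_le hc.aestronglyMeasurable
        (.of_forall fun _ => Complex.abs_re_le_norm _))
      (memLp_low hχ J _) (integrable_flux θ₁ θ₂ i)
  have e : transfer χ J θ₁ θ₂ = ∫ x, ∑ i, ∫ y,
      v x * ((gradKernel hχ J i (x - y)).re * flux θ₁ θ₂ i y) := by
    refine integral_congr_ae (.of_forall fun x => ?_)
    simp only [lowDiv, Finset.sum_mul, fderiv_lowKernel hχ]
    refine Finset.sum_congr rfl fun i _ => ?_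
    rw [mul_comm, ← integral_const_mul]
  rw [e, integral_finsetSum _ fun i _ => (hI i).integral_prod_left]
  refine Finset.sum_congr rfl fun i _ => ?_
  rw [← integral_prod _ (hI i), integral_prod_symm _ (hI i)]
  congr 1 with y
  rw [convRe, ← integral_const_mul]
  refine integral_congr_ae ?_
  filter_upwards [coeFn_lowL2 hχ J (θ₁ - θ₂)] with x hx
  rw [hx, reflect_apply, zero_sub, neg_sub]
  ring

/-- Substituting `θ₁ = (m + w) / 2` and `θ₂ = (m - w) / 2`, the two terms `w R^⊥ w` have opposite
signs. Only the symmetric form in `m` and `w` remains, which is what the commutator estimate needs.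
-/
lemma flux_ae_eq (θ₁ θ₂ : L2) (i : Fin 2) : flux θ₁ θ₂ i =ᵐ[volume] fun x =>
    2⁻¹ * ((θ₁ + θ₂ : L2) x * rieszPerp (θ₁ - θ₂) i x +
      (θ₁ - θ₂ : L2) x * rieszPerp (θ₁ + θ₂) i x) := by
  have h2 : rieszPerp (θ₁ + θ₂) i = rieszPerp θ₁ i + rieszPerp θ₂ i := by
    have h := rieszPerp_sub (θ₁ + θ₂) θ₂ i
    rw [add_sub_cancel_right] at h
    rw [h]; abel
  rw [rieszPerp_sub, h2]
  unfold flux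
  rw [rieszPerp_sub]
  filter_upwards [Lp.coeFn_add θ₁ θ₂, Lp.coeFn_sub θ₁ θ₂,
    Lp.coeFn_add (rieszPerp θ₁ i) (rieszPerp θ₂ i),
    Lp.coeFn_sub (rieszPerp θ₁ i) (rieszPerp θ₂ i)] with x h1 h2 h3 h4
  simp only [h1, h2, h3, h4, Pi.add_apply, Pi.sub_apply]
  ring

lemma enorm_integral_symm_rieszPerp_le (hχ : IsCutoff χ) {p : ℝ} (hp : 2 < p) :
    ∃ A : ℝ≥0∞, A ≠ ⊤ ∧ ∀ (i : Fin 2) (B : ℝ) (V : Plane → ℝ), 0 ≤ B → Measurable V →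
      (∀ x, |V x| ≤ B) →
      eLpNorm V 2 volume ≤ ENNReal.ofReal B → (∀ x z, |V x - V (x - z)| ≤ B * ‖z‖) →
      (∀ z, eLpNorm (fun x => V x - V (x - z)) 2 volume ≤ ENNReal.ofReal (B * ‖z‖)) →
      ∀ m w : L2, ‖∫ x, (m x * rieszPerp w i x + w x * rieszPerp m i x) * V x‖ₑ ≤
        A * (ENNReal.ofReal B * eLpNorm m 2 volume * eLpNorm w (ENNReal.ofReal p) volume) := by
  obtain ⟨A0, hA0, h0⟩ := enorm_integral_symm_riesz_le hχ 0 hp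
  obtain ⟨A1, hA1, h1⟩ := enorm_integral_symm_riesz_le hχ 1 hp
  refine ⟨A0 + A1, by finiteness, ?_⟩
  intro i B V hB hV hVB hV2 hD1 hD2 m w
  fin_cases i
  · have e : ∫ x, (m x * rieszPerp w 0 x + w x * rieszPerp m 0 x) * V x =
        -∫ x, (m x * riesz 1 w x + w x * riesz 1 m x) * V x := by
      rw [← integral_neg]
      refine integral_congr_ae ?_
      rw [rieszPerp_zero, rieszPerp_zero]
      filter_upwards [Lp.coeFn_neg (riesz 1 w), Lp.coeFn_neg (riesz 1 m)] with x e1 e2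
      rw [e1, e2, Pi.neg_apply, Pi.neg_apply]
      ring
    simp only [Fin.zero_eta]
    rw [e, enorm_neg]
    exact (h1 B V hB hV hVB hV2 hD1 hD2 m w).trans (by gcongr; exact le_add_self)
  · simp only [Fin.mk_one, rieszPerp_one]
    exact (h0 B V hB hV hVB hV2 hD1 hD2 m w).trans (by gcongr; exact le_self_add)

/-- The transfer of energy is controlled by an `L²` norm, an `L^p` norm with `p > 2` of the
difference and the low frequencies of the difference. -/
theorem enorm_transfer_le (hχ : IsCutoff χ) (J : ℤ) {p : ℝ} (hp : 2 < p) :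
    ∃ A : ℝ≥0∞, A ≠ ⊤ ∧ ∀ θ₁ θ₂ : L2, ‖transfer χ J θ₁ θ₂‖ₑ ≤ A * eLpNorm (θ₁ + θ₂ : L2) 2 volume *
      eLpNorm (θ₁ - θ₂ : L2) (ENNReal.ofReal p) volume * ‖lowL2 hχ J (θ₁ - θ₂)‖ₑ := by
  obtain ⟨A, hA, h⟩ := enorm_integral_symm_rieszPerp_le hχ hp
  choose B hB hV using fun i => convRe_bounds (reflect (gradKernel hχ J i) 0)
  refine ⟨∑ i, A * ENNReal.ofReal (B i),
    ENNReal.sum_ne_top.mpr fun i _ => ENNReal.mul_ne_top hA ENNReal.ofReal_ne_top, fun θ₁ θ₂ => ?_⟩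
  set v := lowL2 hχ J (θ₁ - θ₂)
  rw [transfer_eq hχ, Finset.sum_mul, Finset.sum_mul, Finset.sum_mul]
  refine (enorm_sum_le _ _).trans (Finset.sum_le_sum fun i _ => ?_)
  obtain ⟨b1, b2, b3, b4⟩ := hV i v
  -- The weight depends linearly on `v = w_{<J}`, so its four bounds carry the factor `‖v‖`.
  have hi := h i (B i * ‖v‖) _ (by have := hB i; positivity)
    (continuous_convRe _ v).measurable b1 b2 b3 b4 (θ₁ + θ₂) (θ₁ - θ₂)
  have e : ∫ y, flux θ₁ θ₂ i y * convRe (reflect (gradKernel hχ J i) 0) v y =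
      2⁻¹ * ∫ y, ((θ₁ + θ₂ : L2) y * rieszPerp (θ₁ - θ₂) i y +
      (θ₁ - θ₂ : L2) y * rieszPerp (θ₁ + θ₂) i y) *
        convRe (reflect (gradKernel hχ J i) 0) v y := by
    rw [← integral_const_mul]
    refine integral_congr_ae ?_
    filter_upwards [flux_ae_eq θ₁ θ₂ i] with y hy
    rw [hy]; ring
  rw [e, enorm_mul]
  have h2 : ‖(2⁻¹ : ℝ)‖ₑ ≤ 1 := by
    rw [Real.enorm_of_nonneg (by norm_num)]
    exact ENNReal.ofReal_le_one.mpr (by norm_num)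
  calc _ ≤ 1 * _ := mul_le_mul' h2 hi
    _ = _ := by
      rw [ENNReal.ofReal_mul (hB i).le, ofReal_norm]
      ring

/-! ### Differential inequalities in the sense of distributions in time -/

/-- Mean zero makes the primitive vanish beyond `u` as well as before `l`. Test functions can thus
be constructed by prescribing their derivative. -/
lemma exists_primitive {h : ℝ → ℝ} (hh : ContDiff ℝ ∞ h) {l u : ℝ}
    (hl : ∀ t ≤ l, h t = 0) (hu : ∀ t, u ≤ t → h t = 0) (h0 : ∫ t in l..u, h t = 0) :
    ∃ ψ : ℝ → ℝ, ContDiff ℝ ∞ ψ ∧ (∀ t, deriv ψ t = h t) ∧ (∀ t, ψ t = ∫ s in l..t, h s) ∧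
      HasCompactSupport ψ ∧ tsupport ψ ⊆ Set.Icc l u := by
  have hc := hh.continuous
  have hd : ∀ t, HasDerivAt (fun t => ∫ s in l..t, h s) (h t) t := fun t =>
    intervalIntegral.integral_hasDerivAt_right (hc.intervalIntegrable _ _)
      (hc.stronglyMeasurableAtFilter _ _) hc.continuousAt
  have hderiv : deriv (fun t => ∫ s in l..t, h s) = h := funext fun t => (hd t).deriv
  have hsupp : tsupport (fun t => ∫ s in l..t, h s) ⊆ Set.Icc l u := by
    refine closure_minimal (fun t ht => ?_) isClosed_Icc
    by_contra hcon
    refine ht ?_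
    rw [Set.mem_Icc, not_and_or, not_le, not_le] at hcon
    rcases hcon with hcon | hcon
    · refine (intervalIntegral.integral_congr (g := fun _ => (0 : ℝ)) fun s hs => ?_).trans
        (by simp)
      rw [Set.uIcc_of_ge hcon.le] at hs
      exact hl s hs.2
    · simp only
      rw [← intervalIntegral.integral_add_adjacent_intervals (hc.intervalIntegrable l u)
        (hc.intervalIntegrable u t), h0, zero_add]
      refine (intervalIntegral.integral_congr (g := fun _ => (0 : ℝ)) fun s hs => ?_).trans
        (by simp)
      rw [Set.uIcc_of_le hcon.le] at hs
      exact hu s hs.1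
  refine ⟨_, ?_, fun t => (hd t).deriv, fun t => rfl, isCompact_Icc.of_isClosed_subset
    (isClosed_tsupport _) hsupp, hsupp⟩
  rw [contDiff_infty_iff_deriv, hderiv]
  exact ⟨fun t => (hd t).differentiableAt, hh⟩

/-- A smooth probability density supported in `(c - r, c + r)` and positive there. -/
lemma exists_bump (c : ℝ) {r : ℝ} (hr : 0 < r) : ∃ g : ℝ → ℝ, ContDiff ℝ ∞ g ∧ (∀ t, 0 ≤ g t) ∧
    (∀ t, g t ≠ 0 ↔ |t - c| < r) ∧ (∫ t, g t = 1) := by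
  let f : ContDiffBump c := ⟨r / 2, r, by positivity, by linarith⟩
  refine ⟨f.normed volume, f.contDiff_normed, fun t => f.nonneg_normed t, fun t => ?_,
    f.integral_normed⟩
  have := f.support_normed_eq (μ := (volume : Measure ℝ))
  rw [← Function.mem_support, this, Metric.mem_ball, Real.dist_eq]

lemma intervalIntegral_eq_integral_of_support {h : ℝ → ℝ} {l u : ℝ}
    (hl : ∀ t ≤ l, h t = 0) (hu : ∀ t, u ≤ t → h t = 0) : ∫ t in l..u, h t = ∫ t, h t := by
  refine intervalIntegral.integral_eq_integral_of_support_subset fun t ht => ?_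
  by_contra hcon
  rw [Set.mem_Ioc, not_and_or, not_lt, not_le] at hcon
  rcases hcon with hcon | hcon
  exacts [ht (hl t hcon), ht (hu t hcon.le)]

/-- Gronwall's inequality in the sense of distributions. -/
theorem ae_eq_zero_of_gronwall {T c C₁ : ℝ} (hT : 0 < T) (hC₁ : 0 ≤ C₁) (hc : 0 ≤ c) {E : ℝ → ℝ}
    (hE : AEStronglyMeasurable E (volume.restrict (Set.Ioo 0 T))) (hE0 : ∀ t, 0 ≤ E t)
    (hE1 : ∀ᵐ t ∂(volume.restrict (Set.Ioo 0 T)), E t ≤ C₁ * t)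
    (hG : ∀ ψ : ℝ → ℝ, ContDiff ℝ ∞ ψ → HasCompactSupport ψ → tsupport ψ ⊆ Set.Ioo 0 T →
      (∀ t, 0 ≤ ψ t) → -(∫ t in Set.Ioo 0 T, deriv ψ t * E t) ≤
        c * ∫ t in Set.Ioo 0 T, ψ t * E t) :
    ∀ᵐ t ∂(volume.restrict (Set.Ioo 0 T)), E t = 0 := by
  set μ := volume.restrict (Set.Ioo 0 T) with hμ
  have hint : ∀ ψ : ℝ → ℝ, Continuous ψ → Integrable (fun t => ψ t * E t) μ := by
    intro ψ hψ
    obtain ⟨M, hM⟩ := (isCompact_Icc (a := (0 : ℝ)) (b := T)).exists_bound_of_continuousOn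
      hψ.continuousOn
    refine Integrable.of_bound (hψ.aestronglyMeasurable.mul hE) (M * (C₁ * T)) ?_
    filter_upwards [hE1, ae_restrict_mem measurableSet_Ioo] with t h1 h2
    rw [norm_mul, Real.norm_of_nonneg (hE0 t)]
    have h3 := hM t ⟨h2.1.le, h2.2.le⟩
    have : 0 ≤ M := (norm_nonneg _).trans h3
    exact mul_le_mul h3 (h1.trans (by gcongr; exact h2.2.le)) (hE0 t) this
  -- The integrating factor turns `E' ≤ cE` into `A' ≤ 0`.
  set A : ℝ → ℝ := fun t => Real.exp (-c * t) * E t with hA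
  have hA0 : ∀ t, 0 ≤ A t := fun t => mul_nonneg (Real.exp_pos _).le (hE0 t)
  have hAint : ∀ ψ : ℝ → ℝ, Continuous ψ → Integrable (fun t => ψ t * A t) μ := by
    intro ψ hψ
    refine (hint (fun t => ψ t * Real.exp (-c * t)) (by fun_prop)).congr (.of_forall fun t => ?_)
    simp only [hA]; ring
  have hA1 : ∀ᵐ t ∂μ, A t ≤ C₁ * t := by
    filter_upwards [hE1, ae_restrict_mem measurableSet_Ioo] with t h1 h2
    refine le_trans ?_ h1
    refine mul_le_of_le_one_left (hE0 t) (Real.exp_le_one_iff.mpr ?_)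
    have := h2.1
    nlinarith
  have hGA : ∀ ψ : ℝ → ℝ, ContDiff ℝ ∞ ψ → HasCompactSupport ψ → tsupport ψ ⊆ Set.Ioo 0 T →
      (∀ t, 0 ≤ ψ t) → 0 ≤ ∫ t, deriv ψ t * A t ∂μ := by
    intro ψ hψ hψc hψs hψ0
    have hexp : ContDiff ℝ ∞ fun t : ℝ => Real.exp (-c * t) := by fun_prop
    have h := hG (fun t => Real.exp (-c * t) * ψ t) (hexp.mul hψ) hψc.mul_left
      ((tsupport_mul_subset_right).trans hψs)
      (fun t => mul_nonneg (Real.exp_pos _).le (hψ0 t))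
    have hd : ∀ t, deriv (fun t => Real.exp (-c * t) * ψ t) t =
        Real.exp (-c * t) * deriv ψ t - c * (Real.exp (-c * t) * ψ t) := by
      intro t
      have h1 : HasDerivAt (fun t : ℝ => Real.exp (-c * t)) (Real.exp (-c * t) * (-c * 1)) t :=
        ((hasDerivAt_id t).const_mul (-c)).exp
      have h2 := (hψ.differentiable (by simp) t).hasDerivAt
      refine (h1.mul h2).deriv.trans ?_
      ring
    have e1 : ∫ t, deriv (fun t => Real.exp (-c * t) * ψ t) t * E t ∂μ =
        (∫ t, deriv ψ t * A t ∂μ) - c * ∫ t, Real.exp (-c * t) * ψ t * E t ∂μ := by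
      rw [← integral_const_mul, ← integral_sub (hAint _ (hψ.continuous_deriv (by simp)))
        ((hint _ (hexp.mul hψ).continuous).const_mul c)]
      congr 1 with t
      rw [hd]
      simp only [hA]
      ring
    rw [e1] at h
    linarith
  have key : ∀ r, 0 < r → r < T / 2 → ∀ᵐ t ∂μ, |t - T / 2| < r → E t = 0 := by
    intro r hr hrT
    obtain ⟨g, hg, hg0, hgs, hg1⟩ := exists_bump (T / 2) hr
    -- Monotonicity of `A` in averaged form: the mean against `g`, around `T / 2`, is at most the
    -- mean against a bump `k` near time zero, where `A` is at most `C₁ (2δ)`. The condition on `δ`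
    -- places the mass of `k` before that of `g`.
    have hle : ∀ δ, 0 < δ → 2 * δ < T / 2 - r → ∫ t, g t * A t ∂μ ≤ C₁ * (2 * δ) := by
      intro δ hδ hδr
      obtain ⟨k, hk, hk0, hks, hk1⟩ := exists_bump δ (show 0 < δ / 2 by positivity)
      have hgz : ∀ t, t ≤ T / 2 - r ∨ T / 2 + r ≤ t → g t = 0 := fun t ht => by
        by_contra hcon
        have := (hgs t).mp hcon
        rw [abs_lt] at this
        rcases ht with ht | ht <;> linarith
      have hkz : ∀ t, t ≤ δ / 2 ∨ 2 * δ ≤ t → k t = 0 := fun t ht => by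
        by_contra hcon
        have := (hks t).mp hcon
        rw [abs_lt] at this
        rcases ht with ht | ht <;> linarith
      have hgI : ∀ a b, IntervalIntegrable g volume a b := hg.continuous.intervalIntegrable
      have hkI : ∀ a b, IntervalIntegrable k volume a b := hk.continuous.intervalIntegrable
      have hgu : ∀ u, T / 2 + r ≤ u → ∫ t in (δ / 2)..u, g t = 1 := fun u hu => by
        rw [intervalIntegral_eq_integral_of_support
          (fun t ht => hgz t (.inl (by linarith))) (fun t ht => hgz t (.inr (by linarith))), hg1]
      have hku : ∀ u, 2 * δ ≤ u → ∫ t in (δ / 2)..u, k t = 1 := fun u hu => by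
        rw [intervalIntegral_eq_integral_of_support
          (fun t ht => hkz t (.inl (by linarith))) (fun t ht => hkz t (.inr (by linarith))), hk1]
      obtain ⟨ψ, hψ, hψd, hψi, hψc, hψs⟩ := exists_primitive (h := fun t => k t - g t) (hk.sub hg)
        (l := δ / 2) (u := T / 2 + r)
        (fun t ht => by rw [hkz t (.inl ht), hgz t (.inl (by linarith)), sub_zero])
        (fun t ht => by rw [hkz t (.inr (by linarith)), hgz t (.inr ht), sub_zero])
        (by rw [intervalIntegral.integral_sub (hkI _ _) (hgI _ _), hgu _ le_rfl,
          hku _ (by linarith), sub_self])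
      -- The primitive of `k - g` first gains the unit mass of `k` and only afterwards loses that of
      -- `g`.
      have hψ0 : ∀ t, 0 ≤ ψ t := by
        intro t
        by_cases htl : t ≤ δ / 2
        · have : ψ t = 0 := by
            rcases htl.eq_or_lt with rfl | h
            · rw [hψi]; simp
            · exact image_eq_zero_of_notMem_tsupport fun h' => absurd (hψs h').1 (not_le.mpr h)
          exact this.ge
        rw [not_le] at htl
        rw [hψi, intervalIntegral.integral_sub (hkI _ _) (hgI _ _), sub_nonneg]
        by_cases htu : t ≤ 2 * δ
        · have : ∫ s in (δ / 2)..t, g s = 0 := by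
            refine (intervalIntegral.integral_congr (g := fun _ => (0 : ℝ)) fun s hs => ?_).trans
              (by simp)
            rw [Set.uIcc_of_le htl.le] at hs
            exact hgz s (.inl (by linarith [hs.2]))
          rw [this]
          exact intervalIntegral.integral_nonneg htl.le fun s _ => hk0 s
        · rw [not_le] at htu
          rw [hku t htu.le]
          by_cases htg : T / 2 + r ≤ t
          · rw [hgu t htg]
          · rw [not_le] at htg
            have h1 := intervalIntegral.integral_add_adjacent_intervals (hgI (δ / 2) t)
              (hgI t (T / 2 + r))
            rw [hgu _ le_rfl] at h1
            have := intervalIntegral.integral_nonneg (μ := volume) htg.le fun s _ => hg0 s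
            linarith
      have h := hGA ψ hψ hψc (hψs.trans fun t ht => ⟨by linarith [ht.1], by linarith [ht.2]⟩) hψ0
      simp only [hψd, sub_mul] at h
      rw [integral_sub (hAint k hk.continuous) (hAint g hg.continuous), sub_nonneg] at h
      refine h.trans ?_
      have hkint : Integrable k := by
        by_contra hcon
        rw [integral_undef hcon] at hk1
        exact zero_ne_one hk1
      calc ∫ t, k t * A t ∂μ ≤ ∫ t, k t * (C₁ * (2 * δ)) ∂μ := by
            refine integral_mono_ae (hAint k hk.continuous) (hkint.restrict.mul_const _) ?_
            filter_upwards [hA1] with t ht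
            by_cases htk : k t = 0
            · simp [htk]
            · have h3 := (hks t).mp htk
              rw [abs_lt] at h3
              refine mul_le_mul_of_nonneg_left (ht.trans ?_) (hk0 t)
              gcongr
              linarith
        _ = (∫ t, k t ∂μ) * (C₁ * (2 * δ)) := integral_mul_const _ _
        _ ≤ 1 * (C₁ * (2 * δ)) := by
            gcongr
            rw [← hk1]
            exact setIntegral_le_integral hkint (.of_forall hk0)
        _ = _ := one_mul _
    have hzero : ∫ t, g t * A t ∂μ ≤ 0 := by
      refine le_of_forall_pos_le_add fun ε hε => ?_
      rw [zero_add]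
      -- The first entry keeps the bumps apart, the second makes `2 C₁ δ ≤ ε`; the shift `C₁ + 1`
      -- avoids division by zero.
      set δ := min ((T / 2 - r) / 4) (ε / (2 * (C₁ + 1)))
      have hpos : 0 < T / 2 - r := by linarith
      have hδ : 0 < δ := lt_min (by positivity) (by positivity)
      have hδ1 : δ ≤ (T / 2 - r) / 4 := min_le_left _ _
      have hδ2 : δ ≤ ε / (2 * (C₁ + 1)) := min_le_right _ _
      refine (hle δ hδ (by linarith)).trans ?_
      rw [le_div_iff₀ (by positivity)] at hδ2
      nlinarith
    have h0 : ∀ᵐ t ∂μ, g t * A t = 0 := by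
      have := (integral_eq_zero_iff_of_nonneg (fun t => mul_nonneg (hg0 t) (hA0 t))
        (hAint g hg.continuous)).mp (le_antisymm hzero
          (integral_nonneg fun t => mul_nonneg (hg0 t) (hA0 t)))
      exact this
    filter_upwards [h0] with t ht hts
    rcases mul_eq_zero.mp ht with h | h
    · exact absurd h ((hgs t).mpr hts)
    · exact (mul_eq_zero.mp h).resolve_left (Real.exp_pos _).ne'
  -- Countably many radii increasing to `T / 2` exhaust `(0, T)` with a single null set.
  have hall : ∀ᵐ t ∂μ, ∀ n : ℕ, |t - T / 2| < T / 2 * (1 - 1 / (n + 2)) → E t = 0 := by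
    rw [ae_all_iff]
    intro n
    have h1 : 0 < 1 / ((n : ℝ) + 2) := by positivity
    have h2 : 1 / ((n : ℝ) + 2) < 1 := by
      rw [div_lt_one (by positivity)]
      have : (0 : ℝ) ≤ n := n.cast_nonneg
      linarith
    exact key _ (mul_pos (by positivity) (by linarith)) (by nlinarith)
  filter_upwards [hall, ae_restrict_mem measurableSet_Ioo] with t h1 h2
  have h3 : |t - T / 2| < T / 2 := by rw [abs_lt]; constructor <;> linarith [h2.1, h2.2]
  obtain ⟨n, hn⟩ := exists_nat_one_div_lt (show 0 < 1 - |t - T / 2| / (T / 2) by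
    rw [sub_pos, div_lt_one (by positivity)]; exact h3)
  refine h1 n ?_
  have h4 : 1 / ((n : ℝ) + 2) ≤ 1 / ((n : ℝ) + 1) := by gcongr; norm_num
  have h5 : |t - T / 2| / (T / 2) < 1 - 1 / ((n : ℝ) + 2) := by linarith
  rwa [div_lt_iff₀' (by positivity)] at h5

/-- A function whose distributional derivative on `[0, T)`, initial value included, is bounded by
`B`, is bounded by `B t`. -/
theorem ae_abs_le_of_weak_derivative {T B : ℝ} (hT : 0 < T) {a b : ℝ → ℝ}
    (ha : Integrable a (volume.restrict (Set.Ioo 0 T)))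
    (hb : AEStronglyMeasurable b (volume.restrict (Set.Ioo 0 T)))
    (hbB : ∀ᵐ t ∂(volume.restrict (Set.Ioo 0 T)), |b t| ≤ B)
    (h : ∀ ψ : ℝ → ℝ, ContDiff ℝ ∞ ψ → HasCompactSupport ψ → tsupport ψ ⊆ Set.Iio T →
      ∫ t in Set.Ioo 0 T, (deriv ψ t * a t + ψ t * b t) = 0) :
    ∀ᵐ t ∂(volume.restrict (Set.Ioo 0 T)), |a t| ≤ B * t := by
  set μ := volume.restrict (Set.Ioo 0 T) with hμ
  have hbint : Integrable b μ := Integrable.of_bound hb B hbB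
  set f : ℝ × ℝ → ℝ := {z : ℝ × ℝ | z.2 < z.1}.indicator fun z => b z.2 with hf
  have hS : MeasurableSet {z : ℝ × ℝ | z.2 < z.1} := measurableSet_lt measurable_snd measurable_fst
  have hfint : Integrable f (μ.prod μ) := (hbint.comp_snd μ).indicator hS
  -- The primitive of `b` vanishing at time zero, written as a partial integral over the product so
  -- that integrability and Fubini are at hand. The claim becomes `a = β` almost everywhere.
  set β : ℝ → ℝ := fun s => ∫ t, f (s, t) ∂μ with hβ
  have hβint : Integrable β μ := hfint.integral_prod_left
  have hβB : ∀ s ∈ Set.Ioo 0 T, |β s| ≤ B * s := by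
    intro s hs
    have e : β s = ∫ t in Set.Ioo 0 s, b t := by
      have e1 : ∀ t, f (s, t) = (Set.Iio s).indicator b t := fun t => by
        simp [hf, Set.indicator_apply]
      simp only [hβ, e1]
      rw [integral_indicator measurableSet_Iio, hμ, Measure.restrict_restrict measurableSet_Iio]
      congr 2
      ext t
      simp only [Set.mem_inter_iff, Set.mem_Iio, Set.mem_Ioo]
      constructor
      · rintro ⟨h1, h2, -⟩; exact ⟨h2, h1⟩
      · rintro ⟨h1, h2⟩; exact ⟨h2, h1, h2.trans hs.2⟩
    rw [e, ← Real.norm_eq_abs]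
    have hsub : Set.Ioo 0 s ⊆ Set.Ioo 0 T := Set.Ioo_subset_Ioo_right hs.2.le
    refine (norm_setIntegral_le_of_norm_le_const_ae (C := B) (by simp) ?_).trans (le_of_eq ?_)
    · exact ae_restrict_of_ae_restrict_of_subset hsub hbB
    · simp [hs.1.le]
  have hmain : ∀ᵐ s, s ∈ Set.Ioo 0 T → a s - β s = 0 := by
    refine isOpen_Ioo.ae_eq_zero_of_integral_contDiff_smul_eq_zero
      (IntegrableOn.locallyIntegrableOn (ha.sub hβint)) fun g hg hgc hgs => ?_
    -- The bump `k` lives in `(-2, 0)`. With `ψ' = (∫ g) k - g` the function `ψ` has compact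
    -- support, while on `(0, T)` it satisfies `ψ' = -g` and `ψ(t) = ∫_t^T g`. Its value at zero
    -- need not vanish, and this is how the zero initial value is used.
    obtain ⟨k, hk, hk0, hks, hk1⟩ := exists_bump (-1) one_pos
    have hgz : ∀ t, t ≤ 0 ∨ T ≤ t → g t = 0 := fun t ht =>
      image_eq_zero_of_notMem_tsupport fun h' => by
        have := hgs h'
        rcases ht with ht | ht <;> linarith [this.1, this.2]
    have hkz : ∀ t, t ≤ -2 ∨ 0 ≤ t → k t = 0 := fun t ht => by
      by_contra hcon
      have := (hks t).mp hcon
      rw [abs_lt] at this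
      rcases ht with ht | ht <;> linarith
    -- A time strictly before `T` after which `g` vanishes, so that the closed support of `ψ` stays
    -- below `T`.
    obtain ⟨u, hu0, huT, hgu⟩ : ∃ u, 0 < u ∧ u < T ∧ ∀ t, u ≤ t → g t = 0 := by
      by_cases hne : (tsupport g).Nonempty
      · obtain ⟨u, hu, hmax⟩ := hgc.isCompact.exists_isMaxOn hne continuousOn_id
        refine ⟨(u + T) / 2, ?_, ?_, fun t ht => ?_⟩
        · linarith [(hgs hu).1, (hgs hu).2]
        · linarith [(hgs hu).2]
        · refine image_eq_zero_of_notMem_tsupport fun h' => ?_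
          have h1 : t ≤ u := hmax h'
          linarith [(hgs hu).2]
      · refine ⟨T / 2, by linarith, by linarith, fun t _ => ?_⟩
        exact image_eq_zero_of_notMem_tsupport fun h' => hne ⟨t, h'⟩
    set m := ∫ t, g t with hm
    have hgI : ∀ a b, IntervalIntegrable g volume a b := hg.continuous.intervalIntegrable
    have hkI : ∀ a b, IntervalIntegrable (fun t => m * k t) volume a b :=
      (continuous_const.mul hk.continuous).intervalIntegrable
    have hku : ∀ v, 0 ≤ v → ∫ t in (-2)..v, m * k t = m := fun v hv => by
      rw [intervalIntegral.integral_const_mul, intervalIntegral_eq_integral_of_support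
        (fun t ht => hkz t (.inl ht)) (fun t ht => hkz t (.inr (by linarith))), hk1,
        mul_one]
    have hgv : ∫ t in (-2)..u, g t = m :=
      intervalIntegral_eq_integral_of_support
        (fun t ht => hgz t (.inl (by linarith))) hgu
    obtain ⟨ψ, hψ, hψd, hψi, hψc, hψs⟩ := exists_primitive (h := fun t => m * k t - g t)
      ((contDiff_const.mul hk).sub hg) (l := -2) (u := u)
      (fun t ht => by rw [hkz t (.inl ht), hgz t (.inl (by linarith)), mul_zero, sub_zero])
      (fun t ht => by rw [hkz t (.inr (by linarith)), hgu t ht, mul_zero, sub_zero])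
      (by rw [intervalIntegral.integral_sub (hkI _ _) (hgI _ _), hgv, hku _ hu0.le, sub_self])
    have hψt : ∀ t ∈ Set.Ioo 0 T, ψ t = ∫ s, {s | t < s}.indicator g s ∂μ := by
      intro t ht
      have e1 : ψ t = ∫ s in t..T, g s := by
        have e2 : ∫ s in (-2)..T, g s = m := intervalIntegral_eq_integral_of_support
          (fun t ht => hgz t (.inl (by linarith))) (fun t ht => hgz t (.inr ht))
        rw [hψi, intervalIntegral.integral_sub (hkI _ _) (hgI _ _), hku _ ht.1.le, ← e2,
          ← intervalIntegral.integral_add_adjacent_intervals (hgI (-2) t) (hgI t T)]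
        ring
      have hms : MeasurableSet {s | t < s} := measurableSet_Ioi
      rw [e1, intervalIntegral.integral_of_le ht.2.le, integral_Ioc_eq_integral_Ioo,
        integral_indicator hms, hμ, Measure.restrict_restrict hms]
      congr 2
      ext s
      simp only [Set.mem_inter_iff, Set.mem_ofPred_eq, Set.mem_Ioo]
      constructor
      · rintro ⟨h1, h2⟩; exact ⟨h1, ht.1.trans h1, h2⟩
      · rintro ⟨h1, -, h2⟩; exact ⟨h1, h2⟩
    obtain ⟨M, hM⟩ := hgc.exists_bound_of_continuous hg.continuous
    have hgf : Integrable (fun z : ℝ × ℝ => g z.1 * f z) (μ.prod μ) :=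
      hfint.bdd_mul (hg.continuous.comp continuous_fst).aestronglyMeasurable
        (.of_forall fun z => hM z.1)
    have hfub : ∫ t, ψ t * b t ∂μ = ∫ s, g s * β s ∂μ := by
      have e1 : ∫ s, g s * β s ∂μ = ∫ s, ∫ t, g s * f (s, t) ∂μ ∂μ := by
        congr 1 with s
        rw [hβ, integral_const_mul]
      rw [e1, integral_integral_swap hgf]
      refine setIntegral_congr_fun measurableSet_Ioo fun t ht => ?_
      rw [hψt t ht, ← integral_mul_const]
      congr 1 with s
      simp only [hf, Set.indicator_apply, Set.mem_ofPred_eq]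
      split_ifs <;> simp
    have hψb : Integrable (fun t => ψ t * b t) μ := by
      obtain ⟨M', hM'⟩ := hψc.exists_bound_of_continuous hψ.continuous
      exact hbint.bdd_mul hψ.continuous.aestronglyMeasurable (.of_forall hM')
    have hga : Integrable (fun t => g t * a t) μ :=
      ha.bdd_mul hg.continuous.aestronglyMeasurable (.of_forall hM)
    have hgβ : Integrable (fun t => g t * β t) μ :=
      hβint.bdd_mul hg.continuous.aestronglyMeasurable (.of_forall hM)
    have hw := h ψ hψ hψc (hψs.trans fun t ht => lt_of_le_of_lt ht.2 huT)
    have hda : ∫ t in Set.Ioo 0 T, (deriv ψ t * a t + ψ t * b t) =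
        ∫ t, (-(g t * a t) + ψ t * b t) ∂μ := by
      refine setIntegral_congr_fun measurableSet_Ioo fun t ht => ?_
      simp only [hψd]
      rw [hkz t (.inr ht.1.le)]
      ring
    have hgan : Integrable (fun t => -(g t * a t)) μ := hga.neg
    rw [hda, integral_add hgan hψb, integral_neg, hfub] at hw
    have hres : ∫ x, g x • (a x - β x) = ∫ x, g x • (a x - β x) ∂μ := by
      rw [hμ, setIntegral_eq_integral_of_forall_compl_eq_zero]
      intro x hx
      have : g x = 0 := image_eq_zero_of_notMem_tsupport fun h' => hx (hgs h')
      rw [this, zero_smul]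
    rw [hres]
    simp only [smul_eq_mul, mul_sub]
    rw [integral_sub hga hgβ]
    linarith
  rw [← ae_restrict_iff' measurableSet_Ioo] at hmain
  filter_upwards [hmain, ae_restrict_mem measurableSet_Ioo] with s h1 h2
  rw [sub_eq_zero.mp h1]
  exact hβB s h2

/-! ### Derivatives of smoothed functions and the fractional Laplacian of test functions -/

lemma fourier_lineDeriv_apply (Ψ : 𝓢(Plane, ℂ)) (e ξ : Plane) :
    𝓕 (∂_{e} Ψ) ξ = (2 * Real.pi * Complex.I) * ((inner ℝ ξ e : ℝ) * 𝓕 Ψ ξ) := by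
  rw [SchwartzMap.fourier_lineDerivOp_eq]
  have : (inner ℝ · e : Plane → ℝ).HasTemperateGrowth := by fun_prop
  simp [SchwartzMap.smulLeftCLM_apply_apply this]

/-- Differentiation under the Fourier integral; the first moment of the transform is integrable by
Cauchy–Schwarz, because `𝓕 Ψ` decays. -/
lemma hasFDerivAt_convRe (Ψ : 𝓢(Plane, ℂ)) (f : L2) (x : Plane) :
    DifferentiableAt ℝ (convRe Ψ f) x ∧
      ∀ e, fderiv ℝ (convRe Ψ f) x e = convRe (∂_{e} Ψ) f x := by
  set m : Plane → ℂ := fun ξ => 𝓕 Ψ ξ * (𝓕 (toC f) : L2C) ξ with hm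
  have hmi : Integrable m := integrable_schwartz_mul _ _
  obtain ⟨C, hC0, -, -, -, hC4, -⟩ := exists_schwartz_bounds (𝓕 Ψ)
  have hmi' : Integrable fun ξ => ‖ξ‖ * ‖m ξ‖ := by
    have := MemLp.integrable_mul hC4 (Lp.memLp (𝓕 (toC f) : L2C)).norm
    refine this.congr (.of_forall fun ξ => ?_)
    simp only [hm, norm_mul, Pi.mul_apply]
    ring
  have h1 := Real.hasFDerivAt_fourier hmi hmi' (-x)
  have h2 : HasFDerivAt (fun y : Plane => -y) (-ContinuousLinearMap.id ℝ Plane) x :=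
    (hasFDerivAt_id x).neg
  have h3 := Complex.reCLM.hasFDerivAt.comp x (h1.comp x h2)
  have e0 : convRe Ψ f = Complex.reCLM ∘ (𝓕 m ∘ fun y : Plane => -y) := by
    funext y
    rw [convRe_eq, Real.fourierInv_eq_fourier_neg]
    rfl
  rw [e0]
  refine ⟨h3.differentiableAt, fun e => ?_⟩
  rw [h3.fderiv, convRe_eq, Real.fourierInv_eq_fourier_neg]
  simp only [ContinuousLinearMap.comp_apply, neg_apply,
    ContinuousLinearMap.id_apply, Complex.reCLM_apply]
  congr 1
  have hint : Integrable (VectorFourier.fourierSMulRight (innerSL ℝ) m) := by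
    refine (hmi'.const_mul (2 * Real.pi * ‖innerSL ℝ (E := Plane)‖)).mono'
      (hmi.1.fourierSMulRight) (.of_forall fun ξ => ?_)
    have := VectorFourier.norm_fourierSMulRight_le (innerSL ℝ) m ξ
    rwa [mul_assoc _ ‖ξ‖] at this
  rw [Real.fourier_continuousLinearMap_apply hint, Real.fourier_eq, Real.fourier_eq]
  congr 1 with ξ
  rw [VectorFourier.fourierSMulRight_apply, fourier_lineDeriv_apply]
  have hin : (innerSL ℝ ξ) (-e) = -inner ℝ ξ e := by rw [map_neg]; rfl
  rw [hin]
  simp only [hm, inner_neg_right, smul_eq_mul, Complex.real_smul]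
  push_cast
  congr 1
  ring

lemma contDiff_convRe (Ψ : 𝓢(Plane, ℂ)) (f : L2) : ContDiff ℝ ∞ (convRe Ψ f) := by
  rw [contDiff_infty]
  intro n
  induction n generalizing Ψ with
  | zero => exact contDiff_zero.mpr (continuous_convRe Ψ f)
  | succ n ih =>
    push_cast
    rw [contDiff_succ_iff_fderiv_apply]
    refine ⟨fun x => (hasFDerivAt_convRe Ψ f x).1, by simp, fun e => ?_⟩
    simp only [(hasFDerivAt_convRe Ψ f _).2]
    exact ih _

lemma norm_le_sum_coord (ξ : Plane) : ‖ξ‖ ≤ ∑ i : Fin 2, |ξ i| := by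
  rw [EuclideanSpace.norm_eq, Real.sqrt_le_left (Finset.sum_nonneg fun i _ => abs_nonneg _)]
  simp only [Fin.sum_univ_two, Real.norm_eq_abs]
  nlinarith [abs_nonneg (ξ 0), abs_nonneg (ξ 1)]

lemma eLpNorm_fourier_schwartz (Ψ : 𝓢(Plane, ℂ)) :
    eLpNorm (𝓕 Ψ : 𝓢(Plane, ℂ)) 2 volume = eLpNorm Ψ 2 volume := by
  have h := SchwartzMap.norm_fourier_toL2_eq Ψ
  rw [SchwartzMap.norm_toLp, SchwartzMap.norm_toLp] at h
  have hfin : ∀ H : 𝓢(Plane, ℂ), eLpNorm H 2 (volume : Measure Plane) ≠ ⊤ := fun H =>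
    (H.memLp 2 (volume : Measure Plane)).2.ne
  rwa [ENNReal.toReal_eq_toReal_iff' (hfin _) (hfin _)] at h

/-- A real test function as a complex Schwartz function. -/
lemma exists_schwartz_ofReal {η : Plane → ℝ} (hη : ContDiff ℝ ∞ η) (hηc : HasCompactSupport η) :
    ∃ H : 𝓢(Plane, ℂ), (∀ x, H x = (η x : ℂ)) ∧ ∀ e x, (∂_{e} H) x = (fderiv ℝ η x e : ℂ) := by
  have hc : HasCompactSupport (fun x => (η x : ℂ)) := by
    refine hηc.mono fun x hx => ?_
    simpa using hx
  have hd : ContDiff ℝ ∞ (fun x => (η x : ℂ)) := Complex.ofRealCLM.contDiff.comp hη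
  obtain ⟨H, hH⟩ : ∃ H : 𝓢(Plane, ℂ), ∀ x, H x = (η x : ℂ) := ⟨hc.toSchwartzMap hd, fun x => rfl⟩
  refine ⟨H, hH, fun e x => ?_⟩
  have h1 : HasFDerivAt (fun x => (η x : ℂ)) (Complex.ofRealCLM ∘L fderiv ℝ η x) x :=
    Complex.ofRealCLM.hasFDerivAt.comp x ((hη.differentiable (by simp)) x).hasFDerivAt
  rw [SchwartzMap.lineDerivOp_apply_eq_fderiv, show (H : Plane → ℂ) = fun x => (η x : ℂ) from funext hH, h1.fderiv]
  rfl

lemma norm_fourier_lineDeriv_single (H : 𝓢(Plane, ℂ)) (i : Fin 2) (ξ : Plane) :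
    ‖𝓕 (∂_{(EuclideanSpace.single i 1 : Plane)} H) ξ‖ = 2 * Real.pi * (|ξ i| * ‖𝓕 H ξ‖) := by
  rw [fourier_lineDeriv_apply]
  simp [abs_of_pos Real.pi_pos, EuclideanSpace.inner_single_right]

/-- Since `2α < 1`, the symbol is at most `1 + 2π ‖ξ‖`, and `‖ξ‖` is at most the sum of the absolute
coordinates, which are the symbols of first derivatives. -/
lemma norm_fracSymbol_mul_le {α : ℝ} (hα0 : 0 < α) (hα1 : α < 1 / 2) (H : 𝓢(Plane, ℂ))
    (ξ : Plane) : ‖(((2 * Real.pi * ‖ξ‖) ^ (2 * α) : ℝ) : ℂ) * 𝓕 H ξ‖ ≤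
      ‖𝓕 H ξ‖ + ∑ i : Fin 2, ‖𝓕 (∂_{(EuclideanSpace.single i 1 : Plane)} H) ξ‖ := by
  have h0 : 0 ≤ 2 * Real.pi * ‖ξ‖ := by positivity
  have h1 : (2 * Real.pi * ‖ξ‖) ^ (2 * α) ≤ 1 + 2 * Real.pi * ‖ξ‖ := by
    by_cases hle : 2 * Real.pi * ‖ξ‖ ≤ 1
    · linarith [Real.rpow_le_one h0 hle (by linarith : 0 ≤ 2 * α)]
    · have := Real.rpow_le_rpow_of_exponent_le (not_le.mp hle).le (by linarith : 2 * α ≤ 1)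
      rw [Real.rpow_one] at this
      linarith
  have h2 := norm_le_sum_coord ξ
  simp only [Fin.sum_univ_two] at h2 ⊢
  rw [norm_fourier_lineDeriv_single, norm_fourier_lineDeriv_single, norm_mul, Complex.norm_real,
    Real.norm_of_nonneg (by positivity)]
  have h3 : 2 * Real.pi * ‖ξ‖ ≤ 2 * Real.pi * (|ξ 0| + |ξ 1|) := by gcongr
  calc _ ≤ (1 + 2 * Real.pi * (|ξ 0| + |ξ 1|)) * ‖𝓕 H ξ‖ := by gcongr; linarith
    _ = _ := by ring

/-- For `2α < 1`, `(-Δ)^α` maps `H¹` to `L²`. -/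
lemma fracLaplacian_bound {α : ℝ} (hα0 : 0 < α) (hα1 : α < 1 / 2) {η : Plane → ℝ}
    (hη : ContDiff ℝ ∞ η) (hηc : HasCompactSupport η) :
    MemLp (fracLaplacian α η) 2 ∧ eLpNorm (fracLaplacian α η) 2 volume ≤ eLpNorm η 2 volume +
      ∑ i : Fin 2, eLpNorm (fun x => fderiv ℝ η x (EuclideanSpace.single i 1)) 2 volume := by
  obtain ⟨H, hH, hDx⟩ := exists_schwartz_ofReal hη hηc
  have hHf : (H : Plane → ℂ) = fun x => (η x : ℂ) := funext hH
  obtain ⟨G, hG⟩ : ∃ G : 𝓢(Plane, ℂ), G = 𝓕 H := ⟨_, rfl⟩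
  obtain ⟨D, hD⟩ : ∃ D : Fin 2 → 𝓢(Plane, ℂ),
      ∀ i, D i = 𝓕 (∂_{(EuclideanSpace.single i 1 : Plane)} H) := ⟨_, fun i => rfl⟩
  obtain ⟨h, hh⟩ : ∃ h : Plane → ℂ,
      h = fun ξ => (((2 * Real.pi * ‖ξ‖) ^ (2 * α) : ℝ) : ℂ) * G ξ := ⟨_, rfl⟩
  have hpt : ∀ ξ, ‖h ξ‖ ≤ ‖G ξ‖ + ∑ i, ‖D i ξ‖ := by
    intro ξ
    simp only [hh, hG, hD]
    exact norm_fracSymbol_mul_le hα0 hα1 H ξ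
  have hmeas : AEStronglyMeasurable h volume := by
    rw [hh]
    refine Measurable.aestronglyMeasurable (Measurable.mul ?_ G.continuous.measurable)
    fun_prop
  have hsum : Integrable (fun ξ => ‖G ξ‖ + ∑ i, ‖D i ξ‖) :=
    G.integrable.norm.add (integrable_finsetSum Finset.univ fun i _ => (D i).integrable.norm)
  have h1 : Integrable h := hsum.mono' hmeas (.of_forall hpt)
  have hdom : MemLp (fun ξ => ‖G ξ‖ + ∑ i, ‖D i ξ‖) 2 :=
    (G.memLp 2).norm.add (memLp_finsetSum Finset.univ fun i _ => ((D i).memLp 2).norm)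
  have hle : ∀ ξ, ‖h ξ‖ ≤ ‖‖G ξ‖ + ∑ i, ‖D i ξ‖‖ := fun ξ => by
    rw [Real.norm_of_nonneg (by positivity)]
    exact hpt ξ
  have h2 : MemLp h 2 := hdom.of_le hmeas (.of_forall hle)
  have e : fracLaplacian α η = fun x => (𝓕⁻ h x).re := by
    funext x
    rw [fracLaplacian, hh, hG]
    simp only [SchwartzMap.fourier_coe, hHf]
  obtain ⟨r1, r2⟩ := eLpNorm_re_fourierInv_le h1 h2
  rw [e]
  refine ⟨r1, r2.trans ?_⟩
  have e1 : eLpNorm η 2 volume = eLpNorm G 2 volume := by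
    rw [hG, eLpNorm_fourier_schwartz, hHf]
    refine eLpNorm_congr_norm_ae (.of_forall fun x => ?_)
    simp
  have e2 : ∀ i, eLpNorm (fun x => fderiv ℝ η x (EuclideanSpace.single i 1)) 2 volume =
      eLpNorm (D i) 2 volume := by
    intro i
    rw [hD, eLpNorm_fourier_schwartz]
    refine eLpNorm_congr_norm_ae (.of_forall fun x => ?_)
    rw [hDx]
    simp
  rw [e1, Finset.sum_congr rfl fun i _ => e2 i, Lp.norm_toLp,
    ENNReal.ofReal_toReal h2.eLpNorm_ne_top]
  refine (eLpNorm_mono hle).trans ((eLpNorm_add_le G.continuous.norm.aestronglyMeasurable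
    (continuous_finsetSum Finset.univ fun i _ =>
      (D i).continuous.norm).aestronglyMeasurable (by norm_num)).trans ?_)
  rw [eLpNorm_norm]
  gcongr
  have h3 : (fun ξ => ∑ i, ‖D i ξ‖) = ∑ i, fun ξ => ‖D i ξ‖ := by
    funext ξ
    simp
  rw [h3]
  refine (eLpNorm_sum_le (fun i _ => (D i).continuous.norm.aestronglyMeasurable)
    (by norm_num)).trans (le_of_eq ?_)
  exact Finset.sum_congr rfl fun i _ => eLpNorm_norm _

/-! ### The equation tested against products -/

lemma integral_mul_eq_inner (f : L2) {g : Plane → ℝ} (hg : MemLp g 2) :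
    ∫ x, f x * g x = inner ℝ (hg.toLp g) f := by
  rw [L2.inner_def]
  refine integral_congr_ae ?_
  filter_upwards [hg.coeFn_toLp] with x hx
  simp [hx]

lemma continuous_integral_mul {g : Plane → ℝ} (hg : MemLp g 2) :
    Continuous fun f : L2 => ∫ x, f x * g x := by
  simp_rw [integral_mul_eq_inner _ hg]
  exact continuous_const.inner continuous_id

lemma norm_toLp_le_of_eLpNorm_le {g : Plane → ℝ} (hg : MemLp g 2) {D : ℝ} (hD : 0 ≤ D)
    (h : eLpNorm g 2 volume ≤ ENNReal.ofReal D) : ‖hg.toLp g‖ ≤ D := by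
  rw [Lp.norm_toLp]
  exact ENNReal.toReal_le_of_le_ofReal hD h

lemma abs_integral_mul_le (f : L2) {g : Plane → ℝ} (hg : MemLp g 2) {D : ℝ} (hD : 0 ≤ D)
    (h : eLpNorm g 2 volume ≤ ENNReal.ofReal D) : |∫ x, f x * g x| ≤ D * ‖f‖ := by
  rw [integral_mul_eq_inner _ hg]
  exact (abs_real_inner_le_norm _ _).trans
    (mul_le_mul_of_nonneg_right (norm_toLp_le_of_eLpNorm_le hg hD h) (norm_nonneg _))

/-- Multiplication as a Lipschitz map of `L²` makes the nonlinear term continuous in `f`, hence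
measurable in time along a solution. -/
lemma exists_bounded_mul {d : Plane → ℝ} (hd : Continuous d) {D : ℝ} (hD0 : 0 ≤ D)
    (hD : ∀ x, |d x| ≤ D) : ∃ M : L2 → L2, Continuous M ∧
      ∀ f, (M f =ᵐ[volume] fun x => f x * d x) ∧ ‖M f‖ ≤ D * ‖f‖ := by
  have hm : ∀ f : L2, MemLp (fun x => f x * d x) 2 := fun f =>
    (Lp.memLp f).of_le_mul (c := D) ((Lp.aestronglyMeasurable f).mul hd.aestronglyMeasurable)
      (.of_forall fun x => by
        rw [norm_mul, mul_comm]
        exact mul_le_mul_of_nonneg_right (hD x) (norm_nonneg _))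
  refine ⟨fun f => (hm f).toLp _, ?_, fun f => ⟨(hm f).coeFn_toLp, ?_⟩⟩
  · refine LipschitzWith.continuous (K := ⟨D, hD0⟩) (LipschitzWith.of_dist_le_mul fun f g => ?_)
    rw [dist_eq_norm, dist_eq_norm]
    refine Lp.norm_le_mul_norm_of_ae_le_mul ?_
    filter_upwards [(hm f).coeFn_toLp, (hm g).coeFn_toLp, Lp.coeFn_sub f g,
      Lp.coeFn_sub ((hm f).toLp _) ((hm g).toLp _)] with x h1 h2 h3 h4
    rw [h4, Pi.sub_apply, h1, h2, h3, Pi.sub_apply, ← sub_mul, norm_mul, mul_comm]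
    exact mul_le_mul_of_nonneg_right (hD x) (norm_nonneg _)
  · refine Lp.norm_le_mul_norm_of_ae_le_mul ?_
    filter_upwards [(hm f).coeFn_toLp] with x h1
    rw [h1, norm_mul, mul_comm]
    exact mul_le_mul_of_nonneg_right (hD x) (norm_nonneg _)

lemma fracLaplacian_const_mul (α c : ℝ) (η : Plane → ℝ) (x : Plane) :
    fracLaplacian α (fun y => c * η y) x = c * fracLaplacian α η x := by
  have h1 : ∀ ξ, 𝓕 (fun y : Plane => ((c * η y : ℝ) : ℂ)) ξ =
      c * 𝓕 (fun y : Plane => (η y : ℂ)) ξ := by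
    intro ξ
    rw [Real.fourier_eq, Real.fourier_eq, ← integral_const_mul]
    congr 1 with y
    simp only [Circle.smul_def, smul_eq_mul]
    push_cast
    ring
  unfold fracLaplacian
  simp only [h1]
  rw [Real.fourierInv_eq, Real.fourierInv_eq, ← Complex.re_ofReal_mul, ← integral_const_mul]
  congr 2 with ξ
  simp only [Circle.smul_def, smul_eq_mul]
  ring

/-- The right-hand side of the equation tested against `η`. -/
def testedForcing (α : ℝ) (η : Plane → ℝ) (f : L2) : ℝ :=
  (∫ x, ∑ i : Fin 2, f x * rieszPerp f i x * fderiv ℝ η x (EuclideanSpace.single i 1))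
    - ∫ x, f x * fracLaplacian α η x

lemma testedForcing_const_mul (α c : ℝ) {η : Plane → ℝ} (hη : Differentiable ℝ η) (f : L2) :
    testedForcing α (fun y => c * η y) f = c * testedForcing α η f := by
  have h1 : ∀ x, fderiv ℝ (fun y => c * η y) x = c • fderiv ℝ η x := fun x =>
    fderiv_const_mul (hη x) c
  simp only [testedForcing, fracLaplacian_const_mul, h1, mul_sub, ← integral_const_mul,
    Finset.mul_sum]
  congr 1
  · congr 1 with x
    refine Finset.sum_congr rfl fun i _ => ?_
    simp only [smul_apply, smul_eq_mul]
    ring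
  · congr 1 with x
    ring

/-- A test function with its gradient under control in `L^∞` and its `H¹` norm under control. -/
structure TestBound (η : Plane → ℝ) (D : ℝ) : Prop where
  smooth : ContDiff ℝ ∞ η
  compactSupport : HasCompactSupport η
  nonneg : 0 ≤ D
  deriv_le : ∀ i x, |fderiv ℝ η x (EuclideanSpace.single i 1)| ≤ D
  eLpNorm_le : eLpNorm η 2 volume ≤ ENNReal.ofReal D
  eLpNorm_deriv_le : ∀ i, eLpNorm (fun x => fderiv ℝ η x (EuclideanSpace.single i 1)) 2 volume ≤
    ENNReal.ofReal D

lemma TestBound.fracLaplacian_bounds {α : ℝ} (hα0 : 0 < α) (hα1 : α < 1 / 2) {η : Plane → ℝ} {D : ℝ}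
    (h : TestBound η D) : MemLp (fracLaplacian α η) 2 ∧
      eLpNorm (fracLaplacian α η) 2 volume ≤ ENNReal.ofReal (3 * D) := by
  obtain ⟨h1, h2⟩ := fracLaplacian_bound hα0 hα1 h.smooth h.compactSupport
  refine ⟨h1, h2.trans ?_⟩
  have hD := h.nonneg
  rw [Fin.sum_univ_two, show 3 * D = D + (D + D) by ring, ENNReal.ofReal_add hD (by positivity),
    ENNReal.ofReal_add hD hD]
  exact add_le_add h.eLpNorm_le (add_le_add (h.eLpNorm_deriv_le 0) (h.eLpNorm_deriv_le 1))

/-- The quadratic part has two components, each at most `D ‖f‖²` as the Riesz transforms are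
contractions of `L²`. The linear part uses the `L²` bound `3D` for the fractional Laplacian of `η`.
-/
lemma TestBound.testedForcing_bounds {α : ℝ} (hα0 : 0 < α) (hα1 : α < 1 / 2) {η : Plane → ℝ} {D : ℝ}
    (h : TestBound η D) : Continuous (testedForcing α η) ∧
      ∀ f, |testedForcing α η f| ≤ D * (2 * ‖f‖ ^ 2 + 3 * ‖f‖) := by
  have hD := h.nonneg
  have hc : ∀ i : Fin 2, Continuous fun x => fderiv ℝ η x (EuclideanSpace.single i 1) := fun i =>
    (h.smooth.continuous_fderiv (by simp)).clm_apply continuous_const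
  choose M hMc hM using fun i => exists_bounded_mul (hc i) hD (h.deriv_le i)
  obtain ⟨hf1, hf2⟩ := h.fracLaplacian_bounds hα0 hα1
  have e : ∀ f : L2, testedForcing α η f =
      ∑ i : Fin 2, inner ℝ (M i f) (rieszPerp f i) - ∫ x, f x * fracLaplacian α η x := by
    intro f
    have hae : ∀ i, (fun x => f x * rieszPerp f i x * fderiv ℝ η x (EuclideanSpace.single i 1))
        =ᵐ[volume] fun x => inner ℝ (M i f x) (rieszPerp f i x) := by
      intro i
      filter_upwards [(hM i f).1] with x hx
      rw [hx]
      simp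
      ring
    rw [testedForcing, integral_finsetSum Finset.univ fun i _ =>
      (L2.integrable_inner (𝕜 := ℝ) (M i f) (rieszPerp f i)).congr (hae i).symm]
    congr 1
    refine Finset.sum_congr rfl fun i _ => ?_
    rw [L2.inner_def, integral_congr_ae (hae i)]
  refine ⟨?_, fun f => ?_⟩
  · rw [show testedForcing α η = _ from funext e]
    exact (continuous_finsetSum Finset.univ fun i _ =>
      (hMc i).inner (continuous_rieszPerp i)).sub (continuous_integral_mul hf1)
  · rw [e, Fin.sum_univ_two]
    have hi : ∀ i, |inner ℝ (M i f) (rieszPerp f i)| ≤ D * ‖f‖ * ‖f‖ := fun i =>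
      (abs_real_inner_le_norm _ _).trans (mul_le_mul (hM i f).2 (norm_rieszPerp_le f i)
        (norm_nonneg _) (by positivity))
    have hl := abs_integral_mul_le f hf1 (by positivity) hf2
    have h0 := hi 0
    have h1 := hi 1
    rw [abs_le] at *
    constructor <;> nlinarith

lemma IsMarchandSolution.exists_norm_le {α q T : ℝ} {θ₀ : L2} {θ : ℝ → L2}
    (h : IsMarchandSolution α q T θ₀ θ) : ∃ M, 0 ≤ M ∧
      ∀ᵐ t ∂(volume.restrict (Set.Ioo 0 T)), ‖θ t‖ ≤ M := by
  obtain ⟨M, hM⟩ := h.bounded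
  refine ⟨max M 0, le_max_right _ _, ?_⟩
  filter_upwards [hM] with t ht
  rw [Lp.norm_def]
  exact ENNReal.toReal_le_of_le_ofReal (le_max_right _ _)
    (ht.1.trans (ENNReal.ofReal_le_ofReal (le_max_left _ _)))

/-- Product test functions reduce the equation to a scalar one in time. The datum appears only on
the right, so it cancels between two solutions. -/
lemma IsMarchandSolution.weak_mul {α q T : ℝ} {θ₀ : L2} {θ : ℝ → L2}
    (h : IsMarchandSolution α q T θ₀ θ) {η : Plane → ℝ} (hη : ContDiff ℝ ∞ η)
    (hηc : HasCompactSupport η) {ψ : ℝ → ℝ} (hψ : ContDiff ℝ ∞ ψ) (hψc : HasCompactSupport ψ)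
    (hψT : tsupport ψ ⊆ Set.Iio T) :
    ∫ t in Set.Ioo 0 T, (deriv ψ t * (∫ x, θ t x * η x) + ψ t * testedForcing α η (θ t)) =
      -∫ x, θ₀ x * (ψ 0 * η x) := by
  have hsub : tsupport (fun z : ℝ × Plane => ψ z.1 * η z.2) ⊆ tsupport ψ ×ˢ tsupport η := by
    refine closure_minimal (fun z hz => ?_) ((isClosed_tsupport ψ).prod (isClosed_tsupport η))
    have hz' : ψ z.1 * η z.2 ≠ 0 := hz
    exact ⟨subset_tsupport _ (left_ne_zero_of_mul hz'), subset_tsupport _ (right_ne_zero_of_mul hz')⟩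
  have hw := h.weak (fun z => ψ z.1 * η z.2)
    ((hψ.comp contDiff_fst).mul (hη.comp contDiff_snd))
    ((hψc.prod hηc).of_isClosed_subset (isClosed_tsupport _) hsub)
    (hsub.trans (Set.prod_mono hψT (Set.subset_univ _)))
  refine eq_neg_of_add_eq_zero_left (Eq.trans ?_ hw)
  congr 2 with t
  rw [← testedForcing_const_mul α (ψ t) (hη.differentiable (by simp)), testedForcing, ← add_sub_assoc,
    ← integral_const_mul]
  congr 3 with x
  simp only [deriv_mul_const (hψ.differentiable (by simp) t)]
  ring

lemma integrable_mul_add_mul {T : ℝ} {a b ψ : ℝ → ℝ}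
    (ha : Integrable a (volume.restrict (Set.Ioo 0 T)))
    (hb : Integrable b (volume.restrict (Set.Ioo 0 T)))
    (hψ : ContDiff ℝ ∞ ψ) (hψc : HasCompactSupport ψ) :
    Integrable (fun t => deriv ψ t * a t + ψ t * b t) (volume.restrict (Set.Ioo 0 T)) := by
  have hψ' : Continuous (deriv ψ) := hψ.continuous_deriv (by simp)
  obtain ⟨C, hC⟩ := hψc.exists_bound_of_continuous hψ.continuous
  obtain ⟨C', hC'⟩ := hψc.deriv.exists_bound_of_continuous hψ'
  exact (ha.bdd_mul hψ'.aestronglyMeasurable (.of_forall hC')).add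
    (hb.bdd_mul hψ.continuous.aestronglyMeasurable (.of_forall hC))

/-- Two weak solutions with the same initial datum separate at most linearly in time, when tested
against a fixed function. -/
lemma exists_ae_abs_integral_sub_mul_le {α q T : ℝ} (hα0 : 0 < α) (hα1 : α < 1 / 2) (hT : 0 < T)
    {θ₀ : L2} {θ₁ θ₂ : ℝ → L2} (h₁ : IsMarchandSolution α q T θ₀ θ₁)
    (h₂ : IsMarchandSolution α q T θ₀ θ₂) : ∃ C, 0 ≤ C ∧ ∀ η D, TestBound η D →
      ∀ᵐ t ∂(volume.restrict (Set.Ioo 0 T)),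
        |∫ x, (θ₁ t - θ₂ t : L2) x * η x| ≤ C * D * t := by
  obtain ⟨M₁, hM₁0, hM₁⟩ := h₁.exists_norm_le
  obtain ⟨M₂, hM₂0, hM₂⟩ := h₂.exists_norm_le
  refine ⟨(2 * M₁ ^ 2 + 3 * M₁) + (2 * M₂ ^ 2 + 3 * M₂), by positivity, fun η D hη => ?_⟩
  have hD := hη.nonneg
  have hm : MemLp η 2 := hη.smooth.continuous.memLp_of_hasCompactSupport hη.compactSupport
  obtain ⟨hFc, hF⟩ := hη.testedForcing_bounds hα0 hα1
  have hFb : ∀ (f : L2) (M : ℝ), ‖f‖ ≤ M →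
      |testedForcing α η f| ≤ D * (2 * M ^ 2 + 3 * M) := fun f M hf =>
    (hF f).trans (by gcongr)
  have hpair : ∀ {θ : ℝ → L2} {M : ℝ}, AEStronglyMeasurable θ (volume.restrict (Set.Ioo 0 T)) →
      (∀ᵐ t ∂(volume.restrict (Set.Ioo 0 T)), ‖θ t‖ ≤ M) →
      Integrable (fun t => ∫ x, θ t x * η x) (volume.restrict (Set.Ioo 0 T)) ∧
      Integrable (fun t => testedForcing α η (θ t)) (volume.restrict (Set.Ioo 0 T)) := by
    intro θ M hθ hM
    constructor
    · refine Integrable.of_bound ((continuous_integral_mul hm).comp_aestronglyMeasurable hθ)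
        (D * M) ?_
      filter_upwards [hM] with t ht
      exact (abs_integral_mul_le _ hm hD hη.eLpNorm_le).trans (by gcongr)
    · refine Integrable.of_bound (hFc.comp_aestronglyMeasurable hθ) (D * (2 * M ^ 2 + 3 * M)) ?_
      filter_upwards [hM] with t ht
      exact hFb _ _ ht
  obtain ⟨a₁, b₁⟩ := hpair h₁.aestronglyMeasurable hM₁
  obtain ⟨a₂, b₂⟩ := hpair h₂.aestronglyMeasurable hM₂
  -- Subtracting the two scalar equations removes the common datum. The difference of the pairings
  -- has a weak derivative bounded by the two forcings and starts from zero.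
  have key := ae_abs_le_of_weak_derivative (B := D * (2 * M₁ ^ 2 + 3 * M₁) +
    D * (2 * M₂ ^ 2 + 3 * M₂)) hT (a₁.sub a₂) (b₁.sub b₂).1 (by
      filter_upwards [hM₁, hM₂] with t h1 h2
      exact (abs_sub _ _).trans (add_le_add (hFb _ _ h1) (hFb _ _ h2))) (by
      intro ψ hψ hψc hψT
      have e1 := h₁.weak_mul hη.smooth hη.compactSupport hψ hψc hψT
      have e2 := h₂.weak_mul hη.smooth hη.compactSupport hψ hψc hψT
      refine Eq.trans ?_ (sub_eq_zero_of_eq (e1.trans e2.symm))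
      rw [← integral_sub (integrable_mul_add_mul a₁ b₁ hψ hψc) (integrable_mul_add_mul a₂ b₂ hψ hψc)]
      congr 1 with t
      change deriv ψ t * (_ - _) + ψ t * (_ - _) = _
      ring)
  filter_upwards [key] with t ht
  have e : ∫ x, (θ₁ t - θ₂ t : L2) x * η x = (∫ x, θ₁ t x * η x) - ∫ x, θ₂ t x * η x := by
    rw [integral_mul_eq_inner _ hm, integral_mul_eq_inner _ hm, integral_mul_eq_inner _ hm,
      inner_sub_right]
  rw [e]
  refine ht.trans (le_of_eq ?_)
  ring

/-! ### Linear growth of the low frequencies -/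

lemma integrable_re_schwartz_mul (Ψ : 𝓢(Plane, ℂ)) (f : L2) (x : Plane) :
    Integrable fun y => (Ψ (x - y)).re * f y := by
  have hi : Integrable (fun y => Ψ (x - y) * toC f y) := by
    simpa using integrable_schwartz_mul (reflect Ψ x) (toC f)
  refine hi.re.congr ?_
  filter_upwards [coeFn_toC f] with y hy
  simp [hy]

lemma convRe_sub (Ψ : 𝓢(Plane, ℂ)) (f g : L2) (x : Plane) :
    convRe Ψ (f - g) x = convRe Ψ f x - convRe Ψ g x := by
  unfold convRe
  rw [← integral_sub (integrable_re_schwartz_mul Ψ f x) (integrable_re_schwartz_mul Ψ g x)]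
  refine integral_congr_ae ?_
  filter_upwards [Lp.coeFn_sub f g] with y hy
  rw [hy, Pi.sub_apply, mul_sub]

lemma lowL2_sub (hχ : IsCutoff χ) (J : ℤ) (f g : L2) :
    lowL2 hχ J (f - g) = lowL2 hχ J f - lowL2 hχ J g := by
  rw [lowL2, lowL2, lowL2, ← MemLp.toLp_sub, MemLp.toLp_eq_toLp_iff]
  refine .of_forall fun x => ?_
  simp only [low_eq_convRe hχ, convRe_sub, Pi.sub_apply]

lemma continuous_lowL2 (hχ : IsCutoff χ) (J : ℤ) : Continuous (lowL2 hχ J) := by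
  obtain ⟨B, hB, h⟩ := convRe_bounds (lowKernelC hχ J)
  refine LipschitzWith.continuous (K := ⟨B, hB.le⟩) (LipschitzWith.of_dist_le_mul fun f g => ?_)
  rw [dist_eq_norm, dist_eq_norm, ← lowL2_sub]
  refine norm_toLp_le_of_eLpNorm_le _ (by positivity) ?_
  rw [low_eq_convRe hχ]
  exact (h _).2.1

/-- `Δ_{<J}` is symmetric. -/
lemma integral_mul_low_comm (hχ : IsCutoff χ) (J : ℤ) (f g : L2) :
    ∫ x, f x * low χ J g x = ∫ x, g x * low χ J f x := by
  have e : ∀ f g : L2, ∫ x, f x * low χ J g x = (∫ ξ, conj ((𝓕 (toC f) : L2C) ξ) *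
      (lowSchwartz hχ J ξ * (𝓕 (toC g) : L2C) ξ)).re := fun f g => by
    rw [low_eq_convRe hχ]
    unfold convRe
    rw [integral_mul_convolution, fourier_lowKernelC]
  rw [e f g, e g f, ← Complex.conj_re, ← integral_conj]
  congr 2 with ξ
  simp only [map_mul, Complex.conj_conj, lowSchwartz_apply, Complex.conj_ofReal]
  ring

/-- Here `lowSymbol χ n` is a cut-off in physical space. For natural `n` the dilation factor is at
most one, which makes the bound uniform. -/
lemma exists_lowSymbol_deriv_bound (hχ : IsCutoff χ) : ∃ C, 0 ≤ C ∧ ∀ (n : ℕ) (i : Fin 2) x,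
    |fderiv ℝ (lowSymbol χ n) x (EuclideanSpace.single i 1)| ≤ C := by
  obtain ⟨C, hC⟩ := (hχ.compactSupport.fderiv ℝ).exists_bound_of_continuous
    (hχ.smooth.continuous_fderiv (by simp))
  refine ⟨C, (norm_nonneg _).trans (hC 0), fun n i x => ?_⟩
  set c : ℝ := (2 : ℝ) ^ (-(n : ℤ)) with hc
  have hc0 : 0 ≤ c := by positivity
  have hc1 : c ≤ 1 := by
    rw [hc, zpow_neg, zpow_natCast]
    exact inv_le_one_of_one_le₀ (one_le_pow₀ (by norm_num))
  have h1 : HasFDerivAt (lowSymbol χ n)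
      ((fderiv ℝ χ (c • x)) ∘L (c • ContinuousLinearMap.id ℝ Plane)) x :=
    ((hχ.smooth.differentiable (by simp)) (c • x)).hasFDerivAt.comp x
      ((hasFDerivAt_id x).const_smul c)
  rw [h1.fderiv]
  simp only [ContinuousLinearMap.comp_apply, smul_apply, ContinuousLinearMap.id_apply, map_smul,
    smul_eq_mul, abs_mul, abs_of_nonneg hc0]
  have h2 := (fderiv ℝ χ (c • x)).le_opNorm (EuclideanSpace.single i 1)
  rw [PiLp.norm_single, norm_one, mul_one, Real.norm_eq_abs] at h2
  calc _ ≤ 1 * C := mul_le_mul hc1 (h2.trans (hC _)) (abs_nonneg _) zero_le_one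
    _ = C := one_mul C

/-- The function `f_{<J}` need not have compact support, so it is cut off at scale `2^n`. The bound
is uniform in `n`, to allow `n → ∞`, and linear in `‖f‖`, to allow duality. -/
lemma exists_testBound_lowSymbol_mul_low (hχ : IsCutoff χ) (J : ℤ) : ∃ K, 0 ≤ K ∧
    ∀ (n : ℕ) (f : L2), TestBound (fun x => lowSymbol χ n x * low χ J f x) (K * ‖f‖) := by
  obtain ⟨A, hA0, hA⟩ := hχ.exists_bound
  obtain ⟨A', hA'0, hA'⟩ := exists_lowSymbol_deriv_bound hχ
  obtain ⟨B, hB0, hB⟩ := convRe_bounds (lowKernelC hχ J)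
  choose B' hB'0 hB' using fun i : Fin 2 =>
    convRe_bounds (∂_{(EuclideanSpace.single i 1 : Plane)} (lowKernelC hχ J))
  obtain ⟨B₁, hB₁⟩ : ∃ B₁, B₁ = B' 0 + B' 1 := ⟨_, rfl⟩
  have hB₁' : ∀ i, B' i ≤ B₁ := by
    intro i
    have h0 := hB'0 0
    have h1 := hB'0 1
    fin_cases i <;> simp only [Fin.zero_eta, Fin.mk_one, hB₁] <;> linarith
  have hB₁0 : 0 ≤ B₁ := (hB'0 0).le.trans (hB₁' 0)
  refine ⟨A * B + (A * B₁ + A' * B), by positivity, fun n f => ?_⟩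
  have hρ0 : ∀ x, |lowSymbol χ n x| ≤ A := fun x => by
    rw [lowSymbol, abs_of_nonneg (hχ.nonneg _)]
    exact hA _
  have hρd := (contDiff_lowSymbol hχ n).differentiable (by simp)
  obtain ⟨g, hg⟩ : ∃ g, g = low χ J f := ⟨_, rfl⟩
  have hgc : ContDiff ℝ ∞ g := by
    rw [hg, low_eq_convRe hχ]
    exact contDiff_convRe _ _
  have hgb : (∀ x, |g x| ≤ B * ‖f‖) ∧ eLpNorm g 2 volume ≤ ENNReal.ofReal (B * ‖f‖) := by
    rw [hg, low_eq_convRe hχ]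
    exact ⟨(hB f).1, (hB f).2.1⟩
  have hgd : ∀ i : Fin 2, (fun x => fderiv ℝ g x (EuclideanSpace.single i 1)) =
      convRe (∂_{(EuclideanSpace.single i 1 : Plane)} (lowKernelC hχ J)) f := by
    intro i
    funext x
    rw [hg, low_eq_convRe hχ, (hasFDerivAt_convRe _ f x).2]
  have hgdb : ∀ i : Fin 2, (∀ x, |fderiv ℝ g x (EuclideanSpace.single i 1)| ≤ B₁ * ‖f‖) ∧
      eLpNorm (fun x => fderiv ℝ g x (EuclideanSpace.single i 1)) 2 volume ≤
        ENNReal.ofReal (B₁ * ‖f‖) := by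
    intro i
    have hle : B' i * ‖f‖ ≤ B₁ * ‖f‖ := by gcongr; exact hB₁' i
    refine ⟨fun x => ?_, ?_⟩
    · rw [congrFun (hgd i) x]
      exact ((hB' i f).1 x).trans hle
    · rw [hgd]
      exact (hB' i f).2.1.trans (ENNReal.ofReal_le_ofReal hle)
  have hd : ∀ (i : Fin 2) x, fderiv ℝ (fun x => lowSymbol χ n x * g x) x
      (EuclideanSpace.single i 1) = lowSymbol χ n x * fderiv ℝ g x (EuclideanSpace.single i 1) +
        g x * fderiv ℝ (lowSymbol χ n) x (EuclideanSpace.single i 1) := by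
    intro i x
    rw [fderiv_fun_mul (hρd x) (hgc.differentiable (by simp) x)]
    simp
  have hmul : ∀ (u v : Plane → ℝ) (a b : ℝ), 0 ≤ a → (∀ x, |v x| ≤ a) →
      eLpNorm u 2 volume ≤ ENNReal.ofReal (b * ‖f‖) →
      eLpNorm (fun x => v x * u x) 2 volume ≤ ENNReal.ofReal (a * b * ‖f‖) := by
    intro u v a b ha hv hu
    refine (eLpNorm_le_mul_eLpNorm_of_ae_le_mul (c := a) (g := u) (.of_forall fun x => ?_) 2).trans
      ?_
    · rw [norm_mul]
      exact mul_le_mul_of_nonneg_right (hv x) (norm_nonneg _)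
    · rw [mul_assoc a, ENNReal.ofReal_mul ha]
      exact mul_le_mul' le_rfl hu
  rw [← hg]
  have hf := norm_nonneg f
  refine ⟨(contDiff_lowSymbol hχ n).mul hgc, ?_, by positivity, fun i x => ?_, ?_, fun i => ?_⟩
  · exact HasCompactSupport.mul_right (hχ.compactSupport.comp_smul (by positivity))
  · rw [hd]
    refine (abs_add_le _ _).trans ?_
    rw [abs_mul, abs_mul]
    have h1 := mul_le_mul (hρ0 x) ((hgdb i).1 x) (abs_nonneg _) hA0.le
    have h2 := mul_le_mul (hgb.1 x) (hA' n i x) (abs_nonneg _) (by positivity)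
    have h3 : 0 ≤ A * B * ‖f‖ := by positivity
    linarith
  · refine (hmul g _ A B hA0.le hρ0 hgb.2).trans (ENNReal.ofReal_le_ofReal ?_)
    gcongr
    have : 0 ≤ A * B₁ + A' * B := by positivity
    linarith
  · simp_rw [hd]
    have c1 : Continuous fun x => fderiv ℝ g x (EuclideanSpace.single i 1) :=
      (hgc.continuous_fderiv (by simp)).clm_apply continuous_const
    have c2 : Continuous fun x => fderiv ℝ (lowSymbol χ n) x (EuclideanSpace.single i 1) :=
      ((contDiff_lowSymbol hχ n).continuous_fderiv (by simp)).clm_apply continuous_const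
    refine (eLpNorm_add_le ((contDiff_lowSymbol hχ n).continuous.mul c1).aestronglyMeasurable
      (hgc.continuous.mul c2).aestronglyMeasurable (by norm_num)).trans ?_
    have h1 := hmul _ _ A B₁ hA0.le hρ0 (hgdb i).2
    have h2 := hmul g _ A' B hA'0 (hA' n i) hgb.2
    simp_rw [mul_comm _ (g _)] at h2
    refine (add_le_add h1 h2).trans ?_
    rw [← ENNReal.ofReal_add (by positivity) (by positivity)]
    refine ENNReal.ofReal_le_ofReal ?_
    have h3 : 0 ≤ A * B * ‖f‖ := by positivity
    linarith

lemma tendsto_integral_mul_lowSymbol_mul (hχ : IsCutoff χ) (f : L2) {g : Plane → ℝ}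
    (hg : MemLp g 2) : Tendsto (fun n : ℕ => ∫ x, f x * (lowSymbol χ n x * g x)) atTop
      (𝓝 (∫ x, f x * g x)) := by
  obtain ⟨A, hA0, hA⟩ := hχ.exists_bound
  have hi : Integrable fun x => f x * g x := (Lp.memLp f).integrable_mul hg
  refine tendsto_integral_of_dominated_convergence (fun x => A * ‖f x * g x‖) (fun n => ?_)
    (hi.norm.const_mul A) (fun n => .of_forall fun x => ?_) (.of_forall fun x => ?_)
  · exact (Lp.aestronglyMeasurable f).mul
      ((contDiff_lowSymbol hχ n).continuous.aestronglyMeasurable.mul hg.1)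
  · rw [mul_left_comm, norm_mul, lowSymbol, Real.norm_of_nonneg (hχ.nonneg _)]
    exact mul_le_mul_of_nonneg_right (hA _) (norm_nonneg _)
  · refine tendsto_const_nhds.congr' ?_
    filter_upwards [tendsto_lowSymbol_atTop hχ x] with n hn
    rw [hn, one_mul]

/-- If two weak solutions start from the same datum, the low frequencies of their difference grow
at most linearly. -/
lemma exists_ae_norm_lowL2_sub_le (hχ : IsCutoff χ) (J : ℤ) {α q T : ℝ} (hα0 : 0 < α)
    (hα1 : α < 1 / 2) (hT : 0 < T) {θ₀ : L2} {θ₁ θ₂ : ℝ → L2}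
    (h₁ : IsMarchandSolution α q T θ₀ θ₁) (h₂ : IsMarchandSolution α q T θ₀ θ₂) :
    ∃ C, 0 ≤ C ∧ ∀ᵐ t ∂(volume.restrict (Set.Ioo 0 T)), ‖lowL2 hχ J (θ₁ t - θ₂ t)‖ ≤ C * t := by
  have : Fact ((2 : ℝ≥0∞) ≠ ⊤) := ⟨by norm_num⟩
  obtain ⟨C, hC0, hC⟩ := exists_ae_abs_integral_sub_mul_le hα0 hα1 hT h₁ h₂
  obtain ⟨K, hK0, hK⟩ := exists_testBound_lowSymbol_mul_low hχ J
  refine ⟨C * K, by positivity, ?_⟩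
  -- The exceptional null set of times depends on the test function, so only countably many are
  -- used: a dense sequence and all the cut-offs.
  have hall : ∀ᵐ t ∂(volume.restrict (Set.Ioo 0 T)), ∀ k n : ℕ,
      |∫ x, (θ₁ t - θ₂ t : L2) x * (lowSymbol χ n x * low χ J (TopologicalSpace.denseSeq L2 k) x)|
        ≤ C * (K * ‖TopologicalSpace.denseSeq L2 k‖) * t :=
    ae_all_iff.mpr fun k => ae_all_iff.mpr fun n => hC _ _ (hK n _)
  filter_upwards [hall, ae_restrict_mem measurableSet_Ioo] with t ht htT
  have ht0 : 0 < t := htT.1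
  set w := θ₁ t - θ₂ t
  have hlow := memLp_low hχ J w
  -- On the dense sequence, symmetry of `Δ_{<J}` moves the truncation onto the test function and the
  -- cut-off is removed by `n → ∞`; both sides are continuous in `f`.
  have hdense : ∀ f : L2, |∫ x, f x * low χ J w x| ≤ C * (K * ‖f‖) * t := by
    intro f
    refine (TopologicalSpace.denseRange_denseSeq L2).induction_on
      (p := fun f : L2 => |∫ x, f x * low χ J w x| ≤ C * (K * ‖f‖) * t) f ?_ fun k => ?_
    · exact isClosed_le (continuous_integral_mul hlow).abs (by fun_prop)
    · rw [integral_mul_low_comm hχ]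
      exact le_of_tendsto (tendsto_integral_mul_lowSymbol_mul hχ w (memLp_low hχ J _)).abs
        (.of_forall fun n => ht k n)
  -- Duality: the choice `f = w_{<J}` gives `‖w_{<J}‖² ≤ C K ‖w_{<J}‖ t`.
  have h := hdense (lowL2 hχ J w)
  rw [integral_mul_eq_inner _ hlow] at h
  change |inner ℝ (lowL2 hχ J w) (lowL2 hχ J w)| ≤ _ at h
  rw [real_inner_self_eq_norm_sq, abs_of_nonneg (by positivity)] at h
  rcases eq_or_lt_of_le (norm_nonneg (lowL2 hχ J w)) with h0 | h0
  · rw [← h0]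
    positivity
  · nlinarith

/-! ### Uniqueness -/

/-- If the high frequencies are controlled by the low ones in `L^p`, the whole function is controlled
by its low frequencies. -/
lemma eLpNorm_le_of_high_div_low_le (hχ : IsCutoff χ) {J : ℤ} {p B C : ℝ} (hp : 1 ≤ p) {w : L2}
    (hB : eLpNorm (low χ J w) (ENNReal.ofReal p) volume ≤ ENNReal.ofReal (B * ‖lowL2 hχ J w‖))
    (hC : eLpNorm (high χ J w) (ENNReal.ofReal p) volume /
      eLpNorm (low χ J w) (ENNReal.ofReal p) volume ≤ ENNReal.ofReal C) :
    eLpNorm w (ENNReal.ofReal p) volume ≤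
      (ENNReal.ofReal C + 1) * ENNReal.ofReal (B * ‖lowL2 hχ J w‖) := by
  have hlow : eLpNorm (low χ J w) (ENNReal.ofReal p) volume ≠ ⊤ :=
    (hB.trans_lt ENNReal.ofReal_lt_top).ne
  -- A zero denominator is harmless: the quotient of a positive number by zero is `⊤`, so a finite
  -- bound forces the numerator to vanish.
  rw [ENNReal.div_le_iff_le_mul (Or.inr ENNReal.ofReal_ne_top) (Or.inl hlow)] at hC
  have e : (w : Plane → ℝ) = high χ J w + low χ J w := by
    funext x
    simp [high]
  have hm := (continuous_low hχ J w).aestronglyMeasurable (μ := volume)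
  have hh : AEStronglyMeasurable (high χ J w) volume := (Lp.aestronglyMeasurable w).sub hm
  calc eLpNorm w (ENNReal.ofReal p) volume
      = eLpNorm (high χ J w + low χ J w) (ENNReal.ofReal p) volume := by rw [← e]
    _ ≤ _ := eLpNorm_add_le hh hm (by simpa using ENNReal.ofReal_le_ofReal hp)
    _ ≤ ENNReal.ofReal C * eLpNorm (low χ J w) (ENNReal.ofReal p) volume +
        1 * eLpNorm (low χ J w) (ENNReal.ofReal p) volume := by
      rw [one_mul]
      exact add_le_add hC le_rfl
    _ ≤ _ := by
      rw [← add_mul]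
      exact mul_le_mul' le_rfl hB

lemma eLpNorm_add_two_le (f g : L2) :
    eLpNorm (f + g : L2) 2 volume ≤ ENNReal.ofReal (‖f‖ + ‖g‖) := by
  rw [← ENNReal.ofReal_toReal (Lp.eLpNorm_ne_top (f + g)), ← Lp.norm_def]
  exact ENNReal.ofReal_le_ofReal (norm_add_le f g)

/-- Under the frequency localization of `w`, the transfer term is controlled by the energy. -/
lemma exists_abs_transfer_le (hχ : IsCutoff χ) (J : ℤ) {p : ℝ} (hp : 2 < p) (C M : ℝ) :
    ∃ c, 0 ≤ c ∧ ∀ θ₁ θ₂ : L2, ‖θ₁‖ + ‖θ₂‖ ≤ M →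
      eLpNorm (high χ J (θ₁ - θ₂ : L2)) (ENNReal.ofReal p) volume /
        eLpNorm (low χ J (θ₁ - θ₂ : L2)) (ENNReal.ofReal p) volume ≤ ENNReal.ofReal C →
      |transfer χ J θ₁ θ₂| ≤ c * ‖lowL2 hχ J (θ₁ - θ₂)‖ ^ 2 := by
  obtain ⟨A, hA, hAt⟩ := enorm_transfer_le hχ J hp
  obtain ⟨B, hB0, hB⟩ := eLpNorm_low_le hχ J hp.le
  obtain ⟨c, hc⟩ : ∃ c : ℝ≥0∞,
      c = A * ENNReal.ofReal M * ((ENNReal.ofReal C + 1) * ENNReal.ofReal B) := ⟨_, rfl⟩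
  have hct : c ≠ ⊤ := by
    rw [hc]
    exact ENNReal.mul_ne_top (ENNReal.mul_ne_top hA ENNReal.ofReal_ne_top)
      (ENNReal.mul_ne_top (by simp) ENNReal.ofReal_ne_top)
  refine ⟨c.toReal, ENNReal.toReal_nonneg, fun θ₁ θ₂ hM hC => ?_⟩
  have hw := eLpNorm_le_of_high_div_low_le hχ (by linarith) (hB _) hC
  have hθ := (eLpNorm_add_two_le θ₁ θ₂).trans (ENNReal.ofReal_le_ofReal hM)
  set N := ‖lowL2 hχ J (θ₁ - θ₂)‖ with hN
  have hN0 : 0 ≤ N := norm_nonneg _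
  have h : ‖transfer χ J θ₁ θ₂‖ₑ ≤ c * ENNReal.ofReal (N ^ 2) := by
    refine (hAt θ₁ θ₂).trans ?_
    have e : ‖lowL2 hχ J (θ₁ - θ₂)‖ₑ = ENNReal.ofReal N := (ofReal_norm _).symm
    rw [e]
    refine (mul_le_mul' (mul_le_mul' (mul_le_mul' le_rfl hθ) hw) le_rfl).trans (le_of_eq ?_)
    rw [hc, ENNReal.ofReal_mul hB0.le, pow_two, ENNReal.ofReal_mul hN0]
    ring
  rw [← ENNReal.ofReal_toReal hct, ← ENNReal.ofReal_mul ENNReal.toReal_nonneg,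
    Real.enorm_eq_ofReal_abs] at h
  exact (ENNReal.ofReal_le_ofReal_iff (by positivity)).mp h

theorem ae_sub_eq_zero (hχ : IsCutoff χ) {α q p T : ℝ} (hα0 : 0 < α) (hα1 : α < 1 / 2)
    (hp : 2 < p) (hT : 0 < T) (J : ℤ) {θ₀ : L2} {θ₁ θ₂ : ℝ → L2}
    (h₁ : IsMarchandSolution α q T θ₀ θ₁) (h₂ : IsMarchandSolution α q T θ₀ θ₂)
    (hE : LowEnergyInequality χ J T θ₁ θ₂) (C : ℝ)
    (hC : ∀ᵐ t ∂(volume.restrict (Set.Ioo 0 T)),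
      eLpNorm (high χ J ((θ₁ t - θ₂ t : L2) : Plane → ℝ)) (ENNReal.ofReal p) volume /
        eLpNorm (low χ J ((θ₁ t - θ₂ t : L2) : Plane → ℝ)) (ENNReal.ofReal p) volume
        ≤ ENNReal.ofReal C) :
    ∀ᵐ t ∂(volume.restrict (Set.Ioo 0 T)), θ₁ t - θ₂ t = 0 := by
  obtain ⟨M₁, hM₁0, hM₁⟩ := h₁.exists_norm_le
  obtain ⟨M₂, hM₂0, hM₂⟩ := h₂.exists_norm_le
  obtain ⟨K, hK0, hK⟩ := exists_ae_norm_lowL2_sub_le hχ J hα0 hα1 hT h₁ h₂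
  obtain ⟨c, hc0, hc⟩ := exists_abs_transfer_le hχ J hp C (M₁ + M₂)
  set μ := volume.restrict (Set.Ioo 0 T) with hμ
  set E : ℝ → ℝ := fun t => ‖lowL2 hχ J (θ₁ t - θ₂ t)‖ ^ 2 with hEdef
  have hEm : AEStronglyMeasurable E μ := ((continuous_lowL2 hχ J).comp_aestronglyMeasurable
    (h₁.aestronglyMeasurable.sub h₂.aestronglyMeasurable)).norm.pow 2
  -- The quadratic bound `K² t²` is weakened to a linear one, which is all that Gronwall's
  -- inequality needs.
  have hE1 : ∀ᵐ t ∂μ, E t ≤ K ^ 2 * T * t := by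
    filter_upwards [hK, ae_restrict_mem measurableSet_Ioo] with t ht htT
    have ht0 : 0 < t := htT.1
    calc E t ≤ (K * t) ^ 2 := pow_le_pow_left₀ (norm_nonneg _) ht 2
      _ = K ^ 2 * t * t := by ring
      _ ≤ K ^ 2 * T * t := by gcongr; exact htT.2.le
  have hEi : Integrable E μ := by
    refine Integrable.of_bound hEm (K ^ 2 * T * T) ?_
    filter_upwards [hE1, ae_restrict_mem measurableSet_Ioo] with t ht htT
    rw [Real.norm_of_nonneg (by positivity)]
    exact ht.trans (by gcongr; exact htT.2.le)
  have hzero : ∀ᵐ t ∂μ, E t = 0 := by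
    refine ae_eq_zero_of_gronwall hT (C₁ := K ^ 2 * T) (c := 2 * c) (by positivity) (by positivity)
      hEm (fun t => by positivity) hE1 fun ψ hψ hψc hψT hψ0 => ?_
    have h := hE ψ hψ hψc hψT hψ0
    simp only [← norm_lowL2_sq hχ] at h
    refine h.trans ?_
    obtain ⟨B, hB⟩ := hψc.exists_bound_of_continuous hψ.continuous
    have hψE : Integrable (fun t => ψ t * E t) μ :=
      hEi.bdd_mul hψ.continuous.aestronglyMeasurable (.of_forall hB)
    rw [← integral_const_mul]
    -- If the transfer term is not integrable in time, its integral is zero by convention, and the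
    -- bound holds because the right-hand side is nonnegative.
    by_cases hi : Integrable (fun t => ψ t * (-2 * transfer χ J (θ₁ t) (θ₂ t))) μ
    · refine integral_mono_ae hi (hψE.const_mul _) ?_
      filter_upwards [hM₁, hM₂, hC] with t h1 h2 h3
      have h4 := hc _ _ (add_le_add h1 h2) h3
      have h5 := (abs_le.mp h4).1
      calc ψ t * (-2 * transfer χ J (θ₁ t) (θ₂ t)) ≤ ψ t * (2 * (c * E t)) := by
            refine mul_le_mul_of_nonneg_left ?_ (hψ0 t)
            simp only [hEdef]
            linarith
        _ = _ := by ring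
    · rw [integral_undef hi]
      exact integral_nonneg fun t => mul_nonneg (by positivity) (mul_nonneg (hψ0 t) (by positivity))
  obtain ⟨B, hB0, hB⟩ := eLpNorm_low_le hχ J hp.le
  filter_upwards [hzero, hC] with t h0 h1
  -- Vanishing of `w_{<J}` now forces `‖w‖_{L^p} = 0`.
  have h2 := eLpNorm_le_of_high_div_low_le hχ (by linarith) (hB _) h1
  rw [pow_eq_zero_iff (by norm_num)] at h0
  rw [h0, mul_zero, ENNReal.ofReal_zero, mul_zero, nonpos_iff_eq_zero,
    eLpNorm_eq_zero_iff (Lp.aestronglyMeasurable _) (by simp; linarith)] at h2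
  exact (Lp.eq_zero_iff_ae_eq_zero).mpr h2

end SQG

end

theorem theorem1p4 (χ : SQG.Plane → ℝ) (hχ : SQG.IsCutoff χ)
    (α : ℝ) (hα₀ : 0 < α) (hα₁ : α < 1 / 2)
    (q : ℝ) (hq : 1 < q) (p : ℝ) (hp : p = 2 * q / (q - 1))
    (T : ℝ) (hT : 0 < T) (J : ℤ)
    (θ₀ : SQG.L2) (hθ₀ : MemLp θ₀ (ENNReal.ofReal q) volume)
    (θ₁ θ₂ : ℝ → SQG.L2)
    (h₁ : SQG.IsMarchandSolution α q T θ₀ θ₁)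
    (h₂ : SQG.IsMarchandSolution α q T θ₀ θ₂)
    (hE : SQG.LowEnergyInequality χ J T θ₁ θ₂)
    (C : ℝ)
    (hC : ∀ᵐ t ∂(volume.restrict (Set.Ioo 0 T)),
      eLpNorm (SQG.high χ J ((θ₁ t - θ₂ t : SQG.L2) : SQG.Plane → ℝ)) (ENNReal.ofReal p) volume /
        eLpNorm (SQG.low χ J ((θ₁ t - θ₂ t : SQG.L2) : SQG.Plane → ℝ)) (ENNReal.ofReal p) volume
        ≤ ENNReal.ofReal C) :
    ∀ᵐ t ∂(volume.restrict (Set.Ioo 0 T)), θ₁ t - θ₂ t = 0 := by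
  have hp2 : 2 < p := by
    rw [hp, lt_div_iff₀ (by linarith)]
    linarith
  exact SQG.ae_sub_eq_zero hχ hα₀ hα₁ hp2 hT J h₁ h₂ hE C hC
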